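/- There are a single randomized algorithm and an absolute constant $C>0$ such that the following holds for every $n\ge 1$ and every $\varepsilon>0$. Let $A\in\mathbb R^{n\times n}$ be a stochastic matrix (non-negative entries, every column sums to $1$) with an eigendecomposition $A=Q\Lambda Q^{-1}$, where $Q\in\mathbb R^{n\times n}$ is invertible and $\Lambda=\mathrm{diag}(\lambda_1,\dots,\lambda_n)$ with $\lambda_i\in[-1,1]$, and let $\mu_\lambda=\frac1n\sum_{i=1}^n\delta_{\lambda_i}$ be its spectral distribution. The algorithm receives the accuracy $\varepsilon$ in the form of the integer $\lceil 1/\varepsilon\rceil$, and has access to $A$ only through unit-cost oracle calls that return either a uniformly random index $j\in\{1,\dots,n\}$, or, for an index $j$ obtained before, a random index distributed according to the $j$-th column of $A$ (all calls being independent); indices can be stored and tested for equality at unit cost (plus, as for every memory access, the bit length of a computed memory address), and integer arithmetic is charged by the bit lengths of the operands. The algorithm always halts, with running time and number of oracle calls at most $C e^{C/\varepsilon}$ (that is, $e^{O(1/\varepsilon)}$, independently of $n$), and with probability at least $2/3$ it outputs a finitely supported probability distribution $\hat p$ on $\mathbb R$, given by its atoms and their masses as rational numbers, such that $$W_1(\hat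 p,\mu_\lambda)\le\varepsilon ,$$ where $W_1(p,q)=\inf_\pi\int|x-y|\,d\pi(x,y)$, the infimum over all couplings $\pi$ of $p$ and $q$, is the earth mover (Wasserstein-1) distance. -/

import Mathlib

namespace SpectralSampling

open MeasureTheory
open scoped ENNReal

noncomputable section

/-! ### Column distributions, spectral distribution, earth mover distance -/

theorem sum_ofReal_column {n : ℕ} {A : Matrix (Fin n) (Fin n) ℝ}
    (hA : A ∈ Matrix.colStochastic ℝ (Fin n)) (j : Fin n) :
    ∑ i, ENNReal.ofReal (A i j) = 1 := by
  rw [← ENNReal.ofReal_sum_of_nonneg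
    (fun i _ => Matrix.nonneg_of_mem_colStochastic hA),
    Matrix.sum_col_of_mem_colStochastic hA j, ENNReal.ofReal_one]

/-- The `j`-th column of a column-stochastic matrix, as a distribution on the indices. -/
def column {n : ℕ} (A : Matrix (Fin n) (Fin n) ℝ)
    (hA : A ∈ Matrix.colStochastic ℝ (Fin n)) (j : Fin n) : PMF (Fin n) :=
  PMF.ofFintype (fun i => ENNReal.ofReal (A i j)) (sum_ofReal_column hA j)

/-- `n` equally weighted point masses at `lam 0, …, lam (n - 1)`. -/
def spectralDistribution {n : ℕ} (lam : Fin n → ℝ) : Measure ℝ :=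
  ∑ i, (n : ℝ≥0∞)⁻¹ • Measure.dirac (lam i)

/-- Earth mover (Wasserstein-1) distance: the infimum of the transport cost over all couplings.
It is `⊤` if there is no coupling. -/
def W1 (μ ν : Measure ℝ) : ℝ≥0∞ :=
  ⨅ (π : Measure (ℝ × ℝ)) (_ : π.map Prod.fst = μ ∧ π.map Prod.snd = ν),
    ∫⁻ z, edist z.1 z.2 ∂π

/-! ### Randomized programs with oracle access

A program works on a random access memory of integer cells and on a random access memory of
vertex cells. Integers are charged by bit length. Vertices (indices of rows and columns of the
matrix) are opaque unit-cost words, which can only be drawn uniformly at random, drawn from the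
column distribution of a stored vertex, and compared for equality. The dimension of the matrix
is not an input of a program. -/

/-- Addressing modes: cell number `i`, or the cell whose number is the content of integer
cell `i`. -/
inductive Loc where
  | dir (i : ℕ)
  | ind (i : ℕ)

inductive Op where
  | add
  | sub
  | mul
  | div

inductive Prog where
  /-- integer cell `d` := the constant `z` -/
  | const (d : Loc) (z : ℤ)
  /-- integer cell `d` := content of integer cell `a` -/
  | copy (d a : Loc)
  /-- integer cell `d` := `a o b` -/
  | arith (o : Op) (d a b : Loc)
  /-- vertex cell `d` := a uniformly random vertex -/
  | unif (d : Loc)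
  /-- vertex cell `d` := a sample from the column named by vertex cell `v` -/
  | sample (d v : Loc)
  /-- integer cell `d` := `1` if vertex cells `v` and `w` agree, else `0` -/
  | test (d v w : Loc)
  | seq (p q : Prog)
  /-- run `p` if integer cell `a` is positive, else `q` -/
  | cond (a : Loc) (p q : Prog)
  /-- repeat `p` as long as integer cell `a` is positive -/
  | loop (a : Loc) (p : Prog)

/-- The two memories, with the running time and the number of oracle calls so far. -/
structure State (n : ℕ) where
  mem : ℕ → ℤ
  vtx : ℕ → Option (Fin n)
  time : ℕ
  queries : ℕ

/-- Bit length of the absolute value. -/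
def bits (z : ℤ) : ℕ := z.natAbs.size

def Op.eval : Op → ℤ → ℤ → ℤ
  | .add, x, y => x + y
  | .sub, x, y => x - y
  | .mul, x, y => x * y
  | .div, x, y => x / y

namespace State

variable {n : ℕ}

/-- The cell number that a location refers to. -/
def addr (s : State n) : Loc → ℕ
  | .dir i => i
  | .ind i => (s.mem i).toNat

/-- The cost of resolving an address. -/
def addrCost (s : State n) : Loc → ℕ
  | .dir _ => 1
  | .ind i => 1 + bits (s.mem i)

def val (s : State n) (a : Loc) : ℤ := s.mem (s.addr a)

def vert (s : State n) (v : Loc) : Option (Fin n) := s.vtx (s.addr v)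

def setMem (s : State n) (d : Loc) (z : ℤ) : State n :=
  { s with mem := Function.update s.mem (s.addr d) z }

def setVtx (s : State n) (d : Loc) (v : Option (Fin n)) : State n :=
  { s with vtx := Function.update s.vtx (s.addr d) v }

def charge (s : State n) (t : ℕ) : State n := { s with time := s.time + t }

/-- Count one oracle call. -/
def query (s : State n) : State n := { s with queries := s.queries + 1 }

/-- The input is written to integer cell `0`; all other integer cells hold `0` and all vertex
cells are empty. -/
def init (n : ℕ) (k : ℕ) : State n where
  mem := Function.update (fun _ => 0) 0 (k : ℤ)
  vtx := fun _ => none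
  time := 0
  queries := 0

/-! The output is a finitely supported distribution: integer cell `0` holds a common denominator
`D`, integer cell `1` the number `m` of atoms, and for `i < m` the integer cells `2 + 2 i` and
`3 + 2 i` hold `x i` and `w i`; the `i`-th atom has location `x i / D` and mass
`w i / ∑ j < m, w j`. -/

def atoms (s : State n) : ℕ := (s.mem 1).toNat

def location (s : State n) (i : ℕ) : ℝ := (s.mem (2 + 2 * i) : ℝ) / (s.mem 0 : ℝ)

def weight (s : State n) (i : ℕ) : ℤ := s.mem (3 + 2 * i)

def totalWeight (s : State n) : ℤ := ∑ i ∈ Finset.range s.atoms, s.weight i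

/-- The memory contents encode a distribution. -/
def WellFormed (s : State n) : Prop :=
  0 < s.mem 0 ∧ (∀ i < s.atoms, 0 ≤ s.weight i) ∧ 0 < s.totalWeight

/-- The encoded distribution. -/
def output (s : State n) : Measure ℝ :=
  ∑ i ∈ Finset.range s.atoms,
    ENNReal.ofReal ((s.weight i : ℝ) / (s.totalWeight : ℝ)) • Measure.dirac (s.location i)

end State

/-- The distribution of the final state of a program that has access to the column
distributions `col`. The result is `none` on those runs whose recursion depth exceeds `fuel`, and
does not depend on `fuel` on the other runs. -/
def exec {n : ℕ} [NeZero n] (col : Fin n → PMF (Fin n)) :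
    (fuel : ℕ) → Prog → State n → PMF (Option (State n))
  | 0, _, _ => PMF.pure none
  | fuel + 1, p, s =>
    match p with
    | .const d z =>
        PMF.pure (some ((s.setMem d z).charge (1 + s.addrCost d + bits z)))
    | .copy d a =>
        PMF.pure (some ((s.setMem d (s.val a)).charge
          (1 + s.addrCost d + s.addrCost a + bits (s.val a))))
    | .arith o d a b =>
        PMF.pure (some ((s.setMem d (o.eval (s.val a) (s.val b))).charge
          (s.addrCost d + s.addrCost a + s.addrCost b
            + (1 + bits (s.val a)) * (1 + bits (s.val b)))))
    | .unif d =>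
        (PMF.uniformOfFintype (Fin n)).map fun j =>
          some (((s.setVtx d (some j)).charge (1 + s.addrCost d)).query)
    | .sample d v =>
        (match s.vert v with
          | none => PMF.pure none
          | some j => (col j).map some).map fun x =>
            some (((s.setVtx d x).charge (1 + s.addrCost d + s.addrCost v)).query)
    | .test d v w =>
        PMF.pure (some ((s.setMem d (if s.vert v = s.vert w then 1 else 0)).charge
          (1 + s.addrCost d + s.addrCost v + s.addrCost w)))
    | .seq p q =>
        (exec col fuel p s).bind fun r => r.elim (PMF.pure none) (exec col fuel q)
    | .cond a p q =>
        let s' := s.charge (1 + s.addrCost a + bits (s.val a))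
        if 0 < s.val a then exec col fuel p s' else exec col fuel q s'
    | .loop a p =>
        let s' := s.charge (1 + s.addrCost a + bits (s.val a))
        if 0 < s.val a then
          (exec col fuel p s').bind fun r => r.elim (PMF.pure none) (exec col fuel (.loop a p))
        else PMF.pure (some s')

end

end SpectralSampling

/-! A walk from a uniformly random vertex is back after j steps with probability tr(A^j)/n, which is
the j-th moment of the spectral distribution (`returnProb_eq`). Return frequencies therefore
estimate moments at a cost that does not involve n. With k = ⌈1/ε⌉, m = 256k and G = 65536^m, the
algorithm runs G^3 walks of length 8m. Chebyshev's inequality for each j and a union bound show that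
all frequencies with j ≤ 8m are within 1/G of the moments with probability at least 2/3
(`reps_bad_le`).

The moments become a distribution by smoothing. Let D(u) = sin((2m+1)φ)/sin φ with u = sin φ; this
is an even polynomial of degree 2m in u. Its fourth power is non-negative, is of order (2m+1)^4 for
|u| ≤ 1/(2m+1), and is at most u^(-4), so its mean distance from the centre is O(1/m) (`gsum_lower`,
`gsum_moment`). The grid point y/G receives the average over the eigenvalues of D((λ - y/G)/4)^4.
This is a polynomial of degree 8m in λ, hence a linear combination of the estimated moments. The
grid covers [-2, 2] although the spectrum lies in [-1, 1]: then every eigenvalue distributes nearly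
the same total mass, the differences being bounded by the kernel's tail (`gsum_tail`). Such a nearly
stochastic kernel yields a cheap coupling (`W1_le_of_kernel`).

The coefficients of the kernel polynomial amplify errors exponentially in m, by (22/4)^(4m) up to a
linear factor, but the moments are known to the smaller precision 65536^(-m) (`noise_le`,
`weight_close`). A constant shift makes all computed weights non-negative; it contributes mass O(G),
against kernel mass of order G m^3, so it is harmless (`W1_weights_le`).

The program never computes coefficients. It evaluates the polynomial at a huge integer B, multiplies
by the return counts written in reverse as digits in base B, and reads off the middle digit, which
is the wanted inner product up to a rounding of one unit (`digit_eq`, `weightOf_eq`). All bit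
lengths are polynomial in m, and the total time is O(G^6) = e^(O(1/ε)) (`totalTime_le`, `cost_le`).

Correctness of the program is separated from probability. `Eff` describes its deterministic pieces.
`Sim` couples its final state with an abstract random variable; for the whole program this is the
vector of return counts, of law `reps`, so that the probabilistic estimates concern `reps` only
(`sim_spectralProgram`). -/

namespace SpectralSampling

open MeasureTheory
open scoped ENNReal

noncomputable section

/-! ### The kernel polynomials -/

/-- Scaled Dirichlet kernels: for `V = 2 * cos (2 * φ)` and `E = 1` the value at `j` is
`sin ((2 * j + 1) * φ) / sin φ`. -/
def kseq {R : Type*} [CommRing R] (V E : R) : ℕ → R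
  | 0 => 1
  | 1 => V + E
  | j + 2 => V * kseq V E (j + 1) - E ^ 2 * kseq V E j

/-- The same recursion is run on integers by the program, on integer polynomials for coefficient
bounds, and on reals for the analysis; evaluation maps connect the three. -/
theorem kseq_map {R S : Type*} [CommRing R] [CommRing S] (f : R →+* S) (V E : R) (j : ℕ) :
    f (kseq V E j) = kseq (f V) (f E) j := by
  induction j using Nat.twoStepInduction with
  | zero => simp [kseq]
  | one => simp [kseq]
  | more j h1 h2 => simp [kseq, h1, h2]

/-- Homogeneity clears denominators: a suitable `E` makes the multiplier an integer polynomial at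
the price of a known power of `E`. -/
theorem kseq_scale {R : Type*} [CommRing R] (v E : R) (j : ℕ) :
    kseq (E * v) E j = E ^ j * kseq v 1 j := by
  induction j using Nat.twoStepInduction with
  | zero => simp [kseq]
  | one => simp [kseq]; ring
  | more j h1 h2 => simp only [kseq, h1, h2]; ring

/-- The Dirichlet kernel of degree `2 * m` as a polynomial function of `u = sin φ`. -/
def dker (m : ℕ) (u : ℝ) : ℝ := kseq (2 - 4 * u ^ 2) 1 m

/-- The recursion is the identity sin(a + 2φ) + sin(a - 2φ) = 2 cos(2φ) sin a. -/
theorem dker_sin_mul (m : ℕ) (φ : ℝ) :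
    dker m (Real.sin φ) * Real.sin φ = Real.sin ((2 * m + 1) * φ) := by
  unfold dker
  have hv : 2 - 4 * Real.sin φ ^ 2 = 2 * Real.cos (2 * φ) := by
    rw [Real.cos_two_mul, Real.cos_sq']; ring
  induction m using Nat.twoStepInduction with
  | zero => simp [kseq]
  | one =>
    simp only [kseq]
    have := Real.sin_three_mul φ
    push_cast
    rw [show (2 * 1 + 1 : ℝ) * φ = 3 * φ by ring, this]; ring
  | more j h1 h2 =>
    simp only [kseq]
    rw [sub_mul, mul_assoc, h2, one_pow, one_mul, h1, hv]
    have e1 : (2 * ((j + 2 : ℕ) : ℝ) + 1) * φ = (2 * ((j + 1 : ℕ) : ℝ) + 1) * φ + 2 * φ := by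
      push_cast; ring
    have e2 : (2 * (j : ℝ) + 1) * φ = (2 * ((j + 1 : ℕ) : ℝ) + 1) * φ - 2 * φ := by
      push_cast; ring
    rw [e1, e2, Real.sin_add, Real.sin_sub]; ring

/-- A sine is bounded by one. This decay, raised to the fourth power, keeps the first moment of the
kernel small. -/
theorem abs_dker_mul_abs_le_one (m : ℕ) {u : ℝ} (h : |u| ≤ 1) : |dker m u| * |u| ≤ 1 := by
  rw [abs_le] at h
  rw [← Real.sin_arcsin h.1 h.2, ← abs_mul, dker_sin_mul]
  exact Real.abs_sin_le_one _

theorem dker_zero (m : ℕ) : dker m 0 = 2 * m + 1 := by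
  unfold dker
  induction m using Nat.twoStepInduction with
  | zero => simp [kseq]
  | one => norm_num [kseq]
  | more j h1 h2 => simp only [kseq]; rw [h1, h2]; push_cast; ring

/-- Put u = sin φ and use Jordan's inequality sin x ≥ 2x/π on [0, π/2] twice: at φ, which shows
(2m+1)φ ≤ π/2, and then at (2m+1)φ. The loss 2/π is at least 1/2, and u ≤ φ allows division by u. -/
theorem half_le_dker (m : ℕ) {u : ℝ} (h : (2 * m + 1) * |u| ≤ 1) :
    (2 * m + 1) / 2 ≤ dker m u := by
  rcases eq_or_ne u 0 with rfl | hu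
  · rw [dker_zero]
    have : (0 : ℝ) ≤ m := by positivity
    linarith
  wlog hpos : 0 < u generalizing u
  · have := this (u := -u) (by simpa using h) (by simpa using hu)
      (by have := lt_of_le_of_ne (not_lt.mp hpos) hu; linarith)
    simpa [dker] using this
  have hm : (0 : ℝ) ≤ m := by positivity
  rw [abs_of_pos hpos] at h
  have h1 : u ≤ 1 := by nlinarith
  set φ := Real.arcsin u with hφ
  have hsin : Real.sin φ = u := Real.sin_arcsin (by linarith) h1
  have hφ0 : 0 < φ := Real.arcsin_pos.mpr hpos
  have hφ1 : φ ≤ Real.pi / 2 := Real.arcsin_le_pi_div_two u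
  have hj : 2 / Real.pi * φ ≤ u := by
    rw [← hsin]; exact Real.mul_le_sin hφ0.le hφ1
  have hpi := Real.pi_pos
  have hpi4 := Real.pi_le_four
  have hφu : φ ≤ Real.pi / 2 * u := by
    rw [div_mul_eq_mul_div, div_le_iff₀ hpi] at hj
    linarith
  have hn : (2 * m + 1) * φ ≤ Real.pi / 2 := by
    calc (2 * (m : ℝ) + 1) * φ ≤ (2 * m + 1) * (Real.pi / 2 * u) := by gcongr
      _ = Real.pi / 2 * ((2 * m + 1) * u) := by ring
      _ ≤ Real.pi / 2 * 1 := by gcongr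
      _ = _ := by ring
  have h2 : 2 / Real.pi * ((2 * m + 1) * φ) ≤ Real.sin ((2 * m + 1) * φ) :=
    Real.mul_le_sin (by positivity) hn
  have h3 : dker m u * u = Real.sin ((2 * m + 1) * φ) := by
    rw [← dker_sin_mul, hsin]
  have h4 : u ≤ φ := by rw [← hsin]; exact Real.sin_le hφ0.le
  have h5 : (2 * m + 1) / 2 * u ≤ dker m u * u := by
    rw [h3]
    refine le_trans ?_ h2
    have : (1 : ℝ) / 2 ≤ 2 / Real.pi := by
      rw [div_le_div_iff₀ (by norm_num) hpi]; linarith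
    calc (2 * (m : ℝ) + 1) / 2 * u = 1 / 2 * ((2 * m + 1) * u) := by ring
      _ ≤ 2 / Real.pi * ((2 * m + 1) * φ) := by gcongr
  exact le_of_mul_le_mul_right h5 hpos

/-! ### Sums of the fourth power of the kernel over a grid -/

/-- The fourth power of the kernel at the grid point `d / (4 * G)`. -/
def gker (m G : ℕ) (d : ℤ) : ℝ := dker m ((d : ℝ) / (4 * G)) ^ 4

theorem gker_nonneg (m G : ℕ) (d : ℤ) : 0 ≤ gker m G d := by
  unfold gker; positivity

theorem gker_mul_pow_le {m G : ℕ} (hG : 0 < G) {d : ℤ} (hd : |d| ≤ 4 * G) :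
    gker m G d * ((|d| : ℤ) : ℝ) ^ 4 ≤ 256 * (G : ℝ) ^ 4 := by
  have hG' : (0 : ℝ) < G := by exact_mod_cast hG
  have hd' : |(d : ℝ)| ≤ 4 * G := by exact_mod_cast hd
  have h := abs_dker_mul_abs_le_one m (u := (d : ℝ) / (4 * G)) (by
    rw [abs_div, abs_of_pos (by positivity : (0 : ℝ) < 4 * G), div_le_one (by positivity)]
    exact hd')
  have h2 : |dker m ((d : ℝ) / (4 * G))| * |(d : ℝ)| ≤ 4 * G := by
    rw [abs_div, abs_of_pos (by positivity : (0 : ℝ) < 4 * G), ← mul_div_assoc,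
      div_le_one (by positivity)] at h
    exact h
  have h3 := pow_le_pow_left₀ (by positivity) h2 4
  rw [mul_pow, Even.pow_abs (by decide)] at h3
  unfold gker
  push_cast
  linarith [h3]

theorem sum_Icc_symm (f : ℤ → ℝ) (hf : ∀ d, f (-d) = f d) (R : ℕ) :
    ∑ d ∈ Finset.Icc (-(R : ℤ)) R, f d = f 0 + 2 * ∑ d ∈ Finset.Icc 1 R, f (d : ℕ) := by
  induction R with
  | zero => simp
  | succ R ih =>
    rw [Finset.sum_Icc_succ_top (by omega)]
    have : Finset.Icc (-((R + 1 : ℕ) : ℤ)) ((R + 1 : ℕ) : ℤ) =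
        insert (-((R + 1 : ℕ) : ℤ)) (insert ((R + 1 : ℕ) : ℤ) (Finset.Icc (-(R : ℤ)) R)) := by
      ext x; simp only [Finset.mem_Icc, Finset.mem_insert]; omega
    rw [this, Finset.sum_insert (by simp; omega), Finset.sum_insert (by simp), ih, hf]
    ring

/-- Sum of the kernel over the window `[-R, R]`. -/
def gsum (m G R : ℕ) : ℝ := ∑ d ∈ Finset.Icc (-(R : ℤ)) R, gker m G d

/-- With n = 2m + 1, `half_le_dker` gives at least (n/2)^4 at each of the 2K + 1 ≥ 4G/n points with
|d| ≤ K = ⌊4G/n⌋; the condition n ≥ 4 keeps them inside the window. -/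
theorem gsum_lower {m G : ℕ} (hG : 0 < G) (hm : 4 ≤ 2 * m + 1) :
    (G : ℝ) * (2 * m + 1) ^ 3 / 4 ≤ gsum m G G := by
  set n : ℕ := 2 * m + 1 with hn
  set K := 4 * G / n with hK
  have hKG : K ≤ G := by
    rw [hK]; exact Nat.div_le_of_le_mul (Nat.mul_le_mul_right _ hm)
  have hGp : (0 : ℝ) < G := by exact_mod_cast hG
  have hnp : (0 : ℝ) < n := by positivity
  have hnR : (2 * (m : ℝ) + 1) = n := by rw [hn]; push_cast; ring
  have hlow : ∀ d ∈ Finset.Icc (-(K : ℤ)) K, (n : ℝ) ^ 4 / 16 ≤ gker m G d := by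
    intro d hd
    rw [Finset.mem_Icc] at hd
    have h1 : |d| ≤ K := abs_le.mpr hd
    have h2 : |(d : ℝ)| ≤ K := by exact_mod_cast h1
    have h3 : (K : ℝ) * n ≤ 4 * G := by exact_mod_cast Nat.div_mul_le_self (4 * G) n
    have h4 : (n : ℝ) / 2 ≤ dker m ((d : ℝ) / (4 * G)) := by
      rw [← hnR]
      apply half_le_dker
      rw [hnR, abs_div, abs_of_pos (by positivity : (0 : ℝ) < 4 * G), ← mul_div_assoc,
        div_le_one (by positivity)]
      nlinarith
    have := pow_le_pow_left₀ (by positivity) h4 4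
    unfold gker
    calc (n : ℝ) ^ 4 / 16 = (n / 2 : ℝ) ^ 4 := by ring
      _ ≤ _ := this
  have hcard : (4 * G : ℝ) / n ≤ ((Finset.Icc (-(K : ℤ)) K).card : ℝ) := by
    have h1 : 4 * G < n * (K + 1) := by
      rw [hK]; exact Nat.lt_mul_div_succ _ (by omega)
    have h2 : (Finset.Icc (-(K : ℤ)) K).card = 2 * K + 1 := by
      rw [Int.card_Icc]; omega
    rw [h2, div_le_iff₀ hnp]
    have : (4 * G : ℝ) < n * (K + 1) := by exact_mod_cast h1
    push_cast
    nlinarith [(Nat.cast_nonneg K : (0 : ℝ) ≤ K)]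
  rw [hnR]
  calc (G : ℝ) * n ^ 3 / 4 = (4 * G / n) * (n ^ 4 / 16) := by field_simp; ring
    _ ≤ ((Finset.Icc (-(K : ℤ)) K).card : ℝ) * (n ^ 4 / 16) := by gcongr
    _ = ∑ d ∈ Finset.Icc (-(K : ℤ)) K, (n : ℝ) ^ 4 / 16 := by simp
    _ ≤ ∑ d ∈ Finset.Icc (-(K : ℤ)) K, gker m G d := Finset.sum_le_sum hlow
    _ ≤ _ := by
      apply Finset.sum_le_sum_of_subset_of_nonneg
      · apply Finset.Icc_subset_Icc <;> omega
      · intros; exact gker_nonneg _ _ _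

/-- Each of the 4G additional points has |u| ≥ 1/4, so the kernel there is at most 4^4. -/
theorem gsum_tail {m G : ℕ} (hG : 0 < G) : gsum m G (3 * G) ≤ gsum m G G + 1024 * G := by
  have hGp : (0 : ℝ) < G := by exact_mod_cast hG
  have hsub : Finset.Icc (-(G : ℤ)) G ⊆ Finset.Icc (-((3 * G : ℕ) : ℤ)) ((3 * G : ℕ) : ℤ) := by
    apply Finset.Icc_subset_Icc <;> push_cast <;> omega
  unfold gsum
  rw [← Finset.sum_sdiff hsub, add_comm]
  gcongr
  have hb : ∀ d ∈ Finset.Icc (-((3 * G : ℕ) : ℤ)) ((3 * G : ℕ) : ℤ) \ Finset.Icc (-(G : ℤ)) G,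
      gker m G d ≤ 256 := by
    intro d hd
    simp only [Finset.mem_sdiff, Finset.mem_Icc, not_and, not_le] at hd
    have h1 : |d| ≤ 4 * G := by rw [abs_le]; push_cast at hd; omega
    have h2 : (G : ℤ) ≤ |d| := by
      by_contra! h
      have := abs_lt.mp h
      have := hd.2 this.1.le
      omega
    have h3 : (G : ℝ) ≤ ((|d| : ℤ) : ℝ) := by exact_mod_cast h2
    have h4 := gker_mul_pow_le (m := m) hG h1
    have h5 : gker m G d * (G : ℝ) ^ 4 ≤ 256 * (G : ℝ) ^ 4 := by
      refine le_trans ?_ h4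
      have := gker_nonneg m G d
      gcongr
    exact le_of_mul_le_mul_right h5 (by positivity)
  refine (Finset.sum_le_card_nsmul _ _ _ hb).trans ?_
  rw [Finset.card_sdiff_of_subset hsub, Int.card_Icc, Int.card_Icc]
  have : (((3 * G : ℕ) : ℤ) + 1 - -((3 * G : ℕ) : ℤ)).toNat - ((G : ℤ) + 1 - -(G : ℤ)).toNat
      = 4 * G := by omega
  rw [this, nsmul_eq_mul]
  push_cast
  linarith

theorem sum_inv_sq_le (K R : ℕ) (hK : 0 < K) :
    ∑ d ∈ Finset.Icc (K + 1) R, ((d : ℝ) ^ 2)⁻¹ ≤ (K : ℝ)⁻¹ := by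
  rcases le_or_gt K R with h | h
  · have := sum_Ioc_inv_sq_le_sub (α := ℝ) hK.ne' h
    have e : Finset.Icc (K + 1) R = Finset.Ioc K R := by
      ext x; simp only [Finset.mem_Icc, Finset.mem_Ioc]; omega
    rw [e]
    have h0 : (0 : ℝ) ≤ (R : ℝ)⁻¹ := by positivity
    linarith
  · rw [Finset.Icc_eq_empty (by omega)]; simp

/-- First absolute moment of the kernel over the window `[-3 * G, 3 * G]`. -/
theorem gsum_moment {m G : ℕ} (hG : 2 * m + 1 ≤ G) :
    ∑ d ∈ Finset.Icc (-((3 * G : ℕ) : ℤ)) ((3 * G : ℕ) : ℤ),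
        gker m G d * (((|d| : ℤ) : ℝ) / (4 * G))
      ≤ gsum m G (3 * G) / (2 * m + 1) + 16 * G * (2 * m + 1) ^ 2 := by
  set n : ℕ := 2 * m + 1 with hn
  have hG0 : 0 < G := by omega
  set K := 4 * G / n with hK
  have hGp : (0 : ℝ) < G := by exact_mod_cast hG0
  have hnp : (0 : ℝ) < n := by positivity
  have hnR : (2 * (m : ℝ) + 1) = n := by rw [hn]; push_cast; ring
  rw [hnR]
  have hKlt : 4 * G < n * (K + 1) := by
    rw [hK]; exact Nat.lt_mul_div_succ _ (by omega)
  have hKpos : 0 < K := by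
    rw [hK]; exact Nat.div_pos (by omega) (by omega)
  -- As n ≤ G, rounding 4G/n down loses less than half of it.
  have hKbig : (2 * G : ℝ) / n ≤ K := by
    rw [div_le_iff₀ hnp]
    have h1 : (4 * G : ℝ) < n * (K + 1) := by exact_mod_cast hKlt
    have h2 : (n : ℝ) ≤ G := by exact_mod_cast hG
    nlinarith
  -- Near the centre the distance itself is at most 1/n. Beyond K the fourth-power decay bounds the
  -- term by 64 G^3/|d|^3, and 4G < n|d| trades one factor 1/|d| for n/(4G), which leaves the
  -- summable 1/d^2.
  have key : ∀ d : ℤ, |d| ≤ 4 * G → gker m G d * (((|d| : ℤ) : ℝ) / (4 * G)) ≤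
      gker m G d / n + (if (K : ℤ) < |d| then 16 * n * (G : ℝ) ^ 2 * (((|d| : ℤ) : ℝ) ^ 2)⁻¹
        else 0) := by
    intro d hd
    have g0 := gker_nonneg m G d
    split_ifs with h
    · have h1 : (K + 1 : ℤ) ≤ |d| := h
      have h2 : (4 * G : ℝ) < n * ((|d| : ℤ) : ℝ) := by
        have : (4 * G : ℤ) < n * |d| := by
          calc (4 * G : ℤ) < n * (K + 1) := by exact_mod_cast hKlt
            _ ≤ n * |d| := by gcongr
        exact_mod_cast this
      set x : ℝ := ((|d| : ℤ) : ℝ) with hx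
      have hxp : 0 < x := by
        by_contra! hh
        nlinarith
      have h3 := gker_mul_pow_le (m := m) hG0 hd
      rw [← hx] at h3
      have h4 : gker m G d * (x / (4 * G)) ≤ 16 * n * (G : ℝ) ^ 2 * (x ^ 2)⁻¹ := by
        rw [← div_eq_mul_inv, ← mul_div_assoc, div_le_div_iff₀ (by positivity) (by positivity)]
        have h5 : gker m G d * x * x ^ 2 * x ≤ 256 * (G : ℝ) ^ 4 := by
          calc _ = gker m G d * x ^ 4 := by ring
            _ ≤ _ := h3
        have h6 : 256 * (G : ℝ) ^ 4 ≤ 16 * n * G ^ 2 * (4 * G) * x := by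
          calc 256 * (G : ℝ) ^ 4 = 64 * G ^ 3 * (4 * G) := by ring
            _ ≤ 64 * G ^ 3 * (n * x) := by gcongr
            _ = _ := by ring
        exact le_of_mul_le_mul_right (h5.trans h6) hxp
      have : 0 ≤ gker m G d / n := by positivity
      linarith
    · push Not at h
      have h1 : ((|d| : ℤ) : ℝ) ≤ K := by exact_mod_cast h
      have h3 : (K : ℝ) * n ≤ 4 * G := by exact_mod_cast Nat.div_mul_le_self (4 * G) n
      rw [add_zero, div_eq_mul_inv (gker m G d)]
      gcongr
      rw [div_le_iff₀ (by positivity), inv_mul_eq_div, le_div_iff₀ hnp]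
      nlinarith
  calc _ ≤ ∑ d ∈ Finset.Icc (-((3 * G : ℕ) : ℤ)) ((3 * G : ℕ) : ℤ),
        (gker m G d / n + (if (K : ℤ) < |d| then
          16 * n * (G : ℝ) ^ 2 * (((|d| : ℤ) : ℝ) ^ 2)⁻¹ else 0)) := by
        apply Finset.sum_le_sum
        intro d hd
        apply key
        rw [Finset.mem_Icc] at hd
        rw [abs_le]; push_cast at hd; omega
    _ = gsum m G (3 * G) / n + ∑ d ∈ Finset.Icc (-((3 * G : ℕ) : ℤ)) ((3 * G : ℕ) : ℤ),
        (if (K : ℤ) < |d| then 16 * n * (G : ℝ) ^ 2 * (((|d| : ℤ) : ℝ) ^ 2)⁻¹ else 0) := by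
        rw [Finset.sum_add_distrib, gsum, Finset.sum_div]
    _ ≤ _ := by
        gcongr
        rw [sum_Icc_symm _ (by simp)]
        have e0 : ¬ ((K : ℤ) < |(0 : ℤ)|) := by simp
        rw [if_neg e0, zero_add]
        have e1 : ∑ d ∈ Finset.Icc 1 (3 * G), (if (K : ℤ) < |((d : ℕ) : ℤ)| then
            16 * n * (G : ℝ) ^ 2 * (((|((d : ℕ) : ℤ)| : ℤ) : ℝ) ^ 2)⁻¹ else 0) =
            ∑ d ∈ Finset.Icc (K + 1) (3 * G), 16 * n * (G : ℝ) ^ 2 * ((d : ℝ) ^ 2)⁻¹ := by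
          rw [← Finset.sum_filter]
          apply Finset.sum_congr
          · ext x
            simp only [Finset.mem_filter, Finset.mem_Icc, Nat.abs_cast]
            omega
          · intro x _
            simp
        rw [e1, ← Finset.mul_sum]
        have h1 := sum_inv_sq_le K (3 * G) hKpos
        have h2 : (K : ℝ)⁻¹ ≤ n / (2 * G) := by
          rw [← inv_div]
          exact inv_anti₀ (by positivity) hKbig
        calc 2 * (16 * n * (G : ℝ) ^ 2 * _) ≤ 2 * (16 * n * (G : ℝ) ^ 2 * (n / (2 * G))) := by
              gcongr; exact h1.trans h2
          _ = _ := by field_simp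

/-! ### Kernel sums over the grid seen from a shifted centre -/

theorem sum_window (f : ℤ → ℝ) (x : ℤ) (R : ℕ) :
    ∑ i ∈ Finset.Icc (-(R : ℤ)) R, f (x - i) = ∑ d ∈ Finset.Icc (x - R) (x + R), f d := by
  refine Finset.sum_bij' (fun i _ => x - i) (fun d _ => x - d) ?_ ?_ ?_ ?_ ?_
  · intro i hi; simp only [Finset.mem_Icc] at hi ⊢; omega
  · intro i hi; simp only [Finset.mem_Icc] at hi ⊢; omega
  · intro i _; ring
  · intro i _; ring
  · intro i _; rfl

/-- The differences x - i fill [x - 2G, x + 2G], which lies between [-G, G] and [-3G, 3G] whatever x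
is. This bound and `le_sum_window` make the row sums nearly independent of the eigenvalue. -/
theorem sum_window_le {f : ℤ → ℝ} (hf : ∀ d, 0 ≤ f d) {G : ℕ} {x : ℤ} (hx : |x| ≤ G) :
    ∑ i ∈ Finset.Icc (-((2 * G : ℕ) : ℤ)) ((2 * G : ℕ) : ℤ), f (x - i) ≤
      ∑ d ∈ Finset.Icc (-((3 * G : ℕ) : ℤ)) ((3 * G : ℕ) : ℤ), f d := by
  rw [sum_window]
  rw [abs_le] at hx
  apply Finset.sum_le_sum_of_subset_of_nonneg
  · apply Finset.Icc_subset_Icc <;> push_cast <;> omega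
  · intros; exact hf _

theorem le_sum_window {f : ℤ → ℝ} (hf : ∀ d, 0 ≤ f d) {G : ℕ} {x : ℤ} (hx : |x| ≤ G) :
    ∑ d ∈ Finset.Icc (-(G : ℤ)) G, f d ≤
      ∑ i ∈ Finset.Icc (-((2 * G : ℕ) : ℤ)) ((2 * G : ℕ) : ℤ), f (x - i) := by
  rw [sum_window]
  rw [abs_le] at hx
  apply Finset.sum_le_sum_of_subset_of_nonneg
  · apply Finset.Icc_subset_Icc <;> push_cast <;> omega
  · intros; exact hf _

end

end SpectralSampling

namespace SpectralSampling

open MeasureTheory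
open scoped ENNReal

noncomputable section

open Polynomial

/-! ### Coefficient norms of integer polynomials -/

/-- The sum of the absolute values of the coefficients. -/
def l1 (p : ℤ[X]) : ℤ := ∑ i ∈ p.support, |p.coeff i|

theorem l1_eq_sum (p : ℤ[X]) {s : Finset ℕ} (h : p.support ⊆ s) :
    l1 p = ∑ i ∈ s, |p.coeff i| := by
  refine Finset.sum_subset h fun i _ hi => ?_
  rw [notMem_support_iff.mp hi, abs_zero]

theorem l1_nonneg (p : ℤ[X]) : 0 ≤ l1 p := Finset.sum_nonneg fun _ _ => abs_nonneg _

theorem l1_add_le (p q : ℤ[X]) : l1 (p + q) ≤ l1 p + l1 q := by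
  rw [l1_eq_sum (p + q) support_add, l1_eq_sum p Finset.subset_union_left,
    l1_eq_sum q Finset.subset_union_right, ← Finset.sum_add_distrib]
  refine Finset.sum_le_sum fun i _ => ?_
  rw [coeff_add]; exact abs_add_le _ _

theorem l1_neg (p : ℤ[X]) : l1 (-p) = l1 p := by simp [l1]

theorem l1_sub_le (p q : ℤ[X]) : l1 (p - q) ≤ l1 p + l1 q := by
  rw [sub_eq_add_neg, ← l1_neg q]; exact l1_add_le _ _

theorem l1_monomial (i : ℕ) (a : ℤ) : l1 (monomial i a) = |a| := by
  rw [l1_eq_sum _ (support_monomial_subset i a)]; simp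

theorem l1_C (a : ℤ) : l1 (C a) = |a| := l1_monomial 0 a

theorem l1_sum_le {ι : Type*} (s : Finset ι) (f : ι → ℤ[X]) :
    l1 (∑ i ∈ s, f i) ≤ ∑ i ∈ s, l1 (f i) := by
  classical
  induction s using Finset.induction_on with
  | empty => simp [l1]
  | insert a s ha ih =>
    rw [Finset.sum_insert ha, Finset.sum_insert ha]
    exact (l1_add_le _ _).trans (by gcongr)

theorem l1_monomial_mul_le (i : ℕ) (a : ℤ) (q : ℤ[X]) : l1 (monomial i a * q) ≤ |a| * l1 q := by
  conv_lhs => rw [q.as_sum_support]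
  rw [Finset.mul_sum]
  refine (l1_sum_le _ _).trans ?_
  rw [l1, Finset.mul_sum]
  refine Finset.sum_le_sum fun j _ => ?_
  rw [monomial_mul_monomial, l1_monomial, abs_mul]

theorem l1_mul_le (p q : ℤ[X]) : l1 (p * q) ≤ l1 p * l1 q := by
  conv_lhs => rw [p.as_sum_support]
  rw [Finset.sum_mul]
  refine (l1_sum_le _ _).trans ?_
  rw [l1, Finset.sum_mul]
  exact Finset.sum_le_sum fun i _ => l1_monomial_mul_le _ _ _

theorem l1_pow_le (p : ℤ[X]) (j : ℕ) : l1 (p ^ j) ≤ l1 p ^ j := by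
  induction j with
  | zero => rw [pow_zero, pow_zero, ← C_1, l1_C]; simp
  | succ j ih =>
    rw [pow_succ, pow_succ]
    exact (l1_mul_le _ _).trans (mul_le_mul_of_nonneg_right ih (l1_nonneg _))

theorem natDegree_kseq_le {V E : ℤ[X]} (hV : V.natDegree ≤ 2) (hE : E.natDegree = 0) (j : ℕ) :
    (kseq V E j).natDegree ≤ 2 * j := by
  induction j using Nat.twoStepInduction with
  | zero => simp [kseq]
  | one =>
    simp only [kseq]
    exact (natDegree_add_le _ _).trans (by rw [hE]; simpa using hV)
  | more j h1 h2 =>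
    simp only [kseq]
    refine (natDegree_sub_le _ _).trans (max_le ?_ ?_)
    · exact natDegree_mul_le.trans (by omega)
    · refine natDegree_mul_le.trans ?_
      have : (E ^ 2).natDegree ≤ 0 := natDegree_pow_le.trans (by rw [hE])
      omega

/-- A growth bound for the kernel recursion with respect to any size function. -/
theorem kseq_growth {R : Type*} [CommRing R] (N : R → ℤ) (hN : ∀ x, 0 ≤ N x)
    (hmul : ∀ x y, N (x * y) ≤ N x * N y) (hadd : ∀ x y, N (x + y) ≤ N x + N y)
    (hsub : ∀ x y, N (x - y) ≤ N x + N y) (h1 : N 1 ≤ 1) {V E : R} {s : ℤ} (hs : 0 ≤ s)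
    (hV : N V ≤ 17 * s) (hE : N E ≤ 4 * s) (j : ℕ) : N (kseq V E j) ≤ (22 * s) ^ j := by
  induction j using Nat.twoStepInduction with
  | zero => simpa [kseq] using h1
  | one => simp only [kseq]; refine (hadd _ _).trans ?_; linarith
  | more j ih1 ih2 =>
    simp only [kseq]
    refine (hsub _ _).trans ?_
    have e1 : N (V * kseq V E (j + 1)) ≤ 17 * s * (22 * s) ^ (j + 1) :=
      (hmul _ _).trans (mul_le_mul hV ih2 (hN _) (by positivity))
    have e2 : N (E ^ 2 * kseq V E j) ≤ (4 * s) * (4 * s) * (22 * s) ^ j := by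
      rw [sq]
      exact (hmul _ _).trans (mul_le_mul ((hmul _ _).trans (mul_le_mul hE hE (hN _)
        (by positivity))) ih1 (hN _) (by positivity))
    have e3 : 0 ≤ s ^ 2 * (22 * s) ^ j := by positivity
    -- The rate 22 works since 17 · 22 + 4^2 = 390 ≤ 484 = 22^2.
    calc _ ≤ 17 * s * (22 * s) ^ (j + 1) + (4 * s) * (4 * s) * (22 * s) ^ j := add_le_add e1 e2
      _ = 390 * (s ^ 2 * (22 * s) ^ j) := by ring
      _ ≤ 484 * (s ^ 2 * (22 * s) ^ j) := by gcongr; norm_num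
      _ = _ := by ring

/-! ### The weight polynomials -/

/-- The multiplier of the kernel recursion. -/
def vPoly (G : ℕ) (y : ℤ) : ℤ[X] := C (2 * (4 * (G : ℤ) ^ 2)) - (C (G : ℤ) * X - C y) ^ 2

/-- `(4 * G ^ 2) ^ (4 * m)` times the fourth power of the kernel centred at `y / G`. -/
def fPoly (m G : ℕ) (y : ℤ) : ℤ[X] := kseq (vPoly G y) (C (4 * (G : ℤ) ^ 2)) m ^ 4

theorem natDegree_vPoly_le (G : ℕ) (y : ℤ) : (vPoly G y).natDegree ≤ 2 := by
  unfold vPoly; compute_degree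

theorem natDegree_fPoly_le (m G : ℕ) (y : ℤ) : (fPoly m G y).natDegree ≤ 8 * m := by
  have := natDegree_kseq_le (natDegree_vPoly_le G y) (natDegree_C (4 * (G : ℤ) ^ 2)) m
  refine natDegree_pow_le.trans ?_
  omega

theorem l1_one_le : l1 1 ≤ 1 := by rw [← C_1, l1_C]; simp

/-- The linear factor has norm at most 3G, and 2 · 4 + 3^2 = 17. -/
theorem l1_vPoly_le {G : ℕ} {y : ℤ} (hy : |y| ≤ 2 * G) : l1 (vPoly G y) ≤ 17 * (G : ℤ) ^ 2 := by
  unfold vPoly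
  have hG : (0 : ℤ) ≤ G := by positivity
  have h1 : l1 (C (G : ℤ) * X - C y) ≤ 3 * G := by
    refine (l1_sub_le _ _).trans ?_
    rw [← monomial_one_one_eq_X, C_mul_monomial, l1_monomial, l1_C, mul_one, abs_of_nonneg hG]
    linarith
  have h2 := (l1_pow_le (C (G : ℤ) * X - C y) 2).trans (pow_le_pow_left₀ (l1_nonneg _) h1 2)
  refine (l1_sub_le _ _).trans ?_
  rw [l1_C, abs_of_nonneg (by positivity)]
  linarith

/-- This controls how much errors in the moments are amplified, relative to the normalizing factor
(4G^2)^(4m). -/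
theorem l1_fPoly_le (m : ℕ) {G : ℕ} {y : ℤ} (hy : |y| ≤ 2 * G) :
    l1 (fPoly m G y) ≤ (22 * (G : ℤ) ^ 2) ^ (4 * m) := by
  unfold fPoly
  refine (l1_pow_le _ _).trans ?_
  rw [mul_comm 4 m, pow_mul]
  refine pow_le_pow_left₀ (l1_nonneg _) ?_ 4
  refine kseq_growth l1 l1_nonneg l1_mul_le l1_add_le l1_sub_le l1_one_le (by positivity)
    (l1_vPoly_le hy) ?_ m
  rw [l1_C, abs_of_nonneg (by positivity)]

theorem eval_fPoly (m G : ℕ) (y B : ℤ) :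
    (fPoly m G y).eval B =
      kseq (2 * (4 * (G : ℤ) ^ 2) - (G * B - y) ^ 2) (4 * (G : ℤ) ^ 2) m ^ 4 := by
  have := kseq_map (evalRingHom B) (vPoly G y) (C (4 * (G : ℤ) ^ 2)) m
  simp only [coe_evalRingHom] at this
  rw [fPoly, eval_pow, this]
  simp [vPoly]

/-- For u = (Gx - y)/(4G) and E = 4G^2 one has E(2 - 4u^2) = 2E - (Gx - y)^2, so `kseq_scale`
extracts E^m before the fourth power is taken. -/
theorem aeval_fPoly (m : ℕ) {G : ℕ} (hG : 0 < G) (y : ℤ) (x : ℝ) :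
    aeval x (fPoly m G y) =
      (4 * (G : ℝ) ^ 2) ^ (4 * m) * dker m ((G * x - y) / (4 * G)) ^ 4 := by
  have := kseq_map (aeval (R := ℤ) x).toRingHom (vPoly G y) (C (4 * (G : ℤ) ^ 2)) m
  simp only [AlgHom.toRingHom_eq_coe, RingHom.coe_coe] at this
  rw [fPoly, map_pow, this]
  have hG' : (G : ℝ) ≠ 0 := by positivity
  have e1 : aeval x (C (4 * (G : ℤ) ^ 2)) = 4 * (G : ℝ) ^ 2 := by rw [aeval_C]; simp
  have e2 : aeval x (vPoly G y) =
      (4 * (G : ℝ) ^ 2) * (2 - 4 * ((G * x - y) / (4 * G)) ^ 2) := by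
    rw [vPoly]
    simp only [map_sub, map_pow, map_mul (aeval x), aeval_C, aeval_X]
    simp only [algebraMap_int_eq, eq_intCast]
    push_cast
    field_simp
  rw [e1, e2, kseq_scale, mul_pow, ← pow_mul, mul_comm m 4, dker]

/-- Each monomial x^i is i-Lipschitz on [-1, 1]. The bound pays for moving eigenvalues to grid
points. -/
theorem abs_aeval_sub_le (p : ℤ[X]) {L : ℕ} (hp : p.natDegree ≤ L) {x y : ℝ} (hx : |x| ≤ 1)
    (hy : |y| ≤ 1) : |aeval x p - aeval y p| ≤ L * l1 p * |x - y| := by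
  have hpow : ∀ i : ℕ, |x ^ i - y ^ i| ≤ i * |x - y| := by
    intro i
    induction i with
    | zero => simp
    | succ i ih =>
      have e : x ^ (i + 1) - y ^ (i + 1) = (x ^ i - y ^ i) * x + y ^ i * (x - y) := by ring
      rw [e]
      refine (abs_add_le _ _).trans ?_
      rw [abs_mul, abs_mul, abs_pow]
      have : |y| ^ i ≤ 1 := pow_le_one₀ (abs_nonneg _) hy
      push_cast
      nlinarith [abs_nonneg (x ^ i - y ^ i), abs_nonneg (x - y)]
  rw [aeval_eq_sum_range, aeval_eq_sum_range, ← Finset.sum_sub_distrib]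
  refine (Finset.abs_sum_le_sum_abs _ _).trans ?_
  rw [l1_eq_sum p supp_subset_range_natDegree_succ]
  push_cast
  rw [Finset.mul_sum, Finset.sum_mul]
  refine Finset.sum_le_sum fun i hi => ?_
  rw [← smul_sub, zsmul_eq_mul, abs_mul]
  have h1 : (i : ℝ) ≤ L := by
    rw [Finset.mem_range] at hi; exact_mod_cast (by omega)
  calc |(p.coeff i : ℝ)| * |x ^ i - y ^ i| ≤ |(p.coeff i : ℝ)| * (L * |x - y|) := by
        gcongr
        exact (hpow i).trans (by gcongr)
    _ = _ := by ring

/-! ### Reading off a coefficient from a value -/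

theorem abs_sum_lt_pow {c : ℕ → ℤ} {B : ℤ} (hB : 0 < B) (hc : ∀ i, |c i| ≤ B - 1) (L : ℕ) :
    |∑ i ∈ Finset.range L, c i * B ^ i| < B ^ L := by
  induction L with
  | zero => simp
  | succ L ih =>
    rw [Finset.sum_range_succ]
    refine (abs_add_le _ _).trans_lt ?_
    rw [abs_mul, abs_of_pos (by positivity : 0 < B ^ L)]
    have := mul_le_mul_of_nonneg_right (hc L) (by positivity : 0 ≤ B ^ L)
    rw [pow_succ]
    linarith

/-- Division by `B ^ L` and reduction modulo `B` of the value of a polynomial at `B` recovers the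
coefficient of index `L`, up to a rounding error. -/
theorem digit_eq (p : ℤ[X]) {B σ : ℤ} (L : ℕ) (hB : 0 < B) (hc : ∀ i, |p.coeff i| ≤ B - 1)
    (h0 : 1 ≤ p.coeff L + σ) (h1 : p.coeff L + σ < B) :
    ∃ e : ℤ, 0 ≤ e ∧ e ≤ 1 ∧
      (p.eval B / B ^ L + σ) - (p.eval B / B ^ L + σ) / B * B = p.coeff L + σ - e := by
  have hBL : 0 < B ^ L := by positivity
  obtain ⟨D, hD⟩ : ∃ D, p.natDegree + 1 ≤ L + 1 + D := ⟨p.natDegree, by omega⟩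
  have hsum : p.eval B = ∑ i ∈ Finset.range (L + 1 + D), p.coeff i * B ^ i :=
    eval_eq_sum_range' (by omega) B
  set lo := ∑ i ∈ Finset.range L, p.coeff i * B ^ i with hlo
  set hi := ∑ i ∈ Finset.range D, p.coeff (L + 1 + i) * B ^ i with hhi
  have hsplit : p.eval B = lo + B ^ L * (p.coeff L + B * hi) := by
    rw [hsum, Finset.sum_range_add, Finset.sum_range_succ, hhi, mul_add, Finset.mul_sum,
      Finset.mul_sum, ← hlo, mul_comm (B ^ L), add_assoc]
    congr 2
    refine Finset.sum_congr rfl fun i _ => ?_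
    ring
  have hlob : |lo| < B ^ L := abs_sum_lt_pow hB hc L
  rw [abs_lt] at hlob
  have hdiv : p.eval B / B ^ L = lo / B ^ L + (p.coeff L + B * hi) := by
    rw [hsplit, Int.add_mul_ediv_left _ _ hBL.ne']
  -- The digits are signed, so a negative lower part borrows one unit from position L. This is the
  -- only source of the rounding error.
  have hq : ∃ e : ℤ, 0 ≤ e ∧ e ≤ 1 ∧ lo / B ^ L = -e := by
    rcases le_or_gt 0 lo with h | h
    · exact ⟨0, le_rfl, by norm_num, by rw [Int.ediv_eq_zero_of_lt h hlob.2]; rfl⟩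
    · refine ⟨1, by norm_num, le_rfl, ?_⟩
      have h2 : lo / B ^ L < 0 := Int.ediv_neg_of_neg_of_pos h hBL
      have h3 : -1 ≤ lo / B ^ L := by
        rw [Int.le_ediv_iff_mul_le hBL]; linarith
      omega
  obtain ⟨e, he0, he1, he⟩ := hq
  refine ⟨e, he0, he1, ?_⟩
  rw [hdiv, he]
  have e1 : -e + (p.coeff L + B * hi) + σ = (p.coeff L + σ - e) + B * hi := by ring
  -- The lower bound `h0` is 1 rather than 0 so that the digit stays non-negative after the borrow
  -- and does not wrap around modulo B.
  rw [e1, Int.add_mul_ediv_left _ _ hB.ne', Int.ediv_eq_zero_of_lt (by linarith) (by linarith)]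
  ring

/-! ### Coded return counts -/

/-- Return counts `M`, coded as a polynomial with reversed indices. -/
def hPoly (L : ℕ) (M : ℕ → ℕ) : ℤ[X] := ∑ j ∈ Finset.range (L + 1), monomial (L - j) (M j : ℤ)

theorem eval_hPoly (L : ℕ) (M : ℕ → ℕ) (B : ℤ) :
    (hPoly L M).eval B = ∑ j ∈ Finset.range (L + 1), (M j : ℤ) * B ^ (L - j) := by
  simp [hPoly, eval_finsetSum, eval_monomial]

theorem coeff_hPoly (L : ℕ) (M : ℕ → ℕ) (i : ℕ) :
    (hPoly L M).coeff i = if i ≤ L then (M (L - i) : ℤ) else 0 := by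
  simp only [hPoly, finsetSum_coeff, coeff_monomial]
  split_ifs with h
  · rw [Finset.sum_eq_single (L - i)]
    · rw [if_pos (by omega)]
    · intro b hb hne; rw [Finset.mem_range] at hb; rw [if_neg (by omega)]
    · intro hh; exact absurd (Finset.mem_range.mpr (by omega)) hh
  · refine Finset.sum_eq_zero fun j hj => ?_
    rw [if_neg (by omega)]

/-- Because the indices of the counts are reversed, the convolution at index L is the inner product
of coefficients and counts. -/
theorem coeff_mul_hPoly (p : ℤ[X]) (L : ℕ) (M : ℕ → ℕ) :
    (p * hPoly L M).coeff L = ∑ j ∈ Finset.range (L + 1), p.coeff j * M j := by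
  rw [coeff_mul, Finset.Nat.sum_antidiagonal_eq_sum_range_succ
    (fun i j => p.coeff i * (hPoly L M).coeff j)]
  refine Finset.sum_congr rfl fun j hj => ?_
  rw [Finset.mem_range] at hj
  rw [coeff_hPoly, if_pos (by omega), Nat.sub_sub_self (by omega)]

theorem abs_coeff_mul_hPoly_le (p : ℤ[X]) (L : ℕ) {M : ℕ → ℕ} {c : ℤ} (hM : ∀ j, (M j : ℤ) ≤ c)
    (i : ℕ) : |(p * hPoly L M).coeff i| ≤ l1 p * c := by
  have hc : 0 ≤ c := le_trans (by positivity) (hM 0)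
  have hh : ∀ j, |(hPoly L M).coeff j| ≤ c := by
    intro j
    rw [coeff_hPoly]
    split_ifs
    · rw [Nat.abs_cast]; exact hM _
    · simpa using hc
  rw [coeff_mul, Finset.Nat.sum_antidiagonal_eq_sum_range_succ
    (fun i j => p.coeff i * (hPoly L M).coeff j)]
  refine (Finset.abs_sum_le_sum_abs _ _).trans ?_
  rw [l1_eq_sum p (s := p.support ∪ Finset.range i.succ) Finset.subset_union_left, Finset.sum_mul]
  calc _ ≤ ∑ j ∈ Finset.range i.succ, |p.coeff j| * c := by
        refine Finset.sum_le_sum fun j _ => ?_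
        rw [abs_mul]
        exact mul_le_mul_of_nonneg_left (hh _) (abs_nonneg _)
    _ ≤ _ := by
        apply Finset.sum_le_sum_of_subset_of_nonneg Finset.subset_union_right
        intros; positivity

end

end SpectralSampling

namespace SpectralSampling

open MeasureTheory
open scoped ENNReal

noncomputable section

/-! ### Couplings of finitely supported distributions -/

theorem W1_le_of_coupling {ι : Type*} {n : ℕ} (s : Finset ι) (y q : ι → ℝ) (x : Fin n → ℝ)
    (π : ι → Fin n → ℝ) (h0 : ∀ i ∈ s, ∀ l, 0 ≤ π i l)
    (hq : ∀ i ∈ s, ∑ l, π i l = q i) (hp : ∀ l, ∑ i ∈ s, π i l = 1 / n) :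
    W1 (∑ i ∈ s, ENNReal.ofReal (q i) • Measure.dirac (y i)) (spectralDistribution x) ≤
      ENNReal.ofReal (∑ i ∈ s, ∑ l, π i l * |y i - x l|) := by
  set P : Measure (ℝ × ℝ) :=
    ∑ i ∈ s, ∑ l, ENNReal.ofReal (π i l) • Measure.dirac (y i, x l) with hP
  have hmap : ∀ f : ℝ × ℝ → ℝ, Measurable f →
      P.map f = ∑ i ∈ s, ∑ l, ENNReal.ofReal (π i l) • Measure.dirac (f (y i, x l)) := by
    intro f hf
    rw [hP, Measure.map_finset_sum hf.aemeasurable]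
    refine Finset.sum_congr rfl fun i _ => ?_
    rw [Measure.map_finset_sum hf.aemeasurable]
    refine Finset.sum_congr rfl fun l _ => ?_
    rw [Measure.map_smul, Measure.map_dirac' hf]
  have h1 : P.map Prod.fst = ∑ i ∈ s, ENNReal.ofReal (q i) • Measure.dirac (y i) := by
    rw [hmap _ measurable_fst]
    refine Finset.sum_congr rfl fun i hi => ?_
    change ∑ l, ENNReal.ofReal (π i l) • Measure.dirac (y i) = _
    rw [← Finset.sum_smul, ← ENNReal.ofReal_sum_of_nonneg fun l _ => h0 i hi l, hq i hi]
  have h2 : P.map Prod.snd = spectralDistribution x := by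
    rw [hmap _ measurable_snd, spectralDistribution, Finset.sum_comm]
    refine Finset.sum_congr rfl fun l _ => ?_
    have hn : 0 < n := Fin.pos l
    change ∑ i ∈ s, ENNReal.ofReal (π i l) • Measure.dirac (x l) = _
    rw [← Finset.sum_smul, ← ENNReal.ofReal_sum_of_nonneg fun i hi => h0 i hi l, hp l, one_div,
      ENNReal.ofReal_inv_of_pos (by exact_mod_cast hn), ENNReal.ofReal_natCast]
  refine (iInf₂_le P ⟨h1, h2⟩).trans (le_of_eq ?_)
  rw [hP, lintegral_finsetSum_measure,
    ENNReal.ofReal_sum_of_nonneg fun i hi => Finset.sum_nonneg fun l _ =>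
      mul_nonneg (h0 i hi l) (abs_nonneg _)]
  refine Finset.sum_congr rfl fun i hi => ?_
  rw [lintegral_finsetSum_measure,
    ENNReal.ofReal_sum_of_nonneg fun l _ => mul_nonneg (h0 i hi l) (abs_nonneg _)]
  refine Finset.sum_congr rfl fun l _ => ?_
  rw [lintegral_smul_measure, lintegral_dirac, ENNReal.ofReal_mul (h0 i hi l), edist_dist,
    Real.dist_eq, smul_eq_mul]

/-- A bound for the earth mover distance from a matrix of non-negative numbers whose row sums are
nearly constant and whose column averages are nearly the weights. -/
theorem W1_le_of_kernel {ι : Type*} {n : ℕ} [NeZero n] (s : Finset ι) (y w : ι → ℝ)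
    (x : Fin n → ℝ) (a : Fin n → ι → ℝ) (e : ι → ℝ) {lo hi η Y Δ : ℝ}
    (ha : ∀ l, ∀ i ∈ s, 0 ≤ a l i) (he : ∀ i ∈ s, 0 ≤ e i)
    (hw : ∀ i ∈ s, w i = (∑ l, a l i) / n + e i) (hη : ∑ i ∈ s, e i ≤ η)
    (hlo : 0 < lo) (hrow : ∀ l, lo ≤ ∑ i ∈ s, a l i ∧ ∑ i ∈ s, a l i ≤ hi)
    (hY : ∀ l, ∑ i ∈ s, a l i * |y i - x l| ≤ Y)
    (hΔ : ∀ l, ∀ i ∈ s, |y i - x l| ≤ Δ) :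
    W1 (∑ i ∈ s, ENNReal.ofReal (w i / ∑ j ∈ s, w j) • Measure.dirac (y i))
      (spectralDistribution x) ≤ ENNReal.ofReal (Y / hi + Δ * ((hi - lo + η) / hi)) := by
  have hn : (0 : ℝ) < n := by exact_mod_cast Nat.pos_of_ne_zero (NeZero.ne n)
  have l0 : Fin n := ⟨0, Nat.pos_of_ne_zero (NeZero.ne n)⟩
  have hhi : 0 < hi := hlo.trans_le ((hrow l0).1.trans (hrow l0).2)
  have hη0 : 0 ≤ η := (Finset.sum_nonneg he).trans hη
  have hlohi : lo ≤ hi := (hrow l0).1.trans (hrow l0).2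
  have hsne : s.Nonempty := by
    by_contra h
    rw [Finset.not_nonempty_iff_eq_empty] at h
    have := (hrow l0).1
    rw [h, Finset.sum_empty] at this
    linarith
  have hΔ0 : 0 ≤ Δ := (abs_nonneg _).trans (hΔ l0 _ hsne.choose_spec)
  have hY0 : 0 ≤ Y := le_trans (Finset.sum_nonneg fun i hi =>
    mul_nonneg (ha l0 i hi) (abs_nonneg _)) (hY l0)
  set τ := ∑ j ∈ s, w j with hτ
  -- average of the row sums
  set A := (∑ l, ∑ i ∈ s, a l i) / n with hA
  have hAlo : lo ≤ A := by
    rw [hA, le_div_iff₀ hn]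
    calc lo * n = ∑ _l : Fin n, lo := by simp; ring
      _ ≤ _ := Finset.sum_le_sum fun l _ => (hrow l).1
  have hAhi : A ≤ hi := by
    rw [hA, div_le_iff₀ hn]
    calc _ ≤ ∑ _l : Fin n, hi := Finset.sum_le_sum fun l _ => (hrow l).2
      _ = _ := by simp; ring
  have hτA : τ = A + ∑ i ∈ s, e i := by
    rw [hτ, Finset.sum_congr rfl hw, Finset.sum_add_distrib, hA, Finset.sum_comm,
      ← Finset.sum_div]
  have hτpos : 0 < τ := by
    rw [hτA]; linarith [Finset.sum_nonneg he]
  -- With this factor the scaled kernel fits below both marginals: its row sums are at most `hi`,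
  -- and the total weight τ is at most `hi + η`.
  set c := 1 / (hi + η) with hc
  have hcpos : 0 < c := by positivity
  have hcτ : c * τ ≤ 1 := by
    rw [hc, one_div, inv_mul_le_one₀ (by positivity), hτA]; linarith
  -- residual masses
  set β : ι → ℝ := fun i => w i / τ - c * ((∑ l, a l i) / n) with hβ
  set α : Fin n → ℝ := fun l => 1 / n - c * ((∑ i ∈ s, a l i) / n) with hα
  set δ := 1 - c * A with hδ
  have hβ0 : ∀ i ∈ s, 0 ≤ β i := by
    intro i hi'
    rw [hβ]
    simp only [sub_nonneg]
    rw [le_div_iff₀ hτpos]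
    have h1 : 0 ≤ (∑ l, a l i) / n :=
      div_nonneg (Finset.sum_nonneg fun l _ => ha l i hi') hn.le
    have h2 := mul_le_mul_of_nonneg_right hcτ h1
    have h3 := he i hi'
    rw [hw i hi']
    nlinarith
  have hα0 : ∀ l, 0 ≤ α l := by
    intro l
    rw [hα]
    simp only [sub_nonneg]
    rw [← mul_div_assoc]
    gcongr
    rw [hc, one_div, inv_mul_le_one₀ (by positivity)]
    linarith [(hrow l).2]
  have hβs : ∑ i ∈ s, β i = δ := by
    simp only [hβ]
    rw [Finset.sum_sub_distrib, ← Finset.sum_div, ← Finset.mul_sum, ← Finset.sum_div,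
      Finset.sum_comm, ← hA, ← hτ, div_self hτpos.ne']
  have hαs : ∑ l, α l = δ := by
    simp only [hα]
    rw [Finset.sum_sub_distrib, ← Finset.mul_sum,
      ← Finset.sum_div _ (fun l => ∑ i ∈ s, a l i), ← hA]
    simp [hδ, hn.ne']
  have hδ0 : 0 ≤ δ := by rw [← hαs]; exact Finset.sum_nonneg fun l _ => hα0 l
  -- If δ = 0 then division by zero gives 0, which is still right because z is squeezed to 0.
  have hres : ∀ z : ℝ, 0 ≤ z → z ≤ δ → z * δ / δ = z := by
    intro z hz0 hz
    rcases eq_or_ne δ 0 with h | h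
    · rw [h] at hz ⊢; simp; linarith
    · field_simp
  -- The scaled kernel transports most of the mass over short distances. The residual masses, both
  -- of total δ, are coupled independently at distance at most Δ.
  set π : ι → Fin n → ℝ := fun i l => c * (a l i / n) + β i * α l / δ with hπ
  have hβle : ∀ i ∈ s, β i ≤ δ := fun i hi' => by
    rw [← hβs]; exact Finset.single_le_sum hβ0 hi'
  have hαle : ∀ l, α l ≤ δ := fun l => by
    rw [← hαs]; exact Finset.single_le_sum (fun l _ => hα0 l) (Finset.mem_univ l)
  refine (W1_le_of_coupling s y (fun i => w i / τ) x π ?_ ?_ ?_).trans ?_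
  · intro i hi' l
    have h1 := ha l i hi'
    have h2 := hβ0 i hi'
    have h3 := hα0 l
    positivity
  · intro i hi'
    simp only [hπ]
    rw [Finset.sum_add_distrib, ← Finset.mul_sum, ← Finset.sum_div, ← Finset.sum_div,
      ← Finset.mul_sum, hαs, hres _ (hβ0 i hi') (hβle i hi')]
    simp only [hβ]; ring
  · intro l
    simp only [hπ]
    rw [Finset.sum_add_distrib, ← Finset.mul_sum, ← Finset.sum_div, ← Finset.sum_div,
      ← Finset.sum_mul, hβs, mul_comm δ, hres _ (hα0 l) (hαle l)]
    simp only [hα]; ring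
  · apply ENNReal.ofReal_le_ofReal
    have e1 : ∑ i ∈ s, ∑ l, π i l * |y i - x l| =
        c * ((∑ l, ∑ i ∈ s, a l i * |y i - x l|) / n) +
          ∑ i ∈ s, ∑ l, β i * α l / δ * |y i - x l| := by
      rw [Finset.sum_comm (f := fun l i => a l i * |y i - x l|), Finset.sum_div, Finset.mul_sum,
        ← Finset.sum_add_distrib]
      refine Finset.sum_congr rfl fun i _ => ?_
      rw [Finset.sum_div, Finset.mul_sum, ← Finset.sum_add_distrib]
      refine Finset.sum_congr rfl fun l _ => ?_
      simp only [hπ]; ring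
    rw [e1]
    have hcle : c ≤ 1 / hi := by
      rw [hc]; exact one_div_le_one_div_of_le hhi (by linarith)
    gcongr
    · calc c * ((∑ l, ∑ i ∈ s, a l i * |y i - x l|) / n) ≤ (1 / hi) * ((∑ _l : Fin n, Y) / n) := by
            gcongr with l
            · exact div_nonneg (Finset.sum_nonneg fun l _ => Finset.sum_nonneg fun i hi' =>
                mul_nonneg (ha l i hi') (abs_nonneg _)) hn.le
            · exact hY l
        _ = Y / hi := by simp; field_simp
    · calc ∑ i ∈ s, ∑ l, β i * α l / δ * |y i - x l|
          ≤ ∑ i ∈ s, ∑ l, β i * α l / δ * Δ := by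
            refine Finset.sum_le_sum fun i hi' => Finset.sum_le_sum fun l _ => ?_
            have h2 := hβ0 i hi'
            have h3 := hα0 l
            exact mul_le_mul_of_nonneg_left (hΔ l i hi') (by positivity)
        _ = δ * δ / δ * Δ := by
            simp_rw [← Finset.sum_mul, ← Finset.sum_div, ← Finset.mul_sum, hαs, ← Finset.sum_mul,
              hβs]
        _ = Δ * δ := by rw [hres δ hδ0 le_rfl]; ring
        _ ≤ _ := by
            gcongr
            rw [hδ, le_div_iff₀ hhi]
            have h1 : c * (hi + η) = 1 := by rw [hc]; field_simp
            have h2 : c * hi ≤ 1 := by nlinarith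
            have h4 : hi * (1 - c * A) = hi * c * (hi + η - A) := by
              have : hi * 1 = hi * (c * (hi + η)) := by rw [h1]
              linarith
            rw [mul_comm, h4]
            calc hi * c * (hi + η - A) ≤ 1 * (hi + η - A) := by
                  apply mul_le_mul_of_nonneg_right <;> linarith
              _ ≤ _ := by linarith

end

end SpectralSampling

namespace SpectralSampling

open MeasureTheory
open scoped ENNReal

noncomputable section

/-! ### Straight-line programs -/

/-- All integer cells have bit length at most `β`. -/
def Bd (β : ℕ) (m : ℕ → ℤ) : Prop := ∀ i, bits (m i) ≤ β

/-- The cell number that a location refers to. -/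
def laddr (m : ℕ → ℤ) : Loc → ℕ
  | .dir i => i
  | .ind i => (m i).toNat

/-- The effect of straight-line integer code on the integer memory. -/
def memEval : Prog → (ℕ → ℤ) → ℕ → ℤ
  | .const d z, m => Function.update m (laddr m d) z
  | .copy d a, m => Function.update m (laddr m d) (m (laddr m a))
  | .arith o d a b, m => Function.update m (laddr m d) (o.eval (m (laddr m a)) (m (laddr m b)))
  | .seq p q, m => memEval q (memEval p m)
  | _, m => m

/-- Programs without loops, branches and access to vertices. -/
def Straight : Prog → Prop
  | .const _ _ => True
  | .copy _ _ => True
  | .arith _ _ _ _ => True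
  | .seq p q => Straight p ∧ Straight q
  | _ => False

/-- A constant that governs the running time of a straight-line program and the growth of
numbers. -/
def scost : Prog → ℕ
  | .const _ z => 3 + bits z
  -- After `p` the bit lengths have grown by a factor of about `scost p`, and the time of `q` is
  -- quadratic in the bit lengths it meets.
  | .seq p q => scost p + scost q * (1 + scost p) ^ 2
  | _ => 4

/-- Nesting depth of a straight-line program. -/
def sdepth : Prog → ℕ
  | .seq p q => max (sdepth p) (sdepth q) + 1
  | _ => 1

theorem bits_le_iff {z : ℤ} {β : ℕ} : bits z ≤ β ↔ |z| < 2 ^ β := by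
  rw [bits, Nat.size_le, ← Int.natCast_natAbs]
  exact_mod_cast Iff.rfl

/-- Products double the bit length, sums need one more bit, and division does not increase the
absolute value, not even by the convention for zero divisors. -/
theorem bits_eval_le (o : Op) {x y : ℤ} {β : ℕ} (hx : bits x ≤ β) (hy : bits y ≤ β) :
    bits (o.eval x y) ≤ 2 * β + 1 := by
  rw [bits_le_iff] at *
  have h1 : (1 : ℤ) ≤ 2 ^ β := one_le_pow₀ (by norm_num)
  have h2 : (2 : ℤ) ^ (2 * β + 1) = 2 * (2 ^ β * 2 ^ β) := by rw [pow_succ, two_mul, pow_add]; ring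
  rw [h2]
  cases o with
  | add =>
    simp only [Op.eval]
    refine (abs_add_le _ _).trans_lt ?_
    nlinarith
  | sub =>
    simp only [Op.eval]
    refine (abs_sub _ _).trans_lt ?_
    nlinarith
  | mul =>
    simp only [Op.eval]
    rw [abs_mul]
    nlinarith [abs_nonneg x, abs_nonneg y]
  | div =>
    simp only [Op.eval]
    have h3 : |x / y| ≤ |x| := by
      rw [← Int.natCast_natAbs, ← Int.natCast_natAbs]
      exact_mod_cast Int.natAbs_ediv_le_natAbs x y
    nlinarith

theorem Bd.mono {β γ : ℕ} (h : β ≤ γ) {m : ℕ → ℤ} (hm : Bd β m) : Bd γ m :=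
  fun i => (hm i).trans h

theorem Bd.update {β : ℕ} {m : ℕ → ℤ} (hm : Bd β m) (d : ℕ) {z : ℤ} (hz : bits z ≤ β) :
    Bd β (Function.update m d z) := by
  intro i
  rcases eq_or_ne i d with rfl | h
  · simpa using hz
  · rw [Function.update_of_ne h]; exact hm i

theorem Bd.memEval {p : Prog} (hp : Straight p) {β : ℕ} {m : ℕ → ℤ} (hm : Bd β m) :
    Bd (scost p * (1 + β)) (memEval p m) := by
  induction p generalizing β m with
  | const d z =>
    simp only [SpectralSampling.memEval, scost]
    exact (hm.mono (by nlinarith)).update _ (by nlinarith)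
  | copy d a =>
    simp only [SpectralSampling.memEval, scost]
    exact (hm.mono (by nlinarith)).update _ ((hm _).trans (by nlinarith))
  | arith o d a b =>
    simp only [SpectralSampling.memEval, scost]
    exact (hm.mono (by nlinarith)).update _ ((bits_eval_le o (hm _) (hm _)).trans (by nlinarith))
  | seq p q ihp ihq =>
    simp only [SpectralSampling.memEval, scost]
    refine (ihq hp.2 (ihp hp.1 hm)).mono ?_
    have : 1 + scost p * (1 + β) ≤ (1 + scost p) ^ 2 * (1 + β) := by
      nlinarith [Nat.zero_le (scost p * β)]
    calc scost q * (1 + scost p * (1 + β)) ≤ scost q * ((1 + scost p) ^ 2 * (1 + β)) := by gcongr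
      _ ≤ _ := by nlinarith
  | _ => exact hp.elim

/-! ### Couplings of discrete random variables -/

theorem bind_congr_support {α β : Type*} (p : PMF α) {f g : α → PMF β}
    (h : ∀ a ∈ p.support, f a = g a) : p.bind f = p.bind g := by
  ext b
  rw [PMF.bind_apply, PMF.bind_apply]
  refine tsum_congr fun a => ?_
  by_cases ha : a ∈ p.support
  · rw [h a ha]
  · rw [(PMF.apply_eq_zero_iff p a).mpr ha, zero_mul, zero_mul]

/-- Sequential composition of couplings. -/
theorem exists_coupling_bind {α β σ : Type} {J : PMF (α × σ)} {D : PMF α} {E : α → PMF β}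
    {e : σ → PMF (Option (σ))} {R : β → σ → Prop} (hJ : J.map Prod.fst = D)
    (h : ∀ x ∈ J.support, ∃ J' : PMF (β × σ), J'.map Prod.fst = E x.1 ∧
      e x.2 = J'.map (fun x => some x.2) ∧ ∀ y ∈ J'.support, R y.1 y.2) :
    ∃ J' : PMF (β × σ), J'.map Prod.fst = D.bind E ∧
      ((J.map (fun x => some x.2)).bind fun r => r.elim (PMF.pure none) e) =
        J'.map (fun x => some x.2) ∧ ∀ y ∈ J'.support, R y.1 y.2 := by
  classical
  choose K hK using h
  -- Couplings exist only on the support of `J`; elsewhere any distribution serves.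
  let K' : α × σ → PMF (β × σ) := fun x =>
    if hx : x ∈ J.support then K x hx else K _ J.support_nonempty.choose_spec
  have hK' : ∀ x (hx : x ∈ J.support), K' x = K x hx := fun x hx => dif_pos hx
  refine ⟨J.bind K', ?_, ?_, ?_⟩
  · rw [PMF.map_bind, ← hJ, PMF.bind_map]
    refine bind_congr_support _ fun x hx => ?_
    rw [hK' x hx, (hK x hx).1]; rfl
  · rw [PMF.map_bind, PMF.bind_map]
    refine bind_congr_support _ fun x hx => ?_
    rw [hK' x hx, ← (hK x hx).2.1]; rfl
  · intro y hy
    rw [PMF.mem_support_bind_iff] at hy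
    obtain ⟨x, hx, hy⟩ := hy
    rw [hK' x hx] at hy
    exact (hK x hx).2.2 y hy

/-! ### Deterministic effects -/

theorem addr_eq_laddr {n : ℕ} {s : State n} {m : ℕ → ℤ} (h : s.mem = m) (d : Loc) :
    s.addr d = laddr m d := by
  subst h; cases d <;> rfl

theorem addrCost_le {n : ℕ} {s : State n} {β : ℕ} (h : Bd β s.mem) (d : Loc) :
    s.addrCost d ≤ 1 + β := by
  cases d with
  | dir i => simp [State.addrCost]
  | ind i => simpa [State.addrCost] using h i

section

variable {n : ℕ} [NeZero n] (col : Fin n → PMF (Fin n))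

/-- The program `p` deterministically changes the integer memory from `m` to `m'`, within time
`T` and recursion depth `F`, without touching the vertex memory. -/
def Eff (F T : ℕ) (p : Prog) (m m' : ℕ → ℤ) : Prop :=
  ∀ s : State n, s.mem = m → ∃ s' : State n,
    (∀ fuel ≥ F, exec col fuel p s = PMF.pure (some s')) ∧ s'.mem = m' ∧ s'.vtx = s.vtx ∧
      s'.queries = s.queries ∧ s'.time ≤ s.time + T

variable {col}

theorem Eff.mono {F F' T T' : ℕ} {p : Prog} {m m' : ℕ → ℤ} (h : Eff col F T p m m')
    (hF : F ≤ F') (hT : T ≤ T') : Eff col F' T' p m m' := by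
  intro s hs
  obtain ⟨s', h1, h2, h3, h4, h5⟩ := h s hs
  exact ⟨s', fun fuel hf => h1 fuel (hF.trans hf), h2, h3, h4, h5.trans (by omega)⟩

theorem exists_fuel_eq_succ {F fuel : ℕ} (h : fuel ≥ F + 1) : ∃ f, fuel = f + 1 ∧ f ≥ F :=
  ⟨fuel - 1, by omega, by omega⟩

theorem Eff.seq {F₁ F₂ T₁ T₂ : ℕ} {p q : Prog} {m₀ m₁ m₂ : ℕ → ℤ} (hp : Eff col F₁ T₁ p m₀ m₁)
    (hq : Eff col F₂ T₂ q m₁ m₂) : Eff col (max F₁ F₂ + 1) (T₁ + T₂) (.seq p q) m₀ m₂ := by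
  intro s hs
  obtain ⟨s₁, a1, a2, a3, a4, a5⟩ := hp s hs
  obtain ⟨s₂, b1, b2, b3, b4, b5⟩ := hq s₁ a2
  refine ⟨s₂, fun fuel hf => ?_, b2, b3.trans a3, b4.trans a4, by omega⟩
  obtain ⟨f, rfl, hf'⟩ := exists_fuel_eq_succ hf
  simp [exec, a1 f (le_of_max_le_left hf'), b1 f (le_of_max_le_right hf')]

theorem Eff.straight {p : Prog} (hp : Straight p) {β : ℕ} {m : ℕ → ℤ} (hm : Bd β m) :
    Eff col (sdepth p) (scost p * (1 + β) ^ 2) p m (memEval p m) := by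
  induction p generalizing β m with
  | const d z =>
    intro s hs
    refine ⟨(s.setMem d z).charge (1 + s.addrCost d + bits z),
      fun fuel hf => ?_, ?_, rfl, rfl, ?_⟩
    · obtain ⟨f, rfl, hf'⟩ := exists_fuel_eq_succ hf; rfl
    · simp [State.charge, State.setMem, memEval, addr_eq_laddr hs, hs]
    · have := addrCost_le (hs ▸ hm) d
      simp only [State.charge, State.setMem, scost]
      nlinarith [Nat.zero_le (bits z * β), Nat.zero_le (bits z * β ^ 2)]
  | copy d a =>
    intro s hs
    refine ⟨(s.setMem d (s.val a)).charge
        (1 + s.addrCost d + s.addrCost a + bits (s.val a)),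
      fun fuel hf => ?_, ?_, rfl, rfl, ?_⟩
    · obtain ⟨f, rfl, hf'⟩ := exists_fuel_eq_succ hf; rfl
    · simp [State.charge, State.setMem, memEval, addr_eq_laddr hs, hs, State.val]
    · have h1 := addrCost_le (hs ▸ hm) d
      have h2 := addrCost_le (hs ▸ hm) a
      have h3 : bits (s.val a) ≤ β := by rw [State.val, hs]; exact hm _
      simp only [State.charge, State.setMem, scost]
      nlinarith
  | arith o d a b =>
    intro s hs
    refine ⟨(s.setMem d (o.eval (s.val a) (s.val b))).charge
        (s.addrCost d + s.addrCost a + s.addrCost b + (1 + bits (s.val a)) * (1 + bits (s.val b))),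
      fun fuel hf => ?_, ?_, rfl, rfl, ?_⟩
    · obtain ⟨f, rfl, hf'⟩ := exists_fuel_eq_succ hf; rfl
    · simp [State.charge, State.setMem, memEval, addr_eq_laddr hs, hs, State.val]
    · have h1 := addrCost_le (hs ▸ hm) d
      have h2 := addrCost_le (hs ▸ hm) a
      have h4 := addrCost_le (hs ▸ hm) b
      have h3 : bits (s.val a) ≤ β := by rw [State.val, hs]; exact hm _
      have h5 : bits (s.val b) ≤ β := by rw [State.val, hs]; exact hm _
      have h6 : (1 + bits (s.val a)) * (1 + bits (s.val b)) ≤ (1 + β) * (1 + β) := by gcongr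
      simp only [State.charge, State.setMem, scost]
      nlinarith
  | seq p q ihp ihq =>
    refine ((ihp hp.1 hm).seq (ihq hp.2 (hm.memEval hp.1))).mono le_rfl ?_
    simp only [scost]
    have h1 : 1 + scost p * (1 + β) ≤ (1 + scost p) * (1 + β) := by nlinarith
    calc _ ≤ scost p * (1 + β) ^ 2 + scost q * ((1 + scost p) * (1 + β)) ^ 2 := by gcongr
      _ = _ := by ring
  | _ => exact hp.elim

theorem exec_loop_pos {fuel a : ℕ} {p : Prog} {s : State n} (h : 0 < s.mem a) :
    exec col (fuel + 1) (.loop (.dir a) p) s =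
      (exec col fuel p (s.charge (2 + bits (s.mem a)))).bind fun r =>
        r.elim (PMF.pure none) (exec col fuel (.loop (.dir a) p)) := by
  simp [exec, State.val, State.addr, State.addrCost, h]

theorem exec_loop_neg {fuel a : ℕ} {p : Prog} {s : State n} (h : s.mem a ≤ 0) :
    exec col (fuel + 1) (.loop (.dir a) p) s =
      PMF.pure (some (s.charge (2 + bits (s.mem a)))) := by
  simp [exec, State.val, State.addr, State.addrCost, not_lt.mpr h]

/-- A loop with an indexed invariant. -/
theorem Eff.loop {F T β a N : ℕ} {p : Prog} (I : ℕ → (ℕ → ℤ) → Prop)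
    (hβ : ∀ i m, i ≤ N → I i m → bits (m a) ≤ β)
    (hstep : ∀ i m, i < N → I i m → 0 < m a ∧ ∃ m', Eff col F T p m m' ∧ I (i + 1) m')
    (hend : ∀ m, I N m → m a ≤ 0) {m : ℕ → ℤ} (h0 : I 0 m) :
    ∃ m', Eff col (F + N + 1) ((N + 1) * (T + (2 + β))) (.loop (.dir a) p) m m' ∧ I N m' := by
  -- The induction runs over the number r of remaining rounds, which also determines the remaining
  -- fuel and time.
  suffices H : ∀ r i m, i + r = N → I i m → ∃ m',
      Eff col (F + r + 1) ((r + 1) * (T + (2 + β))) (.loop (.dir a) p) m m' ∧ I N m' from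
    H N 0 m (by omega) h0
  intro r
  induction r with
  | zero =>
    intro i m hi hI
    obtain rfl : i = N := by omega
    refine ⟨m, fun s hs => ⟨s.charge (2 + bits (s.mem a)), fun fuel hf => ?_, hs, rfl, rfl, ?_⟩, hI⟩
    · obtain ⟨f, rfl, hf'⟩ := exists_fuel_eq_succ hf
      exact exec_loop_neg (by rw [hs]; exact hend m hI)
    · have := hβ i m le_rfl hI
      rw [← hs] at this
      simp only [State.charge]
      nlinarith
  | succ r ih =>
    intro i m hi hI
    obtain ⟨hpos, m₁, hm₁, hI₁⟩ := hstep i m (by omega) hI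
    obtain ⟨m', hm', hI'⟩ := ih (i + 1) m₁ (by omega) hI₁
    refine ⟨m', fun s hs => ?_, hI'⟩
    obtain ⟨s₁, a1, a2, a3, a4, a5⟩ := hm₁ (s.charge (2 + bits (s.mem a))) hs
    obtain ⟨s₂, b1, b2, b3, b4, b5⟩ := hm' s₁ a2
    refine ⟨s₂, fun fuel hf => ?_, b2, b3.trans a3, b4.trans a4, ?_⟩
    · obtain ⟨f, rfl, hf'⟩ := exists_fuel_eq_succ hf
      rw [exec_loop_pos (by rw [hs]; exact hpos), a1 f (by omega)]
      simp [b1 f (by omega)]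
    · have := hβ i m (by omega) hI
      rw [← hs] at this
      simp only [State.charge] at a5
      nlinarith

/-! ### Simulation of random programs -/

variable (col)

/-- The final state of the program `p` started in `s` can be coupled with a random variable of
distribution `D` such that the relation `R` holds almost surely. -/
def Sim {α : Type} (F : ℕ) (p : Prog) (s : State n) (D : PMF α) (R : α → State n → Prop) : Prop :=
  ∀ fuel ≥ F, ∃ J : PMF (α × State n), J.map Prod.fst = D ∧
    exec col fuel p s = J.map (fun x => some x.2) ∧ ∀ x ∈ J.support, R x.1 x.2

variable {col}

theorem Sim.mono {α : Type} {F F' : ℕ} {p : Prog} {s : State n} {D : PMF α}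
    {R R' : α → State n → Prop} (h : Sim col F p s D R) (hF : F ≤ F')
    (hR : ∀ a s', R a s' → R' a s') : Sim col F' p s D R' := by
  intro fuel hf
  obtain ⟨J, h1, h2, h3⟩ := h fuel (hF.trans hf)
  exact ⟨J, h1, h2, fun x hx => hR _ _ (h3 x hx)⟩

theorem Sim.seq {α β : Type} {F₁ F₂ : ℕ} {p q : Prog} {s : State n} {D : PMF α} {E : α → PMF β}
    {R : α → State n → Prop} {R' : β → State n → Prop} (hp : Sim col F₁ p s D R)
    (hq : ∀ a s', R a s' → Sim col F₂ q s' (E a) R') :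
    Sim col (max F₁ F₂ + 1) (.seq p q) s (D.bind E) R' := by
  intro fuel hf
  obtain ⟨f, rfl, hf'⟩ := exists_fuel_eq_succ hf
  obtain ⟨J, h1, h2, h3⟩ := hp f (le_of_max_le_left hf')
  obtain ⟨J', g1, g2, g3⟩ := exists_coupling_bind (E := E) (e := exec col f q) (R := R') h1
    fun x hx => hq _ _ (h3 x hx) f (le_of_max_le_right hf')
  exact ⟨J', g1, by rw [← g2, ← h2, exec], g3⟩

/-- One round is unrolled, so a loop becomes an iterated `PMF.bind` of the abstract process. -/
theorem Sim.loop_pos {α β : Type} {F₁ F₂ a : ℕ} {p : Prog} {s : State n} {D : PMF α}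
    {E : α → PMF β} {R : α → State n → Prop} {R' : β → State n → Prop} (h : 0 < s.mem a)
    (hp : Sim col F₁ p (s.charge (2 + bits (s.mem a))) D R)
    (hq : ∀ a' s', R a' s' → Sim col F₂ (.loop (.dir a) p) s' (E a') R') :
    Sim col (max F₁ F₂ + 1) (.loop (.dir a) p) s (D.bind E) R' := by
  intro fuel hf
  obtain ⟨f, rfl, hf'⟩ := exists_fuel_eq_succ hf
  obtain ⟨J, h1, h2, h3⟩ := hp f (le_of_max_le_left hf')
  obtain ⟨J', g1, g2, g3⟩ := exists_coupling_bind (E := E) (e := exec col f (.loop (.dir a) p))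
    (R := R') h1 fun x hx => hq _ _ (h3 x hx) f (le_of_max_le_right hf')
  exact ⟨J', g1, by rw [← g2, ← h2, exec_loop_pos h], g3⟩

theorem Sim.of_exec {α : Type} {F : ℕ} {p : Prog} {s s' : State n}
    (h : ∀ fuel ≥ F, exec col fuel p s = PMF.pure (some s')) (a : α) {R : α → State n → Prop}
    (hR : R a s') : Sim col F p s (PMF.pure a) R := by
  intro fuel hf
  refine ⟨PMF.pure (a, s'), by rw [PMF.pure_map], by rw [h fuel hf, PMF.pure_map], ?_⟩
  intro x hx
  rw [PMF.mem_support_pure_iff] at hx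
  subst hx; exact hR

theorem Sim.loop_neg {α : Type} {a : ℕ} {p : Prog} {s : State n} (h : s.mem a ≤ 0) (x : α)
    {R : α → State n → Prop} (hR : R x (s.charge (2 + bits (s.mem a)))) :
    Sim col 1 (.loop (.dir a) p) s (PMF.pure x) R := by
  refine Sim.of_exec (fun fuel hf => ?_) x hR
  obtain ⟨f, rfl, -⟩ := exists_fuel_eq_succ hf
  exact exec_loop_neg h

theorem Sim.of_eff {α : Type} {F T : ℕ} {p : Prog} {s : State n} {m' : ℕ → ℤ}
    (h : Eff col F T p s.mem m') (a : α) {R : α → State n → Prop}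
    (hR : ∀ s' : State n, s'.mem = m' → s'.vtx = s.vtx → s'.queries = s.queries →
      s'.time ≤ s.time + T → R a s') : Sim col F p s (PMF.pure a) R := by
  obtain ⟨s', h1, h2, h3, h4, h5⟩ := h s rfl
  exact Sim.of_exec h1 a (hR s' h2 h3 h4 h5)

theorem Sim.unif (d : ℕ) (s : State n) :
    Sim col 1 (.unif (.dir d)) s (PMF.uniformOfFintype (Fin n))
      (fun j s' => s' = ((s.setVtx (.dir d) (some j)).charge 2).query) := by
  intro fuel hf
  obtain ⟨f, rfl, -⟩ := exists_fuel_eq_succ hf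
  refine ⟨(PMF.uniformOfFintype (Fin n)).map
    fun j => (j, ((s.setVtx (.dir d) (some j)).charge 2).query), ?_, ?_, ?_⟩
  · rw [PMF.map_comp]; exact PMF.map_id _
  · rw [PMF.map_comp]; rfl
  · intro x hx
    rw [PMF.mem_support_map_iff] at hx
    obtain ⟨j, -, rfl⟩ := hx
    rfl

theorem Sim.sample (d v : ℕ) (s : State n) {b : Fin n} (hb : s.vtx v = some b) :
    Sim col 1 (.sample (.dir d) (.dir v)) s (col b)
      (fun j s' => s' = ((s.setVtx (.dir d) (some j)).charge 3).query) := by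
  intro fuel hf
  obtain ⟨f, rfl, -⟩ := exists_fuel_eq_succ hf
  refine ⟨(col b).map fun j => (j, ((s.setVtx (.dir d) (some j)).charge 3).query), ?_, ?_, ?_⟩
  · rw [PMF.map_comp]; exact PMF.map_id _
  · have : s.vert (.dir v) = some b := hb
    simp only [exec, this, PMF.map_comp]
    rfl
  · intro x hx
    rw [PMF.mem_support_map_iff] at hx
    obtain ⟨j, -, rfl⟩ := hx
    rfl

theorem Sim.test {α : Type} (d v w : ℕ) (s : State n) (x : α) :
    Sim col 1 (.test (.dir d) (.dir v) (.dir w)) s (PMF.pure x)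
      (fun y s' => y = x ∧
        s' = (s.setMem (.dir d) (if s.vtx v = s.vtx w then 1 else 0)).charge 4) := by
  refine Sim.of_exec (fun fuel hf => ?_) x ⟨rfl, rfl⟩
  obtain ⟨f, rfl, -⟩ := exists_fuel_eq_succ hf
  rfl

/-- Sequential composition with a deterministic first part. -/
theorem Sim.seq_pure {α β : Type} {F₁ F₂ : ℕ} {p q : Prog} {s : State n} {a : α} {E : PMF β}
    {R : α → State n → Prop} {R' : β → State n → Prop} (hp : Sim col F₁ p s (PMF.pure a) R)
    (hq : ∀ a' s', R a' s' → Sim col F₂ q s' E R') :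
    Sim col (max F₁ F₂ + 1) (.seq p q) s E R' := by
  have := hp.seq (E := fun _ => E) hq
  rwa [PMF.pure_bind] at this

end

end

end SpectralSampling

namespace SpectralSampling

open MeasureTheory
open scoped ENNReal

noncomputable section

/-! ### The sampling phase -/

/-- Run a list of programs one after the other. -/
def block : Prog → List Prog → Prog
  | p, [] => p
  | p, q :: l => .seq p (block q l)

def addP (d a b : ℕ) : Prog := .arith .add (.dir d) (.dir a) (.dir b)
def subP (d a b : ℕ) : Prog := .arith .sub (.dir d) (.dir a) (.dir b)
def mulP (d a b : ℕ) : Prog := .arith .mul (.dir d) (.dir a) (.dir b)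
def divP (d a b : ℕ) : Prog := .arith .div (.dir d) (.dir a) (.dir b)
def copyP (d a : ℕ) : Prog := .copy (.dir d) (.dir a)
def constP (d : ℕ) (z : ℤ) : Prog := .const (.dir d) z

/-- Count a return of the walk: the indicator in cell `28` is added to the digit of cell `26`
at the position given by cell `24`, which then moves on to the next digit. -/
def recordBlock : Prog := block (mulP 28 28 24) [addP 26 26 28, divP 24 24 16]

/-- One random walk from vertex cell `0`, with its first step already in vertex cell `1`. -/
def walkLoop : Prog :=
  .loop (.dir 24) (.seq (.test (.dir 28) (.dir 0) (.dir 1))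
    (.seq recordBlock (.sample (.dir 1) (.dir 1))))

/-- One random walk from a uniformly random vertex. -/
def walkBody : Prog :=
  .seq (.unif (.dir 0)) (.seq (.sample (.dir 1) (.dir 0))
    (.seq (copyP 24 22) (.seq walkLoop (subP 12 12 2))))

/-- As many random walks as cell `12` says. -/
def sampleLoop : Prog := .loop (.dir 12) walkBody

section

variable {n : ℕ} (col : Fin n → PMF (Fin n)) (L : ℕ)

/-- The return counts after the last `l` steps of a walk of length `L` that started in `a` and is
now in `b`. -/
def walk (a : Fin n) : ℕ → Fin n → (ℕ → ℕ) → PMF (ℕ → ℕ)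
  | 0, _, M => PMF.pure M
  -- The comparison precedes the step, and the walk enters with its first step made: for l + 1 = L
  -- the index written is L - l = 1. The vertex drawn last is never compared.
  | l + 1, b, M => (col b).bind fun c =>
      walk a l c (if a = b then Function.update M (L - l) (M (L - l) + 1) else M)

/-- The return counts after one more walk. -/
def rep [NeZero n] (M : ℕ → ℕ) : PMF (ℕ → ℕ) :=
  (PMF.uniformOfFintype (Fin n)).bind fun a => (col a).bind fun b => walk col L a L b M

/-- The return counts after `t` more walks. -/
def reps [NeZero n] : ℕ → (ℕ → ℕ) → PMF (ℕ → ℕ)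
  | 0, M => PMF.pure M
  | t + 1, M => (rep col L M).bind (reps t)

/-- Return counts coded in base `B`. -/
def hval (B : ℤ) (M : ℕ → ℕ) : ℤ := ∑ j ∈ Finset.range (L + 1), (M j : ℤ) * B ^ (L - j)

variable {L}

theorem hval_update (B : ℤ) (M : ℕ → ℕ) {l : ℕ} (hl : l ≤ L) :
    hval L B (Function.update M (L - l) (M (L - l) + 1)) = hval L B M + B ^ l := by
  unfold hval
  have h : L - l ∈ Finset.range (L + 1) := Finset.mem_range.mpr (by omega)
  rw [← Finset.add_sum_erase _ _ h, ← Finset.add_sum_erase _ _ h]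
  have e : ∑ x ∈ (Finset.range (L + 1)).erase (L - l),
      (Function.update M (L - l) (M (L - l) + 1) x : ℤ) * B ^ (L - x) =
      ∑ x ∈ (Finset.range (L + 1)).erase (L - l), (M x : ℤ) * B ^ (L - x) := by
    refine Finset.sum_congr rfl fun x hx => ?_
    rw [Function.update_of_ne (Finset.ne_of_mem_erase hx)]
  rw [e, Function.update_self, Nat.sub_sub_self hl]
  push_cast
  ring

/-- What the sampling phase needs to know about the memory it starts with. -/
structure SampleReady (L β U : ℕ) (B : ℤ) (m₀ : ℕ → ℤ) : Prop where
  one_lt : 1 < B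
  cell_one : m₀ 2 = 1
  cell_base : m₀ 16 = B
  cell_top : m₀ 22 = B ^ L / B
  bd : Bd β m₀
  one_le : 1 ≤ β
  bits_hval : ∀ M : ℕ → ℕ, (∀ j, M j ≤ U) → bits (hval L B M) ≤ β
  bits_pow : ∀ l ≤ L, bits (B ^ l / B) ≤ β

/-- States during the sampling phase. -/
structure Sampling (L β : ℕ) (B : ℤ) (m₀ : ℕ → ℤ) (r z : ℤ) (M : ℕ → ℕ) (U T q : ℕ)
    (s : State n) : Prop where
  frame : ∀ i, i ≠ 12 → i ≠ 24 → i ≠ 26 → i ≠ 28 → s.mem i = m₀ i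
  cell_count : s.mem 12 = r
  cell_pos : s.mem 24 = z
  cell_code : s.mem 26 = hval L B M
  bits_tmp : bits (s.mem 28) ≤ β
  bound : ∀ j, M j ≤ U
  time_le : s.time ≤ T
  queries_le : s.queries ≤ q

theorem Sampling.bd {β U₀ : ℕ} {B : ℤ} {m₀ : ℕ → ℤ} {r z : ℤ} {M : ℕ → ℕ} {U T q : ℕ}
    {s : State n} (hr : SampleReady L β U₀ B m₀) (h : Sampling L β B m₀ r z M U T q s)
    (hU : U ≤ U₀) (hrb : bits r ≤ β) (hz : bits z ≤ β) : Bd β s.mem := by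
  intro i
  by_cases h1 : i = 12
  · subst h1; rw [h.cell_count]; exact hrb
  by_cases h2 : i = 24
  · subst h2; rw [h.cell_pos]; exact hz
  by_cases h3 : i = 26
  · subst h3; rw [h.cell_code]; exact hr.bits_hval M fun j => (h.bound j).trans hU
  by_cases h4 : i = 28
  · subst h4; exact h.bits_tmp
  rw [h.frame i h1 h2 h3 h4]
  exact hr.bd i

theorem bits_indicator {β : ℕ} (hβ : 1 ≤ β) (p : Prop) [Decidable p] :
    bits (if p then 1 else 0) ≤ β := by
  rw [bits_le_iff]
  have : (2 : ℤ) ^ 1 ≤ 2 ^ β := pow_le_pow_right₀ (by norm_num) hβ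
  norm_num at this
  split_ifs <;> norm_num
  linarith

/-- Time of one step of a walk. -/
def stepTime (β : ℕ) : ℕ := (scost recordBlock + 9) * (1 + β) ^ 2

variable [NeZero n] {col}

/-- With l steps left the position cell holds B^l / B. This is the place value B^(l-1) of the next
digit if l > 0, and 0 if l = 0, so the same cell ends the loop. A step raises any count by at most
one, whence the bound U + l. -/
theorem sim_walkLoop {β U₀ : ℕ} {B : ℤ} {m₀ : ℕ → ℤ} (hr : SampleReady L β U₀ B m₀) {r : ℤ}
    (hrb : bits r ≤ β) (a : Fin n) (l : ℕ) (hl : l ≤ L) (b : Fin n) (M : ℕ → ℕ) (U T q : ℕ)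
    (hU : U + l ≤ U₀) (s : State n) (hs : Sampling L β B m₀ r (B ^ l / B) M U T q s)
    (ha : s.vtx 0 = some a) (hb : s.vtx 1 = some b) :
    Sim col (sdepth recordBlock + 4 + l) walkLoop s (walk col L a l b M)
      (fun M' s' => Sampling L β B m₀ r 0 M' (U + l) (T + (l + 1) * stepTime β) (q + l) s') := by
  have hB0 : (0 : ℤ) < B := by linarith [hr.one_lt]
  induction l generalizing b M U T q s with
  | zero =>
    have hz : s.mem 24 = 0 := by
      rw [hs.cell_pos, pow_zero]
      exact Int.ediv_eq_zero_of_lt (by norm_num) hr.one_lt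
    refine (Sim.loop_neg (by rw [hz]) M ?_).mono (by omega) fun _ _ h => h
    refine ⟨hs.frame, hs.cell_count, hz, hs.cell_code, hs.bits_tmp, hs.bound, ?_, hs.queries_le⟩
    rw [hz]
    have : bits 0 = 0 := rfl
    simp only [State.charge, this]
    have := hs.time_le
    unfold stepTime
    nlinarith [Nat.zero_le (scost recordBlock * (1 + β) ^ 2)]
  | succ l ih =>
    have hz : s.mem 24 = B ^ l := by
      rw [hs.cell_pos, pow_succ, Int.mul_ediv_cancel _ hB0.ne']
    have hbz : bits (s.mem 24) ≤ β := by
      rw [hs.cell_pos]; exact hr.bits_pow _ hl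
    have hpos : 0 < s.mem 24 := by rw [hz]; positivity
    rw [walk]
    set M₁ := if a = b then Function.update M (L - l) (M (L - l) + 1) else M with hM₁
    -- after one round, before the tail of the loop
    refine (Sim.loop_pos (a := 24) (F₁ := sdepth recordBlock + 3)
      (F₂ := sdepth recordBlock + 4 + l) (D := col b)
      (R := fun c s' => Sampling L β B m₀ r (B ^ l / B) M₁ (U + 1) (T + stepTime β) (q + 1) s' ∧
        s'.vtx 0 = some a ∧ s'.vtx 1 = some c) hpos ?_ ?_).mono (by omega) fun _ _ h => h
    · refine (Sim.seq_pure (Sim.test 28 0 1 _ ()) (F₂ := sdepth recordBlock + 2) ?_).mono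
        (by omega) fun _ _ h => h
      rintro _ s₁ ⟨-, rfl⟩
      set s₁ := ((s.charge (2 + bits (s.mem 24))).setMem (.dir 28)
        (if (s.charge (2 + bits (s.mem 24))).vtx 0 = (s.charge (2 + bits (s.mem 24))).vtx 1
          then 1 else 0)).charge 4 with hs₁
      have hmem : s₁.mem = Function.update s.mem 28 (if a = b then 1 else 0) := by
        simp [hs₁, State.charge, State.setMem, State.addr, ha, hb]
      have hbd : Bd β s₁.mem := by
        rw [hmem]
        exact (hs.bd hr (by omega) hrb (hr.bits_pow _ hl)).update _ (bits_indicator hr.one_le _)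
      have hst : Straight recordBlock := by
        simp [recordBlock, block, Straight, mulP, addP, divP]
      refine (Sim.seq_pure (Sim.of_eff (Eff.straight hst hbd) () (R := fun _ s₂ =>
        s₂.mem = memEval recordBlock s₁.mem ∧ s₂.vtx = s.vtx ∧ s₂.queries = s.queries ∧
          s₂.time ≤ s₁.time + scost recordBlock * (1 + β) ^ 2) ?_) (F₂ := 1) ?_).mono
        (by simp [sdepth, recordBlock, block, mulP, addP, divP]) fun _ _ h => h
      · intro s₂ h1 h2 h3 h4
        exact ⟨h1, h2, h3, h4⟩
      · rintro - s₂ ⟨h1, h2, h3, h4⟩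
        refine (Sim.sample 1 1 s₂ (by rw [h2, hb])).mono le_rfl ?_
        rintro c s₃ rfl
        have hmem2 : s₂.mem = memEval recordBlock
          (Function.update s.mem 28 (if a = b then 1 else 0)) := by rw [h1, hmem]
        have h16 : s.mem 16 = B := by
          rw [hs.frame 16 (by norm_num) (by norm_num) (by norm_num) (by norm_num), hr.cell_base]
        simp [recordBlock, block, memEval, mulP, addP, divP, laddr, Op.eval, hz, h16,
          hs.cell_code] at hmem2
        refine ⟨⟨?_, ?_, ?_, ?_, ?_, ?_, ?_, ?_⟩, ?_, ?_⟩
        · intro i h12 h24 h26 h28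
          simp only [State.query, State.charge, State.setVtx]
          rw [hmem2, Function.update_of_ne h24, Function.update_of_ne h26,
            Function.update_of_ne h28]
          exact hs.frame i h12 h24 h26 h28
        · simp only [State.query, State.charge, State.setVtx]
          rw [hmem2]
          simpa using hs.cell_count
        · simp only [State.query, State.charge, State.setVtx]
          rw [hmem2]
          simp
        · simp only [State.query, State.charge, State.setVtx]
          rw [hmem2, hM₁]
          split_ifs with hab
          · rw [hval_update B M (by omega)]; simp
          · simp
        · simp only [State.query, State.charge, State.setVtx]
          rw [hmem2]
          rw [hz] at hbz
          have h0 : bits 0 ≤ β := by simp [bits]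
          split_ifs <;> simp [hbz, h0]
        · intro j
          have := hs.bound j
          rw [hM₁]
          split_ifs
          · rcases eq_or_ne j (L - l) with rfl | hj
            · simp; omega
            · rw [Function.update_of_ne hj]; omega
          · omega
        · have := hs.time_le
          simp only [State.query, State.charge, State.setVtx, State.setMem, hs₁] at h4 ⊢
          unfold stepTime
          nlinarith [Nat.zero_le (scost recordBlock * (1 + β) ^ 2)]
        · have := hs.queries_le
          simp only [State.query, State.charge, State.setVtx] at h3 ⊢
          omega
        · simp [State.query, State.charge, State.setVtx, State.addr, h2, ha]
        · simp [State.query, State.charge, State.setVtx, State.addr]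
    · rintro c s' ⟨h1, h2, h3⟩
      refine (ih (by omega) c M₁ (U + 1) (T + stepTime β) (q + 1) (by omega) s' h1 h2 h3).mono
        le_rfl ?_
      intro M' s'' h
      have e1 : U + 1 + l = U + (l + 1) := by ring
      have e2 : T + stepTime β + (l + 1) * stepTime β = T + (l + 1 + 1) * stepTime β := by ring
      have e3 : q + 1 + l = q + (l + 1) := by ring
      rw [e1, e2, e3] at h
      exact h

/-- Time of one walk. -/
def walkTime (L β : ℕ) : ℕ := (L + 5) * stepTime β

/-- A walk makes L + 2 oracle calls: its start, its first step, and one draw after each of the L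
comparisons. -/
theorem sim_sampleLoop {β U₀ : ℕ} {B : ℤ} {m₀ : ℕ → ℤ} (hr : SampleReady L β U₀ B m₀) (t : ℕ)
    (htb : bits t ≤ β) (M : ℕ → ℕ) (U T q : ℕ) (hU : U + t * L ≤ U₀) (s : State n)
    (hs : Sampling L β B m₀ t 0 M U T q s) :
    Sim col (sdepth recordBlock + 20 + L + t) sampleLoop s (reps col L t M)
      (fun M' s' => Sampling L β B m₀ 0 0 M' (U + t * L) (T + (t + 1) * walkTime L β)
        (q + t * (L + 2)) s') := by
  induction t generalizing M U T q s with
  | zero =>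
    have hz : s.mem 12 = 0 := by rw [hs.cell_count]; rfl
    refine (Sim.loop_neg (by rw [hz]) M ?_).mono (by omega) fun _ _ h => h
    refine ⟨hs.frame, hz, hs.cell_pos, hs.cell_code, hs.bits_tmp, by simpa using hs.bound, ?_,
      by simpa [State.charge] using hs.queries_le⟩
    rw [hz]
    have : bits 0 = 0 := rfl
    simp only [State.charge, this]
    have := hs.time_le
    have h2 : 2 ≤ stepTime β := by
      unfold stepTime
      nlinarith [Nat.zero_le (scost recordBlock * (1 + β) ^ 2)]
    unfold walkTime
    nlinarith
  | succ t ih =>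
    have hpos : 0 < s.mem 12 := by rw [hs.cell_count]; positivity
    have htb' : bits (t : ℤ) ≤ β := by
      rw [bits_le_iff] at htb ⊢
      rw [Nat.abs_cast] at htb ⊢
      push_cast at htb
      linarith
    have h0 : bits 0 ≤ β := by simp [bits]
    have hstep : 9 * (1 + β) ^ 2 ≤ stepTime β := by
      unfold stepTime; gcongr; omega
    rw [reps]
    refine (Sim.loop_pos (a := 12) (F₁ := sdepth recordBlock + 19 + L)
      (F₂ := sdepth recordBlock + 20 + L + t) (D := rep col L M)
      (R := fun M' s' => Sampling L β B m₀ t 0 M' (U + L) (T + walkTime L β) (q + (L + 2)) s')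
      hpos ?_ ?_).mono (by omega) fun _ _ h => h
    · refine (Sim.seq (Sim.unif 0 _) (F₂ := sdepth recordBlock + 18 + L) ?_).mono (by omega)
        fun _ _ h => h
      rintro a s₁ rfl
      set s₁ := (((s.charge (2 + bits (s.mem 12))).setVtx (.dir 0) (some a)).charge 2).query
        with hs₁
      refine (Sim.seq (Sim.sample 1 0 s₁ (b := a) (by simp [hs₁, State.charge, State.query,
        State.setVtx, State.addr])) (F₂ := sdepth recordBlock + 17 + L) ?_).mono (by omega)
        fun _ _ h => h
      rintro b s₂ rfl
      set s₂ := ((s₁.setVtx (.dir 1) (some b)).charge 3).query with hs₂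
      have hmem₂ : s₂.mem = s.mem := rfl
      have hbd : Bd β s₂.mem := by
        rw [hmem₂]; exact hs.bd hr ((Nat.le_add_right _ _).trans hU) htb h0
      have hst : Straight (copyP 24 22) := trivial
      refine (Sim.seq_pure (Sim.of_eff (Eff.straight hst hbd) () (R := fun _ s₃ =>
        Sampling L β B m₀ (t + 1 : ℕ) (B ^ L / B) M U (T + 3 * stepTime β) (q + 2) s₃ ∧
          s₃.vtx 0 = some a ∧ s₃.vtx 1 = some b) ?_) (F₂ := sdepth recordBlock + 16 + L) ?_).mono
        (by simp only [sdepth, copyP]; omega) fun _ _ h => h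
      · intro s₃ h1 h2 h3 h4
        have hm3 : s₃.mem = Function.update s.mem 24 (B ^ L / B) := by
          rw [h1, hmem₂]
          simp [copyP, memEval, laddr, hs.frame 22, hr.cell_top]
        refine ⟨⟨?_, ?_, ?_, ?_, ?_, hs.bound, ?_, ?_⟩, ?_, ?_⟩
        · intro i h12 h24 h26 h28
          rw [hm3, Function.update_of_ne h24]
          exact hs.frame i h12 h24 h26 h28
        · rw [hm3]; simpa using hs.cell_count
        · rw [hm3]; simp
        · rw [hm3]; simpa using hs.cell_code
        · rw [hm3]; simpa using hs.bits_tmp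
        · have e1 := hs.time_le
          have e2 : bits (s.mem 12) ≤ β := by rw [hs.cell_count]; exact htb
          have e3 : scost (copyP 24 22) = 4 := rfl
          simp only [hs₂, hs₁, State.query, State.charge, State.setVtx, e3] at h4
          nlinarith
        · have := hs.queries_le
          rw [h3]
          simp only [hs₂, hs₁, State.query, State.charge, State.setVtx]
          omega
        · rw [h2]; simp [hs₂, hs₁, State.query, State.charge, State.setVtx, State.addr]
        · rw [h2]; simp [hs₂, State.query, State.charge, State.setVtx, State.addr]
      · rintro - s₃ ⟨h1, h2, h3⟩
        have hw := sim_walkLoop (col := col) hr htb a L le_rfl b M U _ _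
          (by nlinarith) s₃ h1 h2 h3
        have := hw.seq (q := subP 12 12 2) (E := PMF.pure) (F₂ := 1) (R' := fun M' s' =>
          Sampling L β B m₀ t 0 M' (U + L) (T + walkTime L β) (q + (L + 2)) s') ?_
        · rw [PMF.bind_pure] at this
          exact this.mono (by omega) fun _ _ h => h
        · intro M' s₄ h4
          have hbd4 : Bd β s₄.mem := h4.bd hr (by nlinarith) htb h0
          have hst4 : Straight (subP 12 12 2) := trivial
          refine Sim.of_eff (Eff.straight hst4 hbd4) M' ?_
          intro s₅ g1 _ g3 g4
          have hm5 : s₅.mem = Function.update s₄.mem 12 t := by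
            rw [g1]
            simp [subP, memEval, laddr, Op.eval, h4.frame 2, hr.cell_one, h4.cell_count]
          refine ⟨?_, ?_, ?_, ?_, ?_, h4.bound, ?_, ?_⟩
          · intro i h12 h24 h26 h28
            rw [hm5, Function.update_of_ne h12]
            exact h4.frame i h12 h24 h26 h28
          · rw [hm5]; simp
          · rw [hm5]; simpa using h4.cell_pos
          · rw [hm5]; simpa using h4.cell_code
          · rw [hm5]; simpa using h4.bits_tmp
          · have e1 := h4.time_le
            have e3 : scost (subP 12 12 2) = 4 := rfl
            rw [e3] at g4
            unfold walkTime
            nlinarith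
          · have := h4.queries_le
            omega
    · intro M' s' h1
      refine (ih htb' M' (U + L) (T + walkTime L β) (q + (L + 2)) (by nlinarith) s' h1).mono
        le_rfl ?_
      intro M'' s'' h
      have e1 : U + L + t * L = U + (t + 1) * L := by ring
      have e2 : T + walkTime L β + (t + 1) * walkTime L β = T + (t + 1 + 1) * walkTime L β := by
        ring
      have e3 : q + (L + 2) + t * (L + 2) = q + (t + 1) * (L + 2) := by ring
      rw [e1, e2, e3] at h
      exact h

end

end

end SpectralSampling

namespace SpectralSampling

open MeasureTheory
open scoped ENNReal

noncomputable section

/-! ### Return probabilities and moments -/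

/-- Expectation of a non-negative function. -/
def ex {α : Type*} (p : PMF α) (f : α → ℝ≥0∞) : ℝ≥0∞ := ∑' x, p x * f x

theorem ex_pure {α : Type*} (a : α) (f : α → ℝ≥0∞) : ex (PMF.pure a) f = f a := by
  unfold ex
  rw [tsum_eq_single a]
  · simp
  · intro b hb; rw [PMF.pure_apply_of_ne a b hb, zero_mul]

theorem ex_bind {α β : Type*} (p : PMF α) (q : α → PMF β) (f : β → ℝ≥0∞) :
    ex (p.bind q) f = ex p fun a => ex (q a) f := by
  unfold ex
  simp_rw [PMF.bind_apply, ← ENNReal.tsum_mul_right, ← ENNReal.tsum_mul_left]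
  rw [ENNReal.tsum_comm]
  simp_rw [mul_assoc]

/-- Markov's inequality, in the form from which Chebyshev's is obtained with a scaled square. -/
theorem toOuterMeasure_le_ex {α : Type*} (p : PMF α) (s : Set α) (f : α → ℝ≥0∞)
    (hf : ∀ x ∈ s, 1 ≤ f x) : p.toOuterMeasure s ≤ ex p f := by
  rw [PMF.toOuterMeasure_apply, ex]
  refine ENNReal.tsum_le_tsum fun x => ?_
  by_cases hx : x ∈ s
  · rw [Set.indicator_of_mem hx]
    exact le_mul_of_one_le_right' (hf x hx)
  · rw [Set.indicator_of_notMem hx]; exact zero_le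

theorem ex_column {n : ℕ} {A : Matrix (Fin n) (Fin n) ℝ}
    (hA : A ∈ Matrix.colStochastic ℝ (Fin n)) (j : Fin n) (f : Fin n → ℝ≥0∞) :
    ex (column A hA j) f = ∑ i, ENNReal.ofReal (A i j) * f i := by
  rw [ex, tsum_fintype]; rfl

theorem ex_uniform {n : ℕ} [NeZero n] (f : Fin n → ℝ≥0∞) :
    ex (PMF.uniformOfFintype (Fin n)) f = ∑ i, ENNReal.ofReal (1 / n) * f i := by
  rw [ex, tsum_fintype]
  have hn : 0 < n := Nat.pos_of_ne_zero (NeZero.ne n)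
  refine Finset.sum_congr rfl fun i _ => ?_
  rw [PMF.uniformOfFintype_apply, Fintype.card_fin, one_div,
    ENNReal.ofReal_inv_of_pos (by exact_mod_cast hn), ENNReal.ofReal_natCast]

theorem sum_ofReal_mul_ofReal {ι : Type*} (s : Finset ι) {p f : ι → ℝ} (hp : ∀ i ∈ s, 0 ≤ p i)
    (hf : ∀ i ∈ s, 0 ≤ f i) :
    ∑ i ∈ s, ENNReal.ofReal (p i) * ENNReal.ofReal (f i) = ENNReal.ofReal (∑ i ∈ s, p i * f i) := by
  rw [ENNReal.ofReal_sum_of_nonneg fun i hi => mul_nonneg (hp i hi) (hf i hi)]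
  exact Finset.sum_congr rfl fun i hi => (ENNReal.ofReal_mul (hp i hi)).symm

section

variable {n : ℕ} {A : Matrix (Fin n) (Fin n) ℝ}

theorem pow_entry_nonneg (hA : A ∈ Matrix.colStochastic ℝ (Fin n)) (r : ℕ) (i j : Fin n) :
    0 ≤ (A ^ r) i j :=
  Matrix.nonneg_of_mem_colStochastic (pow_mem hA r)

theorem pow_entry_le_one (hA : A ∈ Matrix.colStochastic ℝ (Fin n)) (r : ℕ) (i j : Fin n) :
    (A ^ r) i j ≤ 1 :=
  Matrix.le_one_of_mem_colStochastic (pow_mem hA r)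

/-- With l steps left only the indices above L - l are still written. -/
theorem ex_walk_of_le (hA : A ∈ Matrix.colStochastic ℝ (Fin n)) {L : ℕ} (a : Fin n) {j : ℕ}
    (f : ℕ → ℝ≥0∞) (l : ℕ) (hl : l ≤ L) (hj : j ≤ L - l) (b : Fin n) (M : ℕ → ℕ) :
    ex (walk (column A hA) L a l b M) (fun M' => f (M' j)) = f (M j) := by
  induction l generalizing b M with
  | zero => rw [walk, ex_pure]
  | succ l ih =>
    rw [walk, ex_bind]
    have e : ∀ c, ex (walk (column A hA) L a l c
        (if a = b then Function.update M (L - l) (M (L - l) + 1) else M)) (fun M' => f (M' j)) =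
        f (M j) := by
      intro c
      rw [ih (by omega) (by omega)]
      split_ifs
      · rw [Function.update_of_ne (by omega)]
      · rfl
    simp_rw [e]
    rw [ex, ENNReal.tsum_mul_right, PMF.tsum_coe, one_mul]

/-- The index shown is tested after r further steps, when the walk from b is at a with probability
(A^r)_{ab}; the induction conditions on the next vertex. A general φ is kept since repeated walks
require second moments. -/
theorem ex_walk (hA : A ∈ Matrix.colStochastic ℝ (Fin n)) {L : ℕ} (a : Fin n) {φ : ℕ → ℝ}
    (hφ : ∀ x, 0 ≤ φ x) (l r : ℕ) (hl : l ≤ L) (hr : r < l) (b : Fin n) (M : ℕ → ℕ) :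
    ex (walk (column A hA) L a l b M) (fun M' => ENNReal.ofReal (φ (M' (L - l + 1 + r)))) =
      ENNReal.ofReal ((A ^ r) a b * φ (M (L - l + 1 + r) + 1) +
        (1 - (A ^ r) a b) * φ (M (L - l + 1 + r))) := by
  induction l generalizing r b M with
  | zero => omega
  | succ l ih =>
    rw [walk, ex_bind]
    have ej : L - (l + 1) + 1 = L - l := by omega
    rw [ej]
    rcases r with _ | r
    · rw [add_zero]
      have e : ∀ c, ex (walk (column A hA) L a l c
          (if a = b then Function.update M (L - l) (M (L - l) + 1) else M))
          (fun M' => ENNReal.ofReal (φ (M' (L - l)))) =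
          ENNReal.ofReal (φ (M (L - l) + if a = b then 1 else 0)) := by
        intro c
        rw [ex_walk_of_le hA a (fun x => ENNReal.ofReal (φ x)) l (by omega) le_rfl]
        split_ifs <;> simp
      simp_rw [e]
      rw [ex, ENNReal.tsum_mul_right, PMF.tsum_coe, one_mul, pow_zero, Matrix.one_apply]
      split_ifs <;> simp
    · have ei : L - l + (r + 1) = L - l + 1 + r := by ring
      rw [ei]
      have e : ∀ c, ex (walk (column A hA) L a l c
          (if a = b then Function.update M (L - l) (M (L - l) + 1) else M))
          (fun M' => ENNReal.ofReal (φ (M' (L - l + 1 + r)))) =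
          ENNReal.ofReal ((A ^ r) a c * φ (M (L - l + 1 + r) + 1) +
            (1 - (A ^ r) a c) * φ (M (L - l + 1 + r))) := by
        intro c
        rw [ih r (by omega) (by omega)]
        split_ifs
        · rw [Function.update_of_ne (by omega)]
        · rfl
      simp_rw [e]
      rw [ex_column, sum_ofReal_mul_ofReal]
      · congr 1
        have h1 := Matrix.sum_col_of_mem_colStochastic hA b
        have h2 : (A ^ (r + 1)) a b = ∑ c, (A ^ r) a c * A c b := by
          rw [pow_succ, Matrix.mul_apply]
        set x := φ (M (L - l + 1 + r) + 1)
        set y := φ (M (L - l + 1 + r))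
        have h3 : ∀ c, A c b * ((A ^ r) a c * x + (1 - (A ^ r) a c) * y) =
            (A ^ r) a c * A c b * (x - y) + A c b * y := fun c => by ring
        simp_rw [h3]
        rw [Finset.sum_add_distrib, ← Finset.sum_mul, ← Finset.sum_mul, ← h2, h1]
        ring
      · exact fun c _ => Matrix.nonneg_of_mem_colStochastic hA
      · intro c _
        have h1 := pow_entry_nonneg hA r a c
        have h2 := pow_entry_le_one hA r a c
        have h3 := hφ (M (L - l + 1 + r) + 1)
        have h4 := hφ (M (L - l + 1 + r))
        have h5 : 0 ≤ 1 - (A ^ r) a c := by linarith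
        positivity

/-- Probability that a walk from a uniformly random vertex is back after `j` steps. -/
def returnProb (A : Matrix (Fin n) (Fin n) ℝ) (j : ℕ) : ℝ := (A ^ j).trace / n

/-- Return probabilities are the moments of the spectral distribution. -/
theorem returnProb_eq {Q : Matrix (Fin n) (Fin n) ℝ} {lam : Fin n → ℝ} (hQ : IsUnit Q)
    (h : A = Q * Matrix.diagonal lam * Q⁻¹) (j : ℕ) :
    returnProb A j = (∑ l, lam l ^ j) / n := by
  have hdet : IsUnit Q.det := (Matrix.isUnit_iff_isUnit_det Q).mp hQ
  have hp : A ^ j = Q * Matrix.diagonal lam ^ j * Q⁻¹ := by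
    induction j with
    | zero => simp [Matrix.mul_nonsing_inv Q hdet]
    | succ j ih =>
      rw [pow_succ, ih, pow_succ]
      conv_lhs => rw [h]
      simp only [← Matrix.mul_assoc]
      rw [Matrix.nonsing_inv_mul_cancel_right _ _ hdet]
  rw [returnProb, hp, Matrix.trace_mul_comm, ← Matrix.mul_assoc, Matrix.nonsing_inv_mul Q hdet,
    Matrix.one_mul, Matrix.diagonal_pow, Matrix.trace_diagonal]
  simp

theorem cast_dim_pos [NeZero n] : (0 : ℝ) < n := by
  exact_mod_cast Nat.pos_of_ne_zero (NeZero.ne n)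

theorem returnProb_nonneg (hA : A ∈ Matrix.colStochastic ℝ (Fin n)) (j : ℕ) :
    0 ≤ returnProb A j :=
  div_nonneg (Finset.sum_nonneg fun i _ => pow_entry_nonneg hA j i i) (by positivity)

variable [NeZero n]

theorem returnProb_le_one (hA : A ∈ Matrix.colStochastic ℝ (Fin n)) (j : ℕ) :
    returnProb A j ≤ 1 := by
  have hn : (0 : ℝ) < n := cast_dim_pos
  rw [returnProb, div_le_one hn]
  calc (A ^ j).trace ≤ ∑ _i : Fin n, (1 : ℝ) :=
        Finset.sum_le_sum fun i _ => pow_entry_le_one hA j i i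
    _ = n := by simp

theorem returnProb_zero : returnProb A 0 = 1 := by
  have hn : (0 : ℝ) < n := cast_dim_pos
  simp [returnProb, hn.ne']

theorem ex_rep_zero (hA : A ∈ Matrix.colStochastic ℝ (Fin n)) (L : ℕ) (f : ℕ → ℝ≥0∞)
    (M : ℕ → ℕ) : ex (rep (column A hA) L M) (fun M' => f (M' 0)) = f (M 0) := by
  rw [rep, ex_bind]
  simp_rw [ex_bind, ex_walk_of_le hA _ f L le_rfl (Nat.zero_le _)]
  simp_rw [ex, ENNReal.tsum_mul_right, PMF.tsum_coe, one_mul]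
  rw [ENNReal.tsum_mul_right, PMF.tsum_coe, one_mul]

/-- Averaging (A^(r+1))_{aa} over the start gives the trace. A single count is thus incremented by a
Bernoulli variable; how different counts of one walk depend on each other never matters. -/
theorem ex_rep (hA : A ∈ Matrix.colStochastic ℝ (Fin n)) {L : ℕ} {φ : ℕ → ℝ}
    (hφ : ∀ x, 0 ≤ φ x) {r : ℕ} (hr : r < L) (M : ℕ → ℕ) :
    ex (rep (column A hA) L M) (fun M' => ENNReal.ofReal (φ (M' (r + 1)))) =
      ENNReal.ofReal (returnProb A (r + 1) * φ (M (r + 1) + 1) +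
        (1 - returnProb A (r + 1)) * φ (M (r + 1))) := by
  have hn : (0 : ℝ) < n := cast_dim_pos
  rw [rep, ex_bind]
  simp_rw [ex_bind]
  have e : L - L + 1 + r = r + 1 := by omega
  have h := fun a b => ex_walk hA (L := L) a hφ L r le_rfl hr b M
  rw [e] at h
  simp_rw [h]
  set x := φ (M (r + 1) + 1) with hx
  set y := φ (M (r + 1)) with hy
  have hx0 : 0 ≤ x := hφ _
  have hy0 : 0 ≤ y := hφ _
  have hpos : ∀ a b, 0 ≤ (A ^ r) a b * x + (1 - (A ^ r) a b) * y := by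
    intro a b
    have h1 := pow_entry_nonneg hA r a b
    have h2 : 0 ≤ 1 - (A ^ r) a b := by linarith [pow_entry_le_one hA r a b]
    positivity
  have e2 : ∀ a, ex (column A hA a)
      (fun b => ENNReal.ofReal ((A ^ r) a b * x + (1 - (A ^ r) a b) * y)) =
      ENNReal.ofReal ((A ^ (r + 1)) a a * (x - y) + y) := by
    intro a
    rw [ex_column, sum_ofReal_mul_ofReal _
      (fun c _ => Matrix.nonneg_of_mem_colStochastic hA) fun b _ => hpos a b]
    congr 1
    have h1 := Matrix.sum_col_of_mem_colStochastic hA a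
    have h2 : (A ^ (r + 1)) a a = ∑ c, (A ^ r) a c * A c a := by
      rw [pow_succ, Matrix.mul_apply]
    have h3 : ∀ c, A c a * ((A ^ r) a c * x + (1 - (A ^ r) a c) * y) =
        (A ^ r) a c * A c a * (x - y) + A c a * y := fun c => by ring
    simp_rw [h3]
    rw [Finset.sum_add_distrib, ← Finset.sum_mul, ← Finset.sum_mul, ← h2, h1]
    ring
  simp_rw [e2]
  rw [ex_uniform, sum_ofReal_mul_ofReal]
  · congr 1
    rw [← Finset.mul_sum, Finset.sum_add_distrib, ← Finset.sum_mul]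
    have : ∑ i, (A ^ (r + 1)) i i = n * returnProb A (r + 1) := by
      rw [returnProb, mul_div_cancel₀ _ hn.ne']; rfl
    rw [this]
    simp only [Finset.sum_const, Finset.card_univ, Fintype.card_fin, nsmul_eq_mul]
    field_simp
    ring
  · intros; positivity
  · intro a _
    have h1 := pow_entry_nonneg hA (r + 1) a a
    have h2 : 0 ≤ 1 - (A ^ (r + 1)) a a := by linarith [pow_entry_le_one hA (r + 1) a a]
    nlinarith [mul_nonneg h1 hx0, mul_nonneg h2 hy0]

/-- Bias and variance: every walk moves the mean by p and adds p - p^2 to the variance, and the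
resulting quadratic has the form to which `ex_rep` applies again. The count at time 0 is preset and
never written. -/
theorem ex_reps_sq (hA : A ∈ Matrix.colStochastic ℝ (Fin n)) {L : ℕ} {j : ℕ} (hj : j ≤ L) {κ : ℝ}
    (hκ : 0 ≤ κ) (y : ℝ) (t : ℕ) (M : ℕ → ℕ) :
    ex (reps (column A hA) L t M) (fun M' => ENNReal.ofReal (κ * ((M' j : ℝ) - y) ^ 2)) =
      ENNReal.ofReal (if j = 0 then κ * ((M 0 : ℝ) - y) ^ 2 else
        κ * ((M j + t * returnProb A j - y) ^ 2 +
          t * (returnProb A j - returnProb A j ^ 2))) := by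
  induction t generalizing M with
  | zero =>
    rw [reps, ex_pure]
    split_ifs with h
    · rw [h]
    · simp
  | succ t ih =>
    rw [reps, ex_bind]
    simp_rw [ih]
    split_ifs with h
    · exact ex_rep_zero hA L (fun x => ENNReal.ofReal (κ * ((x : ℝ) - y) ^ 2)) M
    · obtain ⟨r, rfl⟩ := Nat.exists_eq_succ_of_ne_zero h
      set p := returnProb A (r + 1) with hp
      have hp0 : 0 ≤ p := returnProb_nonneg hA _
      have hp1 : p ≤ 1 := returnProb_le_one hA _
      have hv : 0 ≤ p - p ^ 2 := by nlinarith
      rw [ex_rep hA (φ := fun x => κ * (((x : ℝ) + t * p - y) ^ 2 + t * (p - p ^ 2)))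
        (fun x => by positivity) (by omega) M, ← hp]
      congr 1
      push_cast
      ring

/-- All empirical return frequencies are accurate with probability at least `2 / 3`. -/
theorem reps_bad_le (hA : A ∈ Matrix.colStochastic ℝ (Fin n)) {L G : ℕ} (hG : 3 * (L + 1) ≤ 4 * G)
    {M₀ : ℕ → ℕ} (h0 : M₀ 0 = G ^ 3) (h1 : ∀ j, 0 < j → M₀ j = 0) :
    (reps (column A hA) L (G ^ 3) M₀).toOuterMeasure
      {M | ¬ ∀ j ≤ L, |(M j : ℝ) - (G : ℝ) ^ 3 * returnProb A j| ≤ (G : ℝ) ^ 2} ≤ 1 / 3 := by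
  have hG0 : (0 : ℝ) < G := by
    have : 0 < G := by omega
    exact_mod_cast this
  set D := reps (column A hA) L (G ^ 3) M₀ with hD
  have hone : ∀ j ≤ L, D.toOuterMeasure
      {M | ¬ |(M j : ℝ) - (G : ℝ) ^ 3 * returnProb A j| ≤ (G : ℝ) ^ 2} ≤
        -- Chebyshev's inequality with variance at most G^3/4 and deviation G^2.
        ENNReal.ofReal (1 / (4 * G)) := by
    intro j hj
    refine (toOuterMeasure_le_ex D _ (fun M => ENNReal.ofReal (1 / (G : ℝ) ^ 4 *
      ((M j : ℝ) - (G : ℝ) ^ 3 * returnProb A j) ^ 2)) ?_).trans ?_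
    · intro M hM
      rw [Set.mem_ofPred_eq, not_le] at hM
      rw [← ENNReal.ofReal_one]
      apply ENNReal.ofReal_le_ofReal
      rw [one_div, ← div_eq_inv_mul, one_le_div (by positivity), ← sq_abs]
      calc (G : ℝ) ^ 4 = ((G : ℝ) ^ 2) ^ 2 := by ring
        _ ≤ _ := pow_le_pow_left₀ (by positivity) hM.le 2
    · rw [hD, ex_reps_sq hA hj (by positivity)]
      apply ENNReal.ofReal_le_ofReal
      have hq : 1 / (G : ℝ) ^ 4 * ((G : ℝ) ^ 3 * (1 / 4)) = 1 / (4 * G) := by field_simp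
      split_ifs with hj0
      · subst hj0
        rw [returnProb_zero, h0]
        push_cast
        simp
      · rw [h1 j (by omega), ← hq]
        push_cast
        have : returnProb A j - returnProb A j ^ 2 ≤ 1 / 4 := by
          nlinarith [sq_nonneg (returnProb A j - 1 / 2)]
        rw [show (0 + (G : ℝ) ^ 3 * returnProb A j - (G : ℝ) ^ 3 * returnProb A j) ^ 2 = 0 by ring,
          zero_add]
        gcongr
  have hsub : {M : ℕ → ℕ | ¬ ∀ j ≤ L, |(M j : ℝ) - (G : ℝ) ^ 3 * returnProb A j| ≤ (G : ℝ) ^ 2} ⊆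
      ⋃ j ∈ Finset.range (L + 1),
        {M | ¬ |(M j : ℝ) - (G : ℝ) ^ 3 * returnProb A j| ≤ (G : ℝ) ^ 2} := by
    intro M hM
    simp only [Set.mem_ofPred_eq, not_forall] at hM
    obtain ⟨j, hj, hM⟩ := hM
    simp only [Set.mem_iUnion, Finset.mem_range]
    exact ⟨j, by omega, hM⟩
  calc _ ≤ D.toOuterMeasure (⋃ j ∈ Finset.range (L + 1), _) := measure_mono hsub
    _ ≤ ∑ j ∈ Finset.range (L + 1), D.toOuterMeasure _ := measure_biUnion_finset_le _ _
    _ ≤ ∑ _j ∈ Finset.range (L + 1), ENNReal.ofReal (1 / (4 * G)) :=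
        Finset.sum_le_sum fun j hj => hone j (by rw [Finset.mem_range] at hj; omega)
    _ = ENNReal.ofReal ((L + 1) * (1 / (4 * G))) := by
        rw [Finset.sum_const, Finset.card_range, nsmul_eq_mul, ENNReal.ofReal_mul (by positivity)]
        congr 1
        rw [← ENNReal.ofReal_natCast]; push_cast; rfl
    _ ≤ ENNReal.ofReal (1 / 3) := by
        apply ENNReal.ofReal_le_ofReal
        rw [mul_one_div, div_le_div_iff₀ (by positivity) (by norm_num)]
        have : (3 * (L + 1) : ℝ) ≤ 4 * G := by exact_mod_cast hG
        linarith
    _ = 1 / 3 := by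
        rw [ENNReal.ofReal_div_of_pos (by norm_num)]; simp

end

end

end SpectralSampling

namespace SpectralSampling

open MeasureTheory
open scoped ENNReal

noncomputable section

open Polynomial

/-! ### Accuracy of the output -/

/-- This is where 65536 comes from: 1 + 8m ≤ 9^m and 2 ≤ 2^m reduce the claim to 2 · 9 · 22^4 ≤
65536 · 4^4. -/
theorem noise_le {m G : ℕ} (hm : 1 ≤ m) (hG : G = 65536 ^ m) :
    2 * ((22 * (G : ℤ) ^ 2) ^ (4 * m) * (1 + 8 * m)) ≤ G * (4 * (G : ℤ) ^ 2) ^ (4 * m) := by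
  have h9 : (1 + 8 * m : ℤ) ≤ 9 ^ m := by
    have := one_add_mul_le_pow (a := (8 : ℤ)) (by norm_num) m
    norm_num at this
    linarith
  have h2 : (2 : ℤ) ≤ 2 ^ m := by
    calc (2 : ℤ) = 2 ^ 1 := by norm_num
      _ ≤ 2 ^ m := pow_le_pow_right₀ (by norm_num) hm
  rw [mul_pow, mul_pow]
  have hc : (2 : ℤ) ^ m * (22 ^ (4 * m) * 9 ^ m) ≤ G * 4 ^ (4 * m) := by
    rw [hG, pow_mul, pow_mul]
    push_cast
    rw [← mul_pow, ← mul_pow, ← mul_pow]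
    exact pow_le_pow_left₀ (by norm_num) (by norm_num) m
  calc 2 * (22 ^ (4 * m) * ((G : ℤ) ^ 2) ^ (4 * m) * (1 + 8 * m))
      = 2 * (22 ^ (4 * m) * (1 + 8 * m)) * ((G : ℤ) ^ 2) ^ (4 * m) := by ring
    _ ≤ 2 ^ m * (22 ^ (4 * m) * 9 ^ m) * ((G : ℤ) ^ 2) ^ (4 * m) := by gcongr
    _ ≤ G * 4 ^ (4 * m) * ((G : ℤ) ^ 2) ^ (4 * m) := by gcongr
    _ = _ := by ring

/-- Accuracy of one weight. -/
theorem weight_close {n : ℕ} [NeZero n] {m G : ℕ} (hm : 1 ≤ m) (hG : G = 65536 ^ m)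
    {lam : Fin n → ℝ} (hlam : ∀ l, |lam l| ≤ 1) {x : Fin n → ℤ} (hx : ∀ l, |x l| ≤ G)
    (hxl : ∀ l, |lam l - x l / G| ≤ 1 / G) {M : ℕ → ℕ}
    (hM : ∀ j ≤ 8 * m, |(M j : ℝ) - (G : ℝ) ^ 3 * ((∑ l, lam l ^ j) / n)| ≤ (G : ℝ) ^ 2)
    {y : ℤ} (hy : |y| ≤ 2 * G) :
    |((∑ j ∈ Finset.range (8 * m + 1), (fPoly m G y).coeff j * (M j : ℤ) : ℤ) : ℝ) -
        (G : ℝ) ^ 3 * (4 * (G : ℝ) ^ 2) ^ (4 * m) * ((∑ l, gker m G (x l - y)) / n)| ≤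
      (G : ℝ) ^ 3 * (4 * (G : ℝ) ^ 2) ^ (4 * m) / 2 := by
  have hn : (0 : ℝ) < n := cast_dim_pos
  have hG0 : 0 < G := by rw [hG]; positivity
  have hG' : (0 : ℝ) < G := by exact_mod_cast hG0
  set f := fPoly m G y with hf
  have hdeg : f.natDegree ≤ 8 * m := natDegree_fPoly_le m G y
  have hl1 : (l1 f : ℝ) ≤ (22 * (G : ℝ) ^ 2) ^ (4 * m) := by exact_mod_cast l1_fPoly_le m hy
  have hl0 : (0 : ℝ) ≤ l1 f := by exact_mod_cast l1_nonneg f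
  have hker : ∀ l, aeval ((x l : ℝ) / G) f = (4 * (G : ℝ) ^ 2) ^ (4 * m) * gker m G (x l - y) := by
    intro l
    rw [hf, aeval_fPoly m hG0, gker]
    congr 4
    push_cast
    field_simp
  have heval : ∀ z : ℝ, aeval z f = ∑ j ∈ Finset.range (8 * m + 1), (f.coeff j : ℝ) * z ^ j := by
    intro z
    rw [aeval_eq_sum_range' (by omega : f.natDegree < 8 * m + 1)]
    simp
  have hmom : ∑ j ∈ Finset.range (8 * m + 1), (f.coeff j : ℝ) * ((∑ l, lam l ^ j) / n) =
      (∑ l, aeval (lam l) f) / n := by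
    simp_rw [heval]
    rw [Finset.sum_comm, Finset.sum_div]
    refine Finset.sum_congr rfl fun j _ => ?_
    rw [← Finset.mul_sum, mul_div_assoc]
  have h1 : |∑ j ∈ Finset.range (8 * m + 1), (f.coeff j : ℝ) *
      ((M j : ℝ) - (G : ℝ) ^ 3 * ((∑ l, lam l ^ j) / n))| ≤ l1 f * (G : ℝ) ^ 2 := by
    refine (Finset.abs_sum_le_sum_abs _ _).trans ?_
    rw [l1_eq_sum f (s := Finset.range (8 * m + 1))
      (supp_subset_range (by omega))]
    push_cast
    rw [Finset.sum_mul]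
    refine Finset.sum_le_sum fun j hj => ?_
    rw [abs_mul]
    gcongr
    exact hM j (by rw [Finset.mem_range] at hj; omega)
  have h2 : |(∑ l, aeval (lam l) f) / n - (∑ l, aeval ((x l : ℝ) / G) f) / n| ≤
      (8 * m : ℕ) * l1 f / G := by
    rw [← sub_div, ← Finset.sum_sub_distrib, abs_div, abs_of_pos hn, div_le_iff₀ hn]
    refine (Finset.abs_sum_le_sum_abs _ _).trans ?_
    calc ∑ l, |aeval (lam l) f - aeval ((x l : ℝ) / G) f|
        ≤ ∑ _l : Fin n, (8 * m : ℕ) * l1 f / (G : ℝ) := by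
          refine Finset.sum_le_sum fun l _ => ?_
          refine (abs_aeval_sub_le f hdeg (hlam l) ?_).trans ?_
          · rw [abs_div, abs_of_pos hG', div_le_one hG']
            exact_mod_cast hx l
          · exact (mul_le_mul_of_nonneg_left (hxl l) (by positivity)).trans (le_of_eq (by ring))
      _ = _ := by simp; ring
  -- The error has two parts, from sampling the moments and from moving the eigenvalues to the grid.
  -- They are at most 1 and 8m times `l1 f` · G^2.
  have hsplit : ((∑ j ∈ Finset.range (8 * m + 1), f.coeff j * (M j : ℤ) : ℤ) : ℝ) -
        (G : ℝ) ^ 3 * (4 * (G : ℝ) ^ 2) ^ (4 * m) * ((∑ l, gker m G (x l - y)) / n) =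
      (∑ j ∈ Finset.range (8 * m + 1), (f.coeff j : ℝ) *
        ((M j : ℝ) - (G : ℝ) ^ 3 * ((∑ l, lam l ^ j) / n))) +
      (G : ℝ) ^ 3 * ((∑ l, aeval (lam l) f) / n - (∑ l, aeval ((x l : ℝ) / G) f) / n) := by
    rw [← hmom]
    simp_rw [hker, mul_sub]
    rw [Finset.sum_sub_distrib, ← Finset.mul_sum, Finset.mul_sum]
    push_cast
    have : ∀ j, (f.coeff j : ℝ) * ((G : ℝ) ^ 3 * ((∑ l, lam l ^ j) / n)) =
      (G : ℝ) ^ 3 * ((f.coeff j : ℝ) * ((∑ l, lam l ^ j) / n)) := fun j => by ring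
    simp_rw [this]
    ring
  rw [hsplit]
  refine (abs_add_le _ _).trans ?_
  rw [abs_mul, abs_of_pos (by positivity : (0 : ℝ) < (G : ℝ) ^ 3)]
  have hnoise : 2 * ((22 * (G : ℝ) ^ 2) ^ (4 * m) * (1 + 8 * m)) ≤
      G * (4 * (G : ℝ) ^ 2) ^ (4 * m) := by exact_mod_cast noise_le hm hG
  calc _ ≤ l1 f * (G : ℝ) ^ 2 + (G : ℝ) ^ 3 * ((8 * m : ℕ) * l1 f / G) := by gcongr
    _ = l1 f * (1 + 8 * m) * (G : ℝ) ^ 2 := by push_cast; field_simp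
    _ ≤ (22 * (G : ℝ) ^ 2) ^ (4 * m) * (1 + 8 * m) * (G : ℝ) ^ 2 := by gcongr
    _ ≤ (G * (4 * (G : ℝ) ^ 2) ^ (4 * m) / 2) * (G : ℝ) ^ 2 := by gcongr; linarith
    _ = _ := by ring

theorem exists_grid_points {ι : Type*} {G : ℕ} (hG : 0 < G) {lam : ι → ℝ}
    (hlam : ∀ l, |lam l| ≤ 1) :
    ∃ x : ι → ℤ, (∀ l, |x l| ≤ G) ∧ ∀ l, |lam l - x l / G| ≤ 1 / G := by
  have hG' : (0 : ℝ) < G := by exact_mod_cast hG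
  refine ⟨fun l => ⌊(G : ℝ) * lam l⌋, fun l => ?_, fun l => ?_⟩
  · have h1 := abs_le.mp (hlam l)
    rw [abs_le]
    constructor
    · rw [Int.le_floor]; push_cast; nlinarith
    · have : (⌊(G : ℝ) * lam l⌋ : ℝ) ≤ G := (Int.floor_le _).trans (by nlinarith)
      exact_mod_cast this
  · have h1 := Int.floor_le ((G : ℝ) * lam l)
    have h2 := Int.lt_floor_add_one ((G : ℝ) * lam l)
    have e : lam l - ⌊(G : ℝ) * lam l⌋ / G = (G * lam l - ⌊(G : ℝ) * lam l⌋) / G := by field_simp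
    rw [e, abs_div, abs_of_pos hG', abs_of_nonneg (by linarith)]
    gcongr
    linarith

/-- The weights computed from accurate return counts define a distribution that is close to the
spectral distribution. -/
theorem W1_weights_le {n : ℕ} [NeZero n] {k m G : ℕ} (hk : 1 ≤ k) (hm : m = 256 * k)
    (hG : G = 65536 ^ m) {lam : Fin n → ℝ} (hlam : ∀ l, |lam l| ≤ 1) {M : ℕ → ℕ}
    (hM : ∀ j ≤ 8 * m, |(M j : ℝ) - (G : ℝ) ^ 3 * ((∑ l, lam l ^ j) / n)| ≤ (G : ℝ) ^ 2)
    {W : ℤ → ℤ} (hW : ∀ y : ℤ, |y| ≤ 2 * G → ∃ e : ℤ, 0 ≤ e ∧ e ≤ 1 ∧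
      W y = (∑ j ∈ Finset.range (8 * m + 1), (fPoly m G y).coeff j * (M j : ℤ)) +
        (G : ℤ) ^ 3 * (4 * (G : ℤ) ^ 2) ^ (4 * m) - e) :
    (∀ y : ℤ, |y| ≤ 2 * G → 0 ≤ W y) ∧
    0 < ∑ y ∈ Finset.Icc (-((2 * G : ℕ) : ℤ)) ((2 * G : ℕ) : ℤ), W y ∧
    W1 (∑ y ∈ Finset.Icc (-((2 * G : ℕ) : ℤ)) ((2 * G : ℕ) : ℤ), ENNReal.ofReal ((W y : ℝ) /
        ((∑ z ∈ Finset.Icc (-((2 * G : ℕ) : ℤ)) ((2 * G : ℕ) : ℤ), W z : ℤ) : ℝ)) •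
          Measure.dirac ((y : ℝ) / G)) (spectralDistribution lam) ≤ ENNReal.ofReal (1 / k) := by
  have hn : (0 : ℝ) < n := cast_dim_pos
  have hm1 : 1 ≤ m := by omega
  have hG0 : 0 < G := by rw [hG]; positivity
  have hG' : (0 : ℝ) < G := by exact_mod_cast hG0
  have hmG : 2 * m + 1 ≤ G := by
    rw [hG]
    calc 2 * m + 1 ≤ 3 ^ m := by
          have := one_add_mul_le_pow (a := (2 : ℤ)) (by norm_num) m
          norm_num at this
          have h : (1 + 2 * m : ℤ) ≤ 3 ^ m := by linarith
          have h' : 1 + 2 * m ≤ 3 ^ m := by exact_mod_cast h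
          omega
      _ ≤ 65536 ^ m := Nat.pow_le_pow_left (by norm_num) m
  set S := Finset.Icc (-((2 * G : ℕ) : ℤ)) ((2 * G : ℕ) : ℤ) with hS
  have hSmem : ∀ y ∈ S, |y| ≤ 2 * G := by
    intro y hy
    rw [hS, Finset.mem_Icc] at hy
    rw [abs_le]; push_cast at hy; exact hy
  obtain ⟨x, hx, hxl⟩ := exists_grid_points hG0 hlam
  set σ : ℝ := (G : ℝ) ^ 3 * (4 * (G : ℝ) ^ 2) ^ (4 * m) with hσ
  have hσ2 : 2 ≤ σ := by
    have h1 : (1 : ℝ) ≤ G := by exact_mod_cast hG0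
    have h2 : (3 : ℝ) ≤ G := by
      have : 3 ≤ G := by omega
      exact_mod_cast this
    have h3 : (1 : ℝ) ≤ (4 * (G : ℝ) ^ 2) ^ (4 * m) := one_le_pow₀ (by nlinarith)
    have h4 : (2 : ℝ) ≤ (G : ℝ) ^ 3 := by nlinarith [pow_le_pow_left₀ (by norm_num) h2 3]
    rw [hσ]; nlinarith
  have hσ0 : 0 < σ := by linarith
  -- The excess of a normalized weight over the kernel average. The shift contributes 1, the noise
  -- at most 1/2 in absolute value, and digit rounding subtracts at most 1/σ ≤ 1/2, so the excess
  -- lies in [0, 2].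
  set e : ℤ → ℝ := fun y => (W y : ℝ) / σ - (∑ l, gker m G (x l - y)) / n with he
  have hebd : ∀ y ∈ S, 0 ≤ e y ∧ e y ≤ 2 := by
    intro y hy
    have hy' := hSmem y hy
    obtain ⟨d, hd0, hd1, hWy⟩ := hW y hy'
    have hc := weight_close hm1 hG hlam hx hxl hM hy'
    rw [← hσ, abs_le] at hc
    have hWr : (W y : ℝ) = ((∑ j ∈ Finset.range (8 * m + 1), (fPoly m G y).coeff j * (M j : ℤ) : ℤ)
        : ℝ) + σ - d := by
      rw [hWy, hσ]; push_cast; ring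
    have hd0' : (0 : ℝ) ≤ d := by exact_mod_cast hd0
    have hd1' : (d : ℝ) ≤ 1 := by exact_mod_cast hd1
    have hee : e y = ((W y : ℝ) - σ * ((∑ l, gker m G (x l - y)) / n)) / σ := by
      simp only [he]; field_simp
    rw [hee]
    constructor
    · apply div_nonneg _ hσ0.le
      rw [hWr]; linarith [hc.1]
    · rw [div_le_iff₀ hσ0, hWr]; linarith [hc.2]
  have hker0 : ∀ y, 0 ≤ (∑ l, gker m G (x l - y)) / n := fun y =>
    div_nonneg (Finset.sum_nonneg fun l _ => gker_nonneg _ _ _) hn.le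
  have hWnn : ∀ y ∈ S, 0 ≤ W y := by
    intro y hy
    have h1 := (hebd y hy).1
    simp only [he] at h1
    have h2 : 0 ≤ (W y : ℝ) / σ := by linarith [hker0 y]
    have h3 : (0 : ℝ) ≤ W y := by
      by_contra! hh
      exact absurd h2 (not_le.mpr (div_neg_of_neg_of_pos hh hσ0))
    exact_mod_cast h3
  have hlow := gsum_lower (m := m) hG0 (by omega)
  have htail := gsum_tail (m := m) hG0
  have hmom := gsum_moment hmG
  set nn : ℝ := 2 * (m : ℝ) + 1 with hnn
  have hnn512 : 512 * (k : ℝ) ≤ nn := by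
    rw [hnn, hm]; push_cast; linarith
  have hk' : (1 : ℝ) ≤ k := by exact_mod_cast hk
  have hnn0 : 512 ≤ nn := by linarith
  set lo := gsum m G G with hlo
  set hi := gsum m G (3 * G) with hhi
  have hlo0 : 0 < lo := lt_of_lt_of_le (by positivity) hlow
  have hrow : ∀ l, lo ≤ ∑ y ∈ S, gker m G (x l - y) ∧ ∑ y ∈ S, gker m G (x l - y) ≤ hi :=
    fun l => ⟨le_sum_window (gker_nonneg m G) (hx l), sum_window_le (gker_nonneg m G) (hx l)⟩
  have hlohi : lo ≤ hi :=
    (hrow ⟨0, Nat.pos_of_ne_zero (NeZero.ne n)⟩).1.trans (hrow _).2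
  have hcard : (S.card : ℝ) = 4 * G + 1 := by
    rw [hS, Int.card_Icc]
    have : (((2 * G : ℕ) : ℤ) + 1 - -((2 * G : ℕ) : ℤ)).toNat = 4 * G + 1 := by omega
    rw [this]; push_cast; ring
  -- The factor 4 undoes the scaling of the kernel's argument; the last term pays for rounding the
  -- eigenvalues.
  set Y := 4 * (hi / nn + 16 * G * nn ^ 2) + hi * (1 / G) with hY
  have hdist : ∀ (l : Fin n) (y : ℤ),
      |(y : ℝ) / G - lam l| ≤ 4 * (((|x l - y| : ℤ) : ℝ) / (4 * G)) + 1 / G := by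
    intro l y
    have e1 : (y : ℝ) / G - lam l = -((x l - y : ℝ) / G) - (lam l - x l / G) := by ring
    rw [e1]
    refine (abs_sub _ _).trans ?_
    have h2 := hxl l
    have h3 : |-((x l - y : ℝ) / G)| = 4 * (((|x l - y| : ℤ) : ℝ) / (4 * G)) := by
      rw [abs_neg, abs_div, abs_of_pos hG']
      push_cast
      field_simp
    linarith
  have hYrow : ∀ l, ∑ y ∈ S, gker m G (x l - y) * |(y : ℝ) / G - lam l| ≤ Y := by
    intro l
    calc _ ≤ ∑ y ∈ S, (4 * (gker m G (x l - y) * (((|x l - y| : ℤ) : ℝ) / (4 * G))) +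
          gker m G (x l - y) * (1 / G)) := by
          refine Finset.sum_le_sum fun y _ => ?_
          have := mul_le_mul_of_nonneg_left (hdist l y) (gker_nonneg m G (x l - y))
          linarith
      _ = 4 * (∑ y ∈ S, gker m G (x l - y) * (((|x l - y| : ℤ) : ℝ) / (4 * G))) +
          (∑ y ∈ S, gker m G (x l - y)) * (1 / G) := by
          rw [Finset.sum_add_distrib, ← Finset.mul_sum, ← Finset.sum_mul]
      _ ≤ Y := by
          rw [hY]
          gcongr
          · refine le_trans (sum_window_le (f := fun d => gker m G d * (((|d| : ℤ) : ℝ) / (4 * G)))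
              (fun d => ?_) (hx l)) hmom
            have := gker_nonneg m G d
            positivity
          · exact (hrow l).2
  -- Here η is the maximal excess 2 times the number 4G + 1 of grid points, and Δ = 3 is the largest
  -- distance between [-2, 2] and [-1, 1].
  have hmain := W1_le_of_kernel S (fun y : ℤ => (y : ℝ) / G) (fun y => (W y : ℝ) / σ) lam
    (fun l y => gker m G (x l - y)) e (lo := lo) (hi := hi) (η := 2 * (4 * G + 1)) (Y := Y)
    (Δ := 3) (fun l y _ => gker_nonneg _ _ _) (fun y hy => (hebd y hy).1)
    (fun y _ => by simp only [he]; ring)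
    (by
      refine (Finset.sum_le_card_nsmul S e 2 fun y hy => (hebd y hy).2).trans ?_
      rw [nsmul_eq_mul, hcard]; linarith)
    hlo0 hrow hYrow
    (fun l y hy => by
      have h1 : |(y : ℝ)| ≤ 2 * G := by exact_mod_cast hSmem y hy
      refine (abs_sub _ _).trans ?_
      rw [abs_div, abs_of_pos hG']
      have h2 : |(y : ℝ)| / G ≤ 2 := by rw [div_le_iff₀ hG']; exact h1
      linarith [hlam l])
  have hsumpos : 0 < ∑ y ∈ S, (W y : ℝ) / σ := by
    have h1 : ∑ y ∈ S, (W y : ℝ) / σ =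
        ∑ y ∈ S, (∑ l, gker m G (x l - y)) / n + ∑ y ∈ S, e y := by
      rw [← Finset.sum_add_distrib]
      refine Finset.sum_congr rfl fun y _ => ?_
      simp only [he]; ring
    have h2 : 0 ≤ ∑ y ∈ S, e y := Finset.sum_nonneg fun y hy => (hebd y hy).1
    have h3 : 0 < ∑ y ∈ S, (∑ l, gker m G (x l - y)) / n := by
      rw [← Finset.sum_div, Finset.sum_comm]
      apply div_pos _ hn
      have hne : (Finset.univ : Finset (Fin n)).Nonempty :=
        ⟨⟨0, Nat.pos_of_ne_zero (NeZero.ne n)⟩, Finset.mem_univ _⟩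
      exact Finset.sum_pos (fun l _ => hlo0.trans_le (hrow l).1) hne
    linarith
  have hsum : ∑ y ∈ S, (W y : ℝ) / σ = ((∑ y ∈ S, W y : ℤ) : ℝ) / σ := by
    rw [← Finset.sum_div]; push_cast; rfl
  refine ⟨fun y hy => hWnn y ?_, ?_, ?_⟩
  · rw [hS, Finset.mem_Icc]
    rw [abs_le] at hy
    push_cast; exact hy
  · rw [hsum] at hsumpos
    have : (0 : ℝ) < ((∑ y ∈ S, W y : ℤ) : ℝ) := by
      by_contra! hh
      exact absurd hsumpos (not_lt.mpr (div_nonpos_of_nonpos_of_nonneg hh hσ0.le))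
    exact_mod_cast this
  · have hout : ∀ y, (W y : ℝ) / ((∑ z ∈ S, W z : ℤ) : ℝ) =
        (W y : ℝ) / σ / ∑ z ∈ S, (W z : ℝ) / σ := by
      intro y
      rw [hsum, div_div_div_cancel_right₀ hσ0.ne']
    simp_rw [hout]
    refine hmain.trans (ENNReal.ofReal_le_ofReal ?_)
    have hhi0 : 0 < hi := hlo0.trans_le hlohi
    have hhilow : (G : ℝ) * nn ^ 3 / 4 ≤ hi := hlow.trans hlohi
    have hGnn : nn ≤ G := by rw [hnn]; exact_mod_cast hmG
    -- Here 261 = 4 + 256 + 1: the kernel near its centre, its tail, and rounding.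
    have a1 : Y / hi ≤ 261 / nn := by
      have : Y / hi = 4 / nn + 64 * G * nn ^ 2 / hi + 1 / G := by
        rw [hY]; field_simp; ring
      rw [this]
      have b1 : 64 * G * nn ^ 2 / hi ≤ 256 / nn := by
        rw [div_le_div_iff₀ hhi0 (by linarith)]
        linarith
      have b2 : 1 / (G : ℝ) ≤ 1 / nn := one_div_le_one_div_of_le (by linarith) hGnn
      have b3 : 4 / nn + 256 / nn + 1 / nn = 261 / nn := by ring
      linarith
    -- The residual mass is O(G) while `hi` is of order G · nn^3, so this term is of lower order.
    -- The total 262/nn is below 1/k since nn ≥ 512k.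
    have a2 : 3 * ((hi - lo + 2 * (4 * G + 1)) / hi) ≤ 1 / nn := by
      rw [← mul_div_assoc, div_le_div_iff₀ hhi0 (by linarith)]
      have hG1 : (1 : ℝ) ≤ G := by linarith
      have h1 : 3 * (hi - lo + 2 * (4 * G + 1)) ≤ 3102 * G := by linarith
      have h2 : 3102 * G * nn ≤ G * nn ^ 3 / 4 := by
        have : (12408 : ℝ) ≤ nn ^ 2 := by nlinarith
        have hGn : 0 ≤ G * nn := by positivity
        nlinarith [mul_le_mul_of_nonneg_left this hGn]
      have h3 : 3 * (hi - lo + 2 * (4 * G + 1)) * nn ≤ 3102 * G * nn :=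
        mul_le_mul_of_nonneg_right h1 (by linarith)
      linarith
    have a3 : 261 / nn + 1 / nn ≤ 1 / k := by
      rw [← add_div, div_le_div_iff₀ (by linarith) (by linarith)]
      linarith
    linarith

end

end SpectralSampling

namespace SpectralSampling

open MeasureTheory
open scoped ENNReal

noncomputable section

/-! ### Cells written by straight-line code -/

/-- Code that addresses all cells directly. -/
def Direct : Prog → Prop
  | .const (.dir _) _ => True
  | .copy (.dir _) (.dir _) => True
  | .arith _ (.dir _) (.dir _) (.dir _) => True
  | .seq p q => Direct p ∧ Direct q
  | _ => False

/-- The cells that directly addressed code writes. -/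
def writes : Prog → List ℕ
  | .const (.dir d) _ => [d]
  | .copy (.dir d) _ => [d]
  | .arith _ (.dir d) _ _ => [d]
  | .seq p q => writes p ++ writes q
  | _ => []

theorem Direct.straight {p : Prog} (hp : Direct p) : Straight p := by
  induction p with
  | const d z => trivial
  | copy d a => trivial
  | arith o d a b => trivial
  | seq p q ihp ihq => exact ⟨ihp hp.1, ihq hp.2⟩
  | _ => exact hp.elim

theorem Direct.memEval_of_notMem {p : Prog} (hp : Direct p) {i : ℕ} (hi : i ∉ writes p)
    (m : ℕ → ℤ) : memEval p m i = m i := by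
  induction p generalizing m with
  | const d z =>
    cases d with
    | dir d => exact Function.update_of_ne (by simpa [writes, laddr] using hi) _ _
    | ind d => exact hp.elim
  | copy d a =>
    cases d with
    | dir d => exact Function.update_of_ne (by simpa [writes, laddr] using hi) _ _
    | ind d => exact hp.elim
  | arith o d a b =>
    cases d with
    | dir d => exact Function.update_of_ne (by simpa [writes, laddr] using hi) _ _
    | ind d => exact hp.elim
  | seq p q ihp ihq =>
    simp only [writes, List.mem_append, not_or] at hi
    rw [memEval, ihq hp.2 hi.2, ihp hp.1 hi.1]
  | _ => exact hp.elim

theorem Direct.bd {p : Prog} (hp : Direct p) {β : ℕ} {m : ℕ → ℤ} (hm : Bd β m)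
    (h : ∀ i ∈ writes p, bits (memEval p m i) ≤ β) : Bd β (memEval p m) := by
  intro i
  by_cases hi : i ∈ writes p
  · exact h i hi
  · rw [hp.memEval_of_notMem hi]; exact hm i

/-! ### The program

Integer cells with scalar values have even numbers, so that the corresponding atoms of the output
have weight zero. They hold: `0` the input, later the denominator; `2` the number one; `4` the
degree `m`; `6` the grid size `G`; `8` loop counters; `10` the number `G ^ 3` of walks and `12` a
counter for them; `14` and `30` the numbers `4 * G ^ 2` and its square; `16` the base `B` of the
code; `18` bases of powers; `20` the number `B ^ (8 * m)`; `22` and `24` digit positions; `26` the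
coded return counts; `28` temporary values; `32`, `34`, `36` the kernel recursion; `38` the number
of atoms still to be written; `40` the number `2 * G + 1`; `42` the number `G * B`; `44` a shift
that makes all weights non-negative; `46` addresses; `48` and `50` the location and the weight of
an atom; `52` the offset of the atoms. -/

/-- Multiply cell `d` by the power of cell `18` with exponent in cell `8`. -/
def powBlock (d : ℕ) : Prog := block (mulP d d 18) [subP 8 8 2]

def powLoop (d : ℕ) : Prog := .loop (.dir 8) (powBlock d)

/-- All large numbers arise from loops of m multiplications: 65536^m, then G^8 · (G^8)^m = B, then
(B^8)^m = B^(8m), and in `shiftBlock` G^3 · (E^4)^m with E = 4G^2. -/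
def initBlock : Prog := block (constP 2 1)
  [constP 4 256, mulP 4 4 0, copyP 8 4, constP 6 1, constP 18 65536]

def gridBlock : Prog := block (mulP 10 6 6)
  [constP 14 4, mulP 14 14 10, mulP 10 10 6, mulP 30 14 14, mulP 18 6 6, mulP 18 18 18,
    mulP 18 18 18, copyP 16 18, copyP 8 4]

def baseBlock : Prog := block (mulP 18 16 16)
  [mulP 18 18 18, mulP 18 18 18, constP 20 1, copyP 8 4]

def shiftBlock : Prog := block (copyP 44 10) [mulP 18 30 30, copyP 8 4]

/-- The code in cell 26 starts at G^3 · B^(8m), not at 0: at time 0 each of the G^3 walks is at its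
start. -/
def startBlock : Prog := block (divP 22 20 16)
  [mulP 26 10 20, copyP 12 10, mulP 42 6 16, addP 40 6 6, addP 40 40 2, addP 38 40 6, addP 38 38 6,
    constP 52 52]

/-- Set up all parameters. -/
def setup : Prog := block (.seq initBlock (powLoop 6))
  [.seq gridBlock (powLoop 16), .seq baseBlock (powLoop 20), .seq shiftBlock (powLoop 44),
    startBlock]

/-- Cell 36 starts at -E. The general step V · 1 - (-E) then produces the irregular second term V +
E of the recursion. -/
def centerBlock : Prog := block (subP 48 38 40)
  [subP 32 42 48, mulP 32 32 32, addP 28 14 14, subP 32 28 32, constP 34 1, constP 28 0,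
    subP 36 28 14, copyP 8 4]

/-- Cell 34 holds the current term and cell 36 holds E^2 times the previous one. -/
def kernelBlock : Prog := block (mulP 28 32 34)
  [subP 28 28 36, mulP 36 30 34, copyP 34 28, subP 8 8 2]

def kernelLoop : Prog := .loop (.dir 8) kernelBlock

/-- Two squarings give the fourth power; the residue modulo B is x - (x / B) · B. Clearing cell 28
makes its bit bound trivial. -/
def digitBlock : Prog := block (mulP 50 34 34)
  [mulP 50 50 50, mulP 50 50 26, divP 50 50 20, addP 50 50 44, divP 28 50 16, mulP 28 28 16,
    subP 50 50 28, constP 28 0, addP 46 38 38, addP 46 46 52, subP 38 38 2]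

/-- The only indirect addressing in the program. -/
def storeBlock : Prog := block (.copy (.ind 46) (.dir 48))
  [addP 46 46 2, .copy (.ind 46) (.dir 50)]

/-- Write the atoms of the output. -/
def atomLoop : Prog :=
  .loop (.dir 38) (block centerBlock [kernelLoop, digitBlock, storeBlock])

/-- Besides the 4G + 1 genuine atoms, the number of atoms includes 26 of weight zero, made up by the
scalar cells 2 to 53. -/
def finishBlock : Prog := block (copyP 0 6) [addP 1 40 6, addP 1 1 6, constP 28 26, addP 1 1 28]

/-- The algorithm. -/
def spectralProgram : Prog := block setup [sampleLoop, atomLoop, finishBlock]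

/-! ### Bounds for numbers -/

/-- Bound for the bit length of all numbers. -/
def beta (m : ℕ) : ℕ := 16 * m * ((8 * m + 8) * (16 * m + 8))

/-- Since G = 2^(16m), bit bounds become comparisons of exponents of G. The exponent leaves room for
the code, of size G^5 · B^(8m), and for the kernel values at B. -/
theorem two_pow_beta (m : ℕ) : (2 : ℤ) ^ beta m =
    (((65536 ^ m : ℕ) : ℤ)) ^ ((8 * m + 8) * (16 * m + 8)) := by
  rw [beta, pow_mul (2 : ℤ) (16 * m), pow_mul (2 : ℤ) 16 m]
  norm_num

section

variable {m G : ℕ}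

theorem grid_ge (hm : 1 ≤ m) (hG : G = 65536 ^ m) : 65536 ≤ G := by
  rw [hG]
  calc 65536 = 65536 ^ 1 := by norm_num
    _ ≤ _ := Nat.pow_le_pow_right (by norm_num) hm

theorem bits_le_beta (hm : 1 ≤ m) (hG : G = 65536 ^ m) {z : ℤ} (a : ℕ) (h : |z| ≤ (G : ℤ) ^ a)
    (ha : a < (8 * m + 8) * (16 * m + 8)) : bits z ≤ beta m := by
  rw [bits_le_iff, two_pow_beta, ← hG]
  have := grid_ge hm hG
  exact h.trans_lt (pow_lt_pow_right₀ (by exact_mod_cast (by omega : 1 < G)) ha)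

theorem mul_add_le_grid (hm : 1 ≤ m) (hG : G = 65536 ^ m) : 8 * m + 1 ≤ G ∧ m + 2 ≤ G := by
  have h1 : (1 + m * 65535 : ℤ) ≤ (1 + 65535) ^ m := one_add_mul_le_pow (by norm_num) m
  have h2 : 1 + m * 65535 ≤ 65536 ^ m := by
    norm_num at h1
    exact_mod_cast h1
  omega

end

end

end SpectralSampling

namespace SpectralSampling

open MeasureTheory
open scoped ENNReal

noncomputable section

/-! ### The set-up phase -/

section

variable {n : ℕ} [NeZero n] {col : Fin n → PMF (Fin n)}

theorem eff_powLoop {d : ℕ} (h2 : d ≠ 2) (h8 : d ≠ 8) (h18 : d ≠ 18) {β c : ℕ} {μ : ℕ → ℤ}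
    (hμ : Bd β μ) (hone : μ 2 = 1) (hc : μ 8 = c) (hd : 0 ≤ μ d) (hb : 1 ≤ μ 18)
    (hβ : bits (μ d * μ 18 ^ c) ≤ β) :
    Eff col (sdepth (powBlock d) + c + 1) ((c + 1) * (scost (powBlock d) * (1 + β) ^ 2 + (2 + β)))
      (powLoop d) μ (Function.update (Function.update μ d (μ d * μ 18 ^ c)) 8 0) := by
  have hdir : Direct (powBlock d) := by simp [powBlock, block, Direct, mulP, subP]
  suffices H : ∃ μ', Eff col (sdepth (powBlock d) + c + 1)
      ((c + 1) * (scost (powBlock d) * (1 + β) ^ 2 + (2 + β))) (powLoop d) μ μ' ∧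
      μ' = Function.update (Function.update μ d (μ d * μ 18 ^ c)) 8 ((c : ℤ) - c) by
    obtain ⟨μ', h, rfl⟩ := H
    rwa [sub_self] at h
  refine Eff.loop (fun i μ' => μ' = Function.update (Function.update μ d (μ d * μ 18 ^ i)) 8
    ((c : ℤ) - i)) ?_ ?_ ?_ ?_
  · rintro i _ hi rfl
    have h1 := hμ 8
    rw [hc] at h1
    rw [Function.update_self]
    rw [bits_le_iff] at h1 ⊢
    rw [abs_of_nonneg (by omega)] at h1 ⊢
    omega
  · rintro i _ hi rfl
    refine ⟨by rw [Function.update_self]; omega, _, Eff.straight hdir.straight ?_, ?_⟩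
    · refine (hμ.update _ ?_).update _ ?_
      · rw [bits_le_iff] at hβ ⊢
        refine lt_of_le_of_lt ?_ hβ
        have hp : 0 ≤ μ 18 ^ i := by positivity
        rw [abs_of_nonneg (mul_nonneg hd hp), abs_of_nonneg (mul_nonneg hd (by positivity))]
        exact mul_le_mul_of_nonneg_left (pow_le_pow_right₀ hb hi.le) hd
      · have h1 := hμ 8
        rw [hc] at h1
        rw [bits_le_iff] at h1 ⊢
        rw [abs_of_nonneg (by omega)] at h1 ⊢
        omega
    · funext x
      simp only [powBlock, block, memEval, mulP, subP, laddr, Op.eval]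
      rcases eq_or_ne x 8 with rfl | hx8
      · simp [h8.symm, h2.symm, hone]; ring
      rcases eq_or_ne x d with rfl | hxd
      · simp [hx8, h18.symm]; ring
      simp [hx8, hxd]
  · rintro _ rfl
    simp
  · funext x
    rcases eq_or_ne x 8 with rfl | hx8
    · simp [hc]
    · simp [hx8]

/-- The memory after the set-up phase. -/
structure Ready (m G : ℕ) (μ : ℕ → ℤ) : Prop where
  c2 : μ 2 = 1
  c4 : μ 4 = m
  c6 : μ 6 = G
  c12 : μ 12 = (G : ℤ) ^ 3
  c14 : μ 14 = 4 * (G : ℤ) ^ 2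
  c16 : μ 16 = (G : ℤ) ^ (8 * m + 8)
  c20 : μ 20 = ((G : ℤ) ^ (8 * m + 8)) ^ (8 * m)
  c22 : μ 22 = ((G : ℤ) ^ (8 * m + 8)) ^ (8 * m) / (G : ℤ) ^ (8 * m + 8)
  c24 : μ 24 = 0
  c26 : μ 26 = (G : ℤ) ^ 3 * ((G : ℤ) ^ (8 * m + 8)) ^ (8 * m)
  c30 : μ 30 = (4 * (G : ℤ) ^ 2) ^ 2
  c38 : μ 38 = 4 * G + 1
  c40 : μ 40 = 2 * G + 1
  c42 : μ 42 = G * (G : ℤ) ^ (8 * m + 8)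
  c44 : μ 44 = (G : ℤ) ^ 3 * (4 * (G : ℤ) ^ 2) ^ (4 * m)
  c52 : μ 52 = 52
  odd : ∀ i, i % 2 = 1 → μ i = 0
  bd : Bd (beta m) μ

/-- A unit for the running time of the deterministic phases. -/
def unitTime (m : ℕ) : ℕ := (m + 2) * (1 + beta m) ^ 2

theorem straight_time_le (p : Prog) (m : ℕ) :
    scost p * (1 + beta m) ^ 2 ≤ scost p * unitTime m := by
  unfold unitTime
  gcongr
  nlinarith [Nat.zero_le (m * (1 + beta m) ^ 2), Nat.zero_le ((1 + beta m) ^ 2)]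

theorem loop_time_le (p : Prog) (m : ℕ) :
    (m + 1) * (scost p * (1 + beta m) ^ 2 + (2 + beta m)) ≤ (scost p + 2) * unitTime m := by
  unfold unitTime
  have : 2 + beta m ≤ 2 * (1 + beta m) ^ 2 := by nlinarith
  calc _ ≤ (m + 2) * (scost p * (1 + beta m) ^ 2 + 2 * (1 + beta m) ^ 2) := by gcongr; omega
    _ = _ := by ring

def setupCost : ℕ := scost initBlock + (scost (powBlock 6) + 2) + scost gridBlock +
  (scost (powBlock 16) + 2) + scost baseBlock + (scost (powBlock 20) + 2) + scost shiftBlock +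
  (scost (powBlock 44) + 2) + scost startBlock

theorem direct_blocks : Direct initBlock ∧ Direct gridBlock ∧ Direct baseBlock ∧
    Direct shiftBlock ∧ Direct startBlock ∧ Direct centerBlock ∧ Direct kernelBlock ∧
    Direct digitBlock ∧ Direct finishBlock := by
  refine ⟨?_, ?_, ?_, ?_, ?_, ?_, ?_, ?_, ?_⟩ <;>
  simp [initBlock, gridBlock, baseBlock, shiftBlock, startBlock, centerBlock, kernelBlock,
    digitBlock, finishBlock, block, Direct, mulP, subP, constP, copyP, addP, divP]

/-- Cells that stay empty during the set-up phase. -/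
def Clean (μ : ℕ → ℤ) : Prop := ∀ i, i % 2 = 1 ∨ i = 24 → μ i = 0

theorem Clean.update {μ : ℕ → ℤ} (h : Clean μ) {d : ℕ} (hd : d % 2 = 0) (hd' : d ≠ 24) (z : ℤ) :
    Clean (Function.update μ d z) := by
  intro i hi
  rw [Function.update_of_ne (by omega)]
  exact h i hi

theorem Clean.memEval {p : Prog} (hp : Direct p) {μ : ℕ → ℤ} (h : Clean μ)
    (hw : ∀ i ∈ writes p, i % 2 = 0 ∧ i ≠ 24) : Clean (memEval p μ) := by
  intro i hi
  rw [hp.memEval_of_notMem fun hmem => by have := hw i hmem; omega]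
  exact h i hi

section

variable {m G : ℕ}

theorem bits_le_beta_of_nonneg (hm : 1 ≤ m) (hG : G = 65536 ^ m)
    {z : ℤ} (a : ℕ) (h0 : 0 ≤ z) (h : z ≤ (G : ℤ) ^ a)
    (ha : a < (8 * m + 8) * (16 * m + 8)) : bits z ≤ beta m :=
  bits_le_beta hm hG a (by rwa [abs_of_nonneg h0]) ha

theorem bits_le_beta_of_le (hm : 1 ≤ m) (hG : G = 65536 ^ m)
    {z : ℤ} (h0 : 0 ≤ z) (h : z ≤ G) : bits z ≤ beta m :=
  bits_le_beta_of_nonneg hm hG 1 h0 (by rwa [pow_one]) (by nlinarith only [hm])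

theorem bits_degree_le (hm : 1 ≤ m) (hG : G = 65536 ^ m) : bits (m : ℤ) ≤ beta m :=
  bits_le_beta_of_le hm hG (by positivity) (by
    have := (mul_add_le_grid hm hG).2
    exact_mod_cast (by omega : m ≤ G))

theorem grid_cast_ge (hm : 1 ≤ m) (hG : G = 65536 ^ m) : (65536 : ℤ) ≤ G := by
  exact_mod_cast grid_ge hm hG

theorem four_mul_sq_le (hm : 1 ≤ m) (hG : G = 65536 ^ m) : 4 * (G : ℤ) ^ 2 ≤ (G : ℤ) ^ 3 := by
  have := grid_cast_ge hm hG
  rw [pow_succ (G : ℤ) 2, mul_comm]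
  gcongr
  linarith

theorem eff_init (hm : 1 ≤ m) (hG : G = 65536 ^ m) {k : ℕ} (hk : m = 256 * k) :
    ∃ F μ', Eff col F (scost initBlock * unitTime m + (scost (powBlock 6) + 2) * unitTime m)
        (.seq initBlock (powLoop 6)) (Function.update (fun _ => 0) 0 (k : ℤ)) μ' ∧
      Bd (beta m) μ' ∧ Clean μ' ∧ μ' 2 = 1 ∧ μ' 4 = m ∧ μ' 6 = G := by
  have hgz := grid_cast_ge hm hG
  have d1 := direct_blocks.1
  set μ₀ : ℕ → ℤ := Function.update (fun _ => 0) 0 (k : ℤ) with hμ₀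
  have b0 : Bd (beta m) μ₀ := by
    intro i
    rcases eq_or_ne i 0 with rfl | hi
    · simp only [hμ₀, Function.update_self]
      refine bits_le_beta_of_le hm hG (by positivity) ?_
      have := (mul_add_le_grid hm hG).2
      exact_mod_cast (by omega : k ≤ G)
    · simp [hμ₀, hi, bits]
  have z0 : Clean μ₀ := by
    intro i hi
    rw [hμ₀, Function.update_of_ne (by omega)]
  set μ₁ := memEval initBlock μ₀ with hμ₁
  have a2 : μ₁ 2 = 1 := by
    simp [hμ₁, initBlock, block, memEval, mulP, constP, copyP, laddr, Op.eval]
  have a4 : μ₁ 4 = m := by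
    simp [hμ₁, hμ₀, initBlock, block, memEval, mulP, constP, copyP, laddr, Op.eval, hk]
  have a8 : μ₁ 8 = m := by
    simp [hμ₁, hμ₀, initBlock, block, memEval, mulP, constP, copyP, laddr, Op.eval, hk]
  have a6 : μ₁ 6 = 1 := by
    simp [hμ₁, initBlock, block, memEval, mulP, constP, copyP, laddr, Op.eval]
  have a18 : μ₁ 18 = 65536 := by
    simp [hμ₁, initBlock, block, memEval, mulP, constP, copyP, laddr, Op.eval]
  have w1 : writes initBlock = [2, 4, 4, 8, 6, 18] := rfl
  have b1 : Bd (beta m) μ₁ := by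
    refine d1.bd b0 ?_
    rw [← hμ₁, w1]
    simp only [List.forall_mem_cons, a2, a4, a8, a6, a18]
    have hh := bits_degree_le hm hG
    have h1 : bits 1 ≤ beta m := bits_le_beta_of_le hm hG (by norm_num) (by linarith)
    exact ⟨h1, hh, hh, hh, h1, bits_le_beta_of_le hm hG (by norm_num) hgz, by simp⟩
  have z1 : Clean μ₁ := z0.memEval d1 (by rw [w1]; decide)
  have hGz : (1 : ℤ) * 65536 ^ m = G := by rw [hG]; push_cast; ring
  have hGb : bits (G : ℤ) ≤ beta m := bits_le_beta_of_le hm hG (by positivity) le_rfl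
  have e2 := eff_powLoop (col := col) (d := 6) (by norm_num) (by norm_num) (by norm_num) b1 a2 a8
    (by rw [a6]; norm_num) (by rw [a18]; norm_num) (by rw [a6, a18, hGz]; exact hGb)
  rw [a6, a18, hGz] at e2
  refine ⟨_, _, ((Eff.straight d1.straight b0).seq e2).mono le_rfl
    (add_le_add (straight_time_le _ _) (loop_time_le _ _)),
    (b1.update _ hGb).update _ (by simp [bits]),
    (z1.update (by norm_num) (by norm_num) _).update (by norm_num) (by norm_num) _, ?_, ?_, ?_⟩
  · simp [a2]
  · simp [a4]
  · simp

theorem eff_grid (hm : 1 ≤ m) (hG : G = 65536 ^ m)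
    {μ : ℕ → ℤ} (b : Bd (beta m) μ) (z : Clean μ) (c2 : μ 2 = 1) (c4 : μ 4 = m)
    (c6 : μ 6 = G) :
    ∃ F μ', Eff col F (scost gridBlock * unitTime m + (scost (powBlock 16) + 2) * unitTime m)
        (.seq gridBlock (powLoop 16)) μ μ' ∧
      Bd (beta m) μ' ∧ Clean μ' ∧ μ' 2 = 1 ∧ μ' 4 = m ∧ μ' 6 = G ∧ μ' 10 = (G : ℤ) ^ 3 ∧
      μ' 14 = 4 * (G : ℤ) ^ 2 ∧ μ' 30 = (4 * (G : ℤ) ^ 2) ^ 2 ∧ μ' 16 = (G : ℤ) ^ (8 * m + 8) := by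
  have hgz := grid_cast_ge hm hG
  have hg1 : (1 : ℤ) ≤ G := by linarith
  have d2 := direct_blocks.2.1
  set μ₃ := memEval gridBlock μ with hμ₃
  have w3 : writes gridBlock = [10, 14, 14, 10, 30, 18, 18, 18, 16, 8] := rfl
  have f2 : μ₃ 2 = 1 := by rw [hμ₃, d2.memEval_of_notMem (by rw [w3]; decide), c2]
  have f4 : μ₃ 4 = m := by rw [hμ₃, d2.memEval_of_notMem (by rw [w3]; decide), c4]
  have f6 : μ₃ 6 = G := by rw [hμ₃, d2.memEval_of_notMem (by rw [w3]; decide), c6]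
  have f8 : μ₃ 8 = m := by
    simp [hμ₃, gridBlock, block, memEval, mulP, constP, copyP, laddr, Op.eval, c4]
  have f10 : μ₃ 10 = (G : ℤ) ^ 3 := by
    simp [hμ₃, gridBlock, block, memEval, mulP, constP, copyP, laddr, Op.eval, c6]; ring
  have f14 : μ₃ 14 = 4 * (G : ℤ) ^ 2 := by
    simp [hμ₃, gridBlock, block, memEval, mulP, constP, copyP, laddr, Op.eval, c6]; ring
  have f30 : μ₃ 30 = (4 * (G : ℤ) ^ 2) ^ 2 := by
    simp [hμ₃, gridBlock, block, memEval, mulP, constP, copyP, laddr, Op.eval, c6]; ring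
  have f18 : μ₃ 18 = (G : ℤ) ^ 8 := by
    simp [hμ₃, gridBlock, block, memEval, mulP, constP, copyP, laddr, Op.eval, c6]; ring
  have f16 : μ₃ 16 = (G : ℤ) ^ 8 := by
    simp [hμ₃, gridBlock, block, memEval, mulP, constP, copyP, laddr, Op.eval, c6]; ring
  have hE := four_mul_sq_le hm hG
  have hEE : (4 * (G : ℤ) ^ 2) ^ 2 ≤ (G : ℤ) ^ 6 := by
    calc (4 * (G : ℤ) ^ 2) ^ 2 ≤ ((G : ℤ) ^ 3) ^ 2 := pow_le_pow_left₀ (by positivity) hE 2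
      _ = _ := by ring
  have b3 : Bd (beta m) μ₃ := by
    refine d2.bd b ?_
    rw [← hμ₃, w3]
    simp only [List.forall_mem_cons, f10, f14, f30, f18, f16, f8]
    have h10 : bits ((G : ℤ) ^ 3) ≤ beta m :=
      bits_le_beta_of_nonneg hm hG 3 (by positivity) le_rfl (by nlinarith only [hm])
    have h14 := bits_le_beta_of_nonneg hm hG 3 (by positivity) hE (by nlinarith only [hm])
    have h30 := bits_le_beta_of_nonneg hm hG 6 (by positivity) hEE (by nlinarith only [hm])
    have h18 : bits ((G : ℤ) ^ 8) ≤ beta m :=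
      bits_le_beta_of_nonneg hm hG 8 (by positivity) le_rfl (by nlinarith only [hm])
    exact ⟨h10, h14, h14, h10, h30, h18, h18, h18, h18, bits_degree_le hm hG, by simp⟩
  have z3 : Clean μ₃ := z.memEval d2 (by rw [w3]; decide)
  have hBz : (G : ℤ) ^ 8 * ((G : ℤ) ^ 8) ^ m = (G : ℤ) ^ (8 * m + 8) := by ring
  have hBb : bits ((G : ℤ) ^ (8 * m + 8)) ≤ beta m :=
    bits_le_beta_of_nonneg hm hG (8 * m + 8) (by positivity) le_rfl (by nlinarith only [hm])
  have e4 := eff_powLoop (col := col) (d := 16) (by norm_num) (by norm_num) (by norm_num) b3 f2 f8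
    (by rw [f16]; positivity) (by rw [f18]; exact one_le_pow₀ hg1)
    (by rw [f16, f18, hBz]; exact hBb)
  rw [f16, f18, hBz] at e4
  refine ⟨_, _, ((Eff.straight d2.straight b).seq e4).mono le_rfl
    (add_le_add (straight_time_le _ _) (loop_time_le _ _)),
    (b3.update _ hBb).update _ (by simp [bits]),
    (z3.update (by norm_num) (by norm_num) _).update (by norm_num) (by norm_num) _,
    ?_, ?_, ?_, ?_, ?_, ?_, ?_⟩ <;> simp [f2, f4, f6, f10, f14, f30]

theorem eff_base (hm : 1 ≤ m) (hG : G = 65536 ^ m)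
    {μ : ℕ → ℤ} (b : Bd (beta m) μ) (z : Clean μ) (c2 : μ 2 = 1) (c4 : μ 4 = m)
    (c16 : μ 16 = (G : ℤ) ^ (8 * m + 8)) :
    ∃ F μ', Eff col F (scost baseBlock * unitTime m + (scost (powBlock 20) + 2) * unitTime m)
        (.seq baseBlock (powLoop 20)) μ μ' ∧
      Bd (beta m) μ' ∧ Clean μ' ∧ (∀ i, i ∉ [8, 18, 20] → μ' i = μ i) ∧
      μ' 20 = ((G : ℤ) ^ (8 * m + 8)) ^ (8 * m) := by
  have hgz := grid_cast_ge hm hG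
  have d3 := direct_blocks.2.2.1
  set B : ℤ := (G : ℤ) ^ (8 * m + 8) with hB
  have hBpos : 0 < B := by positivity
  set μ₅ := memEval baseBlock μ with hμ₅
  have w5 : writes baseBlock = [18, 18, 18, 20, 8] := rfl
  have g5 : ∀ i, i ∉ [18, 18, 18, 20, 8] → μ₅ i = μ i := fun i hi => by
    rw [hμ₅, d3.memEval_of_notMem (by rw [w5]; exact hi)]
  have h18 : μ₅ 18 = B ^ 8 := by
    simp [hμ₅, baseBlock, block, memEval, mulP, constP, copyP, laddr, Op.eval, c16]; ring
  have h20 : μ₅ 20 = 1 := by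
    simp [hμ₅, baseBlock, block, memEval, mulP, constP, copyP, laddr, Op.eval]
  have h8 : μ₅ 8 = m := by
    simp [hμ₅, baseBlock, block, memEval, mulP, constP, copyP, laddr, Op.eval, c4]
  have h2 : μ₅ 2 = 1 := by rw [g5 _ (by decide), c2]
  have b5 : Bd (beta m) μ₅ := by
    refine d3.bd b ?_
    rw [← hμ₅, w5]
    simp only [List.forall_mem_cons, h18, h20, h8]
    have hh : bits (B ^ 8) ≤ beta m := bits_le_beta_of_nonneg hm hG ((8 * m + 8) * 8)
      (by positivity) (by rw [hB, ← pow_mul]) (by nlinarith only [hm])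
    exact ⟨hh, hh, hh, bits_le_beta_of_le hm hG (by norm_num) (by linarith),
      bits_degree_le hm hG, by simp⟩
  have z5 : Clean μ₅ := z.memEval d3 (by rw [w5]; decide)
  have hZz : (1 : ℤ) * (B ^ 8) ^ m = B ^ (8 * m) := by rw [one_mul, ← pow_mul]
  have hZb : bits (B ^ (8 * m)) ≤ beta m := bits_le_beta_of_nonneg hm hG ((8 * m + 8) * (8 * m))
    (by positivity) (by rw [hB, ← pow_mul]) (by nlinarith only [hm])
  have e6 := eff_powLoop (col := col) (d := 20) (by norm_num) (by norm_num) (by norm_num) b5 h2 h8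
    (by rw [h20]; norm_num) (by rw [h18]; exact one_le_pow₀ hBpos)
    (by rw [h20, h18, hZz]; exact hZb)
  rw [h20, h18, hZz] at e6
  refine ⟨_, _, ((Eff.straight d3.straight b).seq e6).mono le_rfl
    (add_le_add (straight_time_le _ _) (loop_time_le _ _)),
    (b5.update _ hZb).update _ (by simp [bits]),
    (z5.update (by norm_num) (by norm_num) _).update (by norm_num) (by norm_num) _, ?_, by simp⟩
  intro i hi
  simp only [List.mem_cons, List.not_mem_nil, or_false, not_or] at hi
  rw [Function.update_of_ne hi.1, Function.update_of_ne hi.2.2]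
  exact g5 i (by simp only [List.mem_cons, List.not_mem_nil, or_false]; omega)

theorem eff_shift (hm : 1 ≤ m) (hG : G = 65536 ^ m)
    {μ : ℕ → ℤ} (b : Bd (beta m) μ) (z : Clean μ) (c2 : μ 2 = 1) (c4 : μ 4 = m)
    (c10 : μ 10 = (G : ℤ) ^ 3) (c30 : μ 30 = (4 * (G : ℤ) ^ 2) ^ 2) :
    ∃ F μ', Eff col F (scost shiftBlock * unitTime m + (scost (powBlock 44) + 2) * unitTime m)
        (.seq shiftBlock (powLoop 44)) μ μ' ∧
      Bd (beta m) μ' ∧ Clean μ' ∧ (∀ i, i ∉ [8, 18, 44] → μ' i = μ i) ∧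
      μ' 44 = (G : ℤ) ^ 3 * (4 * (G : ℤ) ^ 2) ^ (4 * m) := by
  have hgz := grid_cast_ge hm hG
  have d4 := direct_blocks.2.2.2.1
  set μ₇ := memEval shiftBlock μ with hμ₇
  have w7 : writes shiftBlock = [44, 18, 8] := rfl
  have g7 : ∀ i, i ∉ [44, 18, 8] → μ₇ i = μ i := fun i hi => by
    rw [hμ₇, d4.memEval_of_notMem (by rw [w7]; exact hi)]
  have i44 : μ₇ 44 = (G : ℤ) ^ 3 := by
    simp [hμ₇, shiftBlock, block, memEval, mulP, copyP, laddr, Op.eval, c10]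
  have i18 : μ₇ 18 = (4 * (G : ℤ) ^ 2) ^ 4 := by
    simp [hμ₇, shiftBlock, block, memEval, mulP, copyP, laddr, Op.eval, c30]; ring
  have i8 : μ₇ 8 = m := by
    simp [hμ₇, shiftBlock, block, memEval, mulP, copyP, laddr, Op.eval, c4]
  have i2 : μ₇ 2 = 1 := by rw [g7 _ (by decide), c2]
  have hE4 : (4 * (G : ℤ) ^ 2) ^ 4 ≤ (G : ℤ) ^ 12 := by
    calc (4 * (G : ℤ) ^ 2) ^ 4 ≤ ((G : ℤ) ^ 3) ^ 4 :=
          pow_le_pow_left₀ (by positivity) (four_mul_sq_le hm hG) 4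
      _ = _ := by ring
  have b7 : Bd (beta m) μ₇ := by
    refine d4.bd b ?_
    rw [← hμ₇, w7]
    simp only [List.forall_mem_cons, i44, i18, i8]
    exact ⟨bits_le_beta_of_nonneg hm hG 3 (by positivity) le_rfl (by nlinarith only [hm]),
      bits_le_beta_of_nonneg hm hG 12 (by positivity) hE4 (by nlinarith only [hm]),
      bits_degree_le hm hG, by simp⟩
  have z7 : Clean μ₇ := z.memEval d4 (by rw [w7]; decide)
  have hσz : (G : ℤ) ^ 3 * ((4 * (G : ℤ) ^ 2) ^ 4) ^ m =
      (G : ℤ) ^ 3 * (4 * (G : ℤ) ^ 2) ^ (4 * m) := by rw [← pow_mul]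
  have hσb : bits ((G : ℤ) ^ 3 * (4 * (G : ℤ) ^ 2) ^ (4 * m)) ≤ beta m := by
    refine bits_le_beta_of_nonneg hm hG (3 + 12 * m) (by positivity) ?_ (by nlinarith only [hm])
    rw [← hσz, pow_add, pow_mul _ 12]
    gcongr
  have e8 := eff_powLoop (col := col) (d := 44) (by norm_num) (by norm_num) (by norm_num) b7 i2 i8
    (by rw [i44]; positivity) (by rw [i18]; exact one_le_pow₀ (by nlinarith))
    (by rw [i44, i18, hσz]; exact hσb)
  rw [i44, i18, hσz] at e8
  refine ⟨_, _, ((Eff.straight d4.straight b).seq e8).mono le_rfl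
    (add_le_add (straight_time_le _ _) (loop_time_le _ _)),
    (b7.update _ hσb).update _ (by simp [bits]),
    (z7.update (by norm_num) (by norm_num) _).update (by norm_num) (by norm_num) _, ?_, by simp⟩
  intro i hi
  simp only [List.mem_cons, List.not_mem_nil, or_false, not_or] at hi
  rw [Function.update_of_ne hi.1, Function.update_of_ne hi.2.2]
  exact g7 i (by simp only [List.mem_cons, List.not_mem_nil, or_false]; omega)

theorem eff_start (hm : 1 ≤ m) (hG : G = 65536 ^ m)
    {μ : ℕ → ℤ} (b : Bd (beta m) μ) (z : Clean μ) (c2 : μ 2 = 1) (c4 : μ 4 = m)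
    (c6 : μ 6 = G) (c10 : μ 10 = (G : ℤ) ^ 3) (c14 : μ 14 = 4 * (G : ℤ) ^ 2)
    (c30 : μ 30 = (4 * (G : ℤ) ^ 2) ^ 2) (c16 : μ 16 = (G : ℤ) ^ (8 * m + 8))
    (c20 : μ 20 = ((G : ℤ) ^ (8 * m + 8)) ^ (8 * m))
    (c44 : μ 44 = (G : ℤ) ^ 3 * (4 * (G : ℤ) ^ 2) ^ (4 * m)) :
    ∃ F μ', Eff col F (scost startBlock * unitTime m) startBlock μ μ' ∧ Ready m G μ' := by
  have hgz := grid_cast_ge hm hG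
  have d5 := direct_blocks.2.2.2.2.1
  set B : ℤ := (G : ℤ) ^ (8 * m + 8) with hB
  set μ₉ := memEval startBlock μ with hμ₉
  have w9 : writes startBlock = [22, 26, 12, 42, 40, 40, 38, 38, 52] := rfl
  have g9 : ∀ i, i ∉ [22, 26, 12, 42, 40, 40, 38, 38, 52] → μ₉ i = μ i := fun i hi => by
    rw [hμ₉, d5.memEval_of_notMem (by rw [w9]; exact hi)]
  have k22 : μ₉ 22 = B ^ (8 * m) / B := by
    simp [hμ₉, startBlock, block, memEval, mulP, divP, addP, constP, copyP, laddr, Op.eval, c20,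
      c16]
  have k26 : μ₉ 26 = (G : ℤ) ^ 3 * B ^ (8 * m) := by
    simp [hμ₉, startBlock, block, memEval, mulP, divP, addP, constP, copyP, laddr, Op.eval, c20,
      c10]
  have k12 : μ₉ 12 = (G : ℤ) ^ 3 := by
    simp [hμ₉, startBlock, block, memEval, mulP, divP, addP, constP, copyP, laddr, Op.eval, c10]
  have k42 : μ₉ 42 = G * B := by
    simp [hμ₉, startBlock, block, memEval, mulP, divP, addP, constP, copyP, laddr, Op.eval, c6, c16]
  have k40 : μ₉ 40 = 2 * G + 1 := by
    simp [hμ₉, startBlock, block, memEval, mulP, divP, addP, constP, copyP, laddr, Op.eval, c6, c2]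
    ring
  have k38 : μ₉ 38 = 4 * G + 1 := by
    simp [hμ₉, startBlock, block, memEval, mulP, divP, addP, constP, copyP, laddr, Op.eval, c6, c2]
    ring
  have k52 : μ₉ 52 = 52 := by
    simp [hμ₉, startBlock, block, memEval, mulP, divP, addP, constP, copyP, laddr, Op.eval]
  have b9 : Bd (beta m) μ₉ := by
    refine d5.bd b ?_
    rw [← hμ₉, w9]
    simp only [List.forall_mem_cons, k22, k26, k12, k42, k40, k38, k52]
    have hG2 : 4 * (G : ℤ) + 1 ≤ (G : ℤ) ^ 2 := by nlinarith
    have h40 : bits (2 * (G : ℤ) + 1) ≤ beta m :=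
      bits_le_beta_of_nonneg hm hG 2 (by positivity) (by linarith) (by nlinarith only [hm])
    have h38 := bits_le_beta_of_nonneg hm hG 2 (by positivity) hG2 (by nlinarith only [hm])
    have h22 : bits (B ^ (8 * m) / B) ≤ beta m := by
      refine bits_le_beta_of_nonneg hm hG ((8 * m + 8) * (8 * m)) (by positivity) ?_
        (by nlinarith only [hm])
      rw [pow_mul (G : ℤ), ← hB]
      exact Int.ediv_le_self _ (by positivity)
    have h26 : bits ((G : ℤ) ^ 3 * B ^ (8 * m)) ≤ beta m :=
      bits_le_beta_of_nonneg hm hG (3 + (8 * m + 8) * (8 * m)) (by positivity)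
        (by rw [pow_add, pow_mul (G : ℤ), ← hB]) (by nlinarith only [hm])
    exact ⟨h22, h26, bits_le_beta_of_nonneg hm hG 3 (by positivity) le_rfl (by nlinarith only [hm]),
      bits_le_beta_of_nonneg hm hG (1 + (8 * m + 8)) (by positivity)
        (by rw [pow_add, ← hB, pow_one]) (by nlinarith only [hm]),
      h40, h40, h38, h38, bits_le_beta_of_le hm hG (by norm_num) (by linarith), by simp⟩
  have z9 : Clean μ₉ := z.memEval d5 (by rw [w9]; decide)
  refine ⟨_, μ₉, (Eff.straight d5.straight b).mono le_rfl (straight_time_le _ _), ?_⟩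
  exact
    { c2 := by rw [g9 _ (by decide), c2]
      c4 := by rw [g9 _ (by decide), c4]
      c6 := by rw [g9 _ (by decide), c6]
      c12 := k12
      c14 := by rw [g9 _ (by decide), c14]
      c16 := by rw [g9 _ (by decide), c16]
      c20 := by rw [g9 _ (by decide), c20]
      c22 := k22
      c24 := z9 24 (Or.inr rfl)
      c26 := k26
      c30 := by rw [g9 _ (by decide), c30]
      c38 := k38
      c40 := k40
      c42 := k42
      c44 := by rw [g9 _ (by decide), c44]
      c52 := k52
      odd := fun i hi => z9 i (Or.inl hi)
      bd := b9 }

theorem eff_setup (hm : 1 ≤ m) (hG : G = 65536 ^ m) {k : ℕ} (hk : m = 256 * k) :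
    ∃ F μ', Eff col F (setupCost * unitTime m) setup
      (Function.update (fun _ => 0) 0 (k : ℤ)) μ' ∧ Ready m G μ' := by
  obtain ⟨F₁, μ₁, e1, b1, z1, a2, a4, a6⟩ := eff_init (col := col) hm hG hk
  obtain ⟨F₂, μ₂, e2, b2, z2, f2, f4, f6, f10, f14, f30, f16⟩ :=
    eff_grid (col := col) hm hG b1 z1 a2 a4 a6
  obtain ⟨F₃, μ₃, e3, b3, z3, g3, g20⟩ := eff_base (col := col) hm hG b2 z2 f2 f4 f16
  obtain ⟨F₄, μ₄, e4, b4, z4, g4, g44⟩ := eff_shift (col := col) hm hG b3 z3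
    (by rw [g3 _ (by decide), f2]) (by rw [g3 _ (by decide), f4]) (by rw [g3 _ (by decide), f10])
    (by rw [g3 _ (by decide), f30])
  obtain ⟨F₅, μ₅, e5, hr⟩ := eff_start (col := col) hm hG b4 z4
    (by rw [g4 _ (by decide), g3 _ (by decide), f2])
    (by rw [g4 _ (by decide), g3 _ (by decide), f4])
    (by rw [g4 _ (by decide), g3 _ (by decide), f6])
    (by rw [g4 _ (by decide), g3 _ (by decide), f10])
    (by rw [g4 _ (by decide), g3 _ (by decide), f14])
    (by rw [g4 _ (by decide), g3 _ (by decide), f30])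
    (by rw [g4 _ (by decide), g3 _ (by decide), f16])
    (by rw [g4 _ (by decide), g20]) g44
  refine ⟨_, μ₅, (e1.seq (e2.seq (e3.seq (e4.seq e5)))).mono le_rfl (le_of_eq ?_), hr⟩
  unfold setupCost
  ring

end

end

end

end SpectralSampling

namespace SpectralSampling

open MeasureTheory
open scoped ENNReal

noncomputable section

/-! ### The output phase -/

/-- The memory before the output phase, with the code `H` of the return counts. -/
structure AtomReady (m G : ℕ) (H : ℤ) (μ : ℕ → ℤ) : Prop where
  c2 : μ 2 = 1
  c4 : μ 4 = m
  c6 : μ 6 = G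
  c14 : μ 14 = 4 * (G : ℤ) ^ 2
  c16 : μ 16 = (G : ℤ) ^ (8 * m + 8)
  c20 : μ 20 = ((G : ℤ) ^ (8 * m + 8)) ^ (8 * m)
  c26 : μ 26 = H
  c30 : μ 30 = (4 * (G : ℤ) ^ 2) ^ 2
  c38 : μ 38 = 4 * G + 1
  c40 : μ 40 = 2 * G + 1
  c42 : μ 42 = G * (G : ℤ) ^ (8 * m + 8)
  c44 : μ 44 = (G : ℤ) ^ 3 * (4 * (G : ℤ) ^ 2) ^ (4 * m)
  c52 : μ 52 = 52
  odd : ∀ i, i % 2 = 1 → μ i = 0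
  bd : Bd (beta m) μ

/-- The multiplier of the kernel recursion at the base of the code. -/
def vVal (m G : ℕ) (y : ℤ) : ℤ :=
  2 * (4 * (G : ℤ) ^ 2) - (G * (G : ℤ) ^ (8 * m + 8) - y) ^ 2

/-- The computed weight of the atom at `y / G`. -/
def weightOf (m G : ℕ) (H y : ℤ) : ℤ :=
  (kseq (vVal m G y) (4 * (G : ℤ) ^ 2) m ^ 4 * H / ((G : ℤ) ^ (8 * m + 8)) ^ (8 * m) +
    (G : ℤ) ^ 3 * (4 * (G : ℤ) ^ 2) ^ (4 * m)) % (G : ℤ) ^ (8 * m + 8)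

section

variable {n : ℕ} [NeZero n] {col : Fin n → PMF (Fin n)} {m G : ℕ}

theorem abs_vVal_le (hG : 1 ≤ G) {y : ℤ} (hy : |y| ≤ 2 * G) :
    |vVal m G y| ≤ 17 * ((G : ℤ) ^ 2 * ((G : ℤ) ^ (8 * m + 8)) ^ 2) := by
  have hg : (1 : ℤ) ≤ G := by exact_mod_cast hG
  set B : ℤ := (G : ℤ) ^ (8 * m + 8) with hB
  have hB1 : 1 ≤ B := one_le_pow₀ hg
  have h1 : |G * B - y| ≤ 3 * G * B := by
    refine (abs_sub _ _).trans ?_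
    rw [abs_of_nonneg (by positivity)]
    nlinarith
  have h2 := pow_le_pow_left₀ (abs_nonneg _) h1 2
  rw [sq_abs] at h2
  have h3 : (G : ℤ) ^ 2 * 1 ≤ (G : ℤ) ^ 2 * B ^ 2 := by gcongr; exact one_le_pow₀ hB1
  unfold vVal
  rw [← hB, abs_le]
  constructor <;> nlinarith [sq_nonneg (G * B - y)]

/-- The growth bound behind `l1_fPoly_le`, now with the absolute value as size function and s = G^2
B^2. -/
theorem abs_kseq_le (hm : 1 ≤ m) (hG : G = 65536 ^ m) {y : ℤ} (hy : |y| ≤ 2 * G) {j : ℕ}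
    (hj : j ≤ m) :
    |kseq (vVal m G y) (4 * (G : ℤ) ^ 2) j| ≤ (G : ℤ) ^ ((16 * m + 19) * m) := by
  have hgz := grid_cast_ge hm hG
  have hg1 : 1 ≤ G := by have := grid_ge hm hG; omega
  set B : ℤ := (G : ℤ) ^ (8 * m + 8) with hB
  have hB1 : 1 ≤ B := one_le_pow₀ (by linarith)
  have hs : (G : ℤ) ^ 2 ≤ (G : ℤ) ^ 2 * B ^ 2 :=
    le_mul_of_one_le_right (by positivity) (one_le_pow₀ hB1)
  have h := kseq_growth (fun z : ℤ => |z|) abs_nonneg (fun x y => (abs_mul x y).le) abs_add_le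
    abs_sub (by simp) (s := (G : ℤ) ^ 2 * B ^ 2) (by positivity) (abs_vVal_le (m := m) hg1 hy)
    (E := 4 * (G : ℤ) ^ 2) (by rw [abs_of_nonneg (by positivity)]; linarith) j
  refine h.trans ?_
  have h1 : 22 * ((G : ℤ) ^ 2 * B ^ 2) ≤ (G : ℤ) ^ (16 * m + 19) := by
    have e : (G : ℤ) ^ (16 * m + 19) = G * ((G : ℤ) ^ 2 * B ^ 2) := by rw [hB]; ring
    rw [e]
    gcongr
    linarith
  calc (22 * ((G : ℤ) ^ 2 * B ^ 2)) ^ j ≤ ((G : ℤ) ^ (16 * m + 19)) ^ j :=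
        pow_le_pow_left₀ (by positivity) h1 j
    _ ≤ ((G : ℤ) ^ (16 * m + 19)) ^ m := pow_le_pow_right₀ (one_le_pow₀ (by linarith)) hj
    _ = _ := by rw [← pow_mul]

theorem eff_kernelLoop (hm : 1 ≤ m) (hG : G = 65536 ^ m) {y : ℤ} (hy : |y| ≤ 2 * G)
    {μ : ℕ → ℤ} (b : Bd (beta m) μ) (c2 : μ 2 = 1) (c8 : μ 8 = m)
    (c30 : μ 30 = (4 * (G : ℤ) ^ 2) ^ 2) (c32 : μ 32 = vVal m G y) (c34 : μ 34 = 1)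
    (c36 : μ 36 = -(4 * (G : ℤ) ^ 2)) :
    ∃ μ', Eff col (sdepth kernelBlock + m + 1) ((scost kernelBlock + 2) * unitTime m)
      kernelLoop μ μ' ∧ (∀ i, i ∉ [8, 28, 34, 36] → μ' i = μ i) ∧
      μ' 34 = kseq (vVal m G y) (4 * (G : ℤ) ^ 2) m ∧ Bd (beta m) μ' := by
  have d := direct_blocks.2.2.2.2.2.2.1
  have w : writes kernelBlock = [28, 28, 36, 34, 8] := rfl
  set V := vVal m G y with hV
  set E : ℤ := 4 * (G : ℤ) ^ 2 with hE
  suffices H : ∃ μ', Eff col (sdepth kernelBlock + m + 1)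
      ((m + 1) * (scost kernelBlock * (1 + beta m) ^ 2 + (2 + beta m))) kernelLoop μ μ' ∧
      ((∀ i, i ∉ [8, 28, 34, 36] → μ' i = μ i) ∧ μ' 34 = kseq V E m ∧
        μ' 36 = V * kseq V E m - kseq V E (m + 1) ∧ μ' 8 = (m : ℤ) - m ∧ Bd (beta m) μ') by
    obtain ⟨μ', h1, h2, h3, -, -, h6⟩ := H
    exact ⟨μ', h1.mono le_rfl (loop_time_le _ _), h2, h3, h6⟩
  -- Writing cell 36 as a difference of later terms avoids a predecessor of j and covers j = 0,
  -- where the value is -E.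
  refine Eff.loop (fun j μ' => (∀ i, i ∉ [8, 28, 34, 36] → μ' i = μ i) ∧ μ' 34 = kseq V E j ∧
        μ' 36 = V * kseq V E j - kseq V E (j + 1) ∧ μ' 8 = (m : ℤ) - j ∧ Bd (beta m) μ')
    ?_ ?_ ?_ ?_
  · rintro i μ' - ⟨-, -, -, -, h⟩
    exact h 8
  · rintro j μ' hj ⟨h1, h2, h3, h4, h5⟩
    refine ⟨by rw [h4]; omega, _, Eff.straight d.straight h5, ?_⟩
    set μ₁ := memEval kernelBlock μ' with hμ₁
    have e30 : μ' 30 = E ^ 2 := by rw [h1 _ (by decide), c30]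
    have e32 : μ' 32 = V := by rw [h1 _ (by decide), c32]
    have e2 : μ' 2 = 1 := by rw [h1 _ (by decide), c2]
    have k28 : μ₁ 28 = kseq V E (j + 1) := by
      simp [hμ₁, kernelBlock, block, memEval, mulP, subP, copyP, laddr, Op.eval, e32, h2, h3]
    have k34 : μ₁ 34 = kseq V E (j + 1) := by
      simp [hμ₁, kernelBlock, block, memEval, mulP, subP, copyP, laddr, Op.eval, e32, h2, h3]
    have k36 : μ₁ 36 = E ^ 2 * kseq V E j := by
      simp [hμ₁, kernelBlock, block, memEval, mulP, subP, copyP, laddr, Op.eval, e30, h2]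
    have k8 : μ₁ 8 = (m : ℤ) - (j + 1 : ℕ) := by
      simp [hμ₁, kernelBlock, block, memEval, mulP, subP, copyP, laddr, Op.eval, e2, h4]
      ring
    refine ⟨?_, k34, ?_, k8, ?_⟩
    · intro i hi
      simp only [List.mem_cons, List.not_mem_nil, or_false] at hi
      rw [hμ₁, d.memEval_of_notMem (by
        rw [w]; simp only [List.mem_cons, List.not_mem_nil, or_false]; omega)]
      exact h1 i (by simp only [List.mem_cons, List.not_mem_nil, or_false]; omega)
    · rw [k36]; simp only [kseq]; ring
    · refine d.bd h5 ?_
      rw [← hμ₁, w]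
      simp only [List.forall_mem_cons, k28, k34, k36, k8]
      have hA := bits_le_beta hm hG _ (abs_kseq_le hm hG hy (j := j + 1) (by omega))
        (by nlinarith only [hm])
      have hb : bits (E ^ 2 * kseq V E j) ≤ beta m := by
        refine bits_le_beta hm hG (6 + (16 * m + 19) * m) ?_ (by nlinarith only [hm])
        rw [abs_mul, abs_of_nonneg (by positivity : 0 ≤ E ^ 2), pow_add]
        have hE2 : E ^ 2 ≤ (G : ℤ) ^ 6 := by
          calc E ^ 2 ≤ ((G : ℤ) ^ 3) ^ 2 :=
                pow_le_pow_left₀ (by positivity) (four_mul_sq_le hm hG) 2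
            _ = _ := by ring
        exact mul_le_mul hE2 (abs_kseq_le hm hG hy hj.le) (abs_nonneg _) (by positivity)
      refine ⟨hA, hA, hb, hA, ?_, by simp⟩
      have hmb := bits_degree_le hm hG
      rw [bits_le_iff] at hmb ⊢
      rw [abs_of_nonneg (by omega)] at hmb ⊢
      omega
  · rintro μ' ⟨-, -, -, h, -⟩
    rw [h]; simp
  · refine ⟨fun i _ => rfl, by simpa [kseq] using c34, ?_, by simpa using c8, b⟩
    simp only [kseq]
    rw [c36]; ring

/-- The memory after `i` atoms have been written. -/
structure AtomInv (m G : ℕ) (H : ℤ) (μ₁ : ℕ → ℤ) (i : ℕ) (μ : ℕ → ℤ) : Prop where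
  frame : ∀ j < 54, j ∉ [8, 28, 32, 34, 36, 38, 46, 48, 50] → μ j = μ₁ j
  c38 : μ 38 = 4 * G + 1 - i
  -- Atoms are written in descending order, along with the counter in cell 38.
  out : ∀ c : ℕ, 4 * G + 1 < c + i → c ≤ 4 * G + 1 →
    μ (2 * c + 52) = (c : ℤ) - (2 * G + 1) ∧ μ (2 * c + 53) = weightOf m G H ((c : ℤ) - (2 * G + 1))
  bd : Bd (beta m) μ

def atomCost : ℕ := scost centerBlock + (scost kernelBlock + 2) + scost digitBlock +
  scost storeBlock

theorem eff_center (hm : 1 ≤ m) (hG : G = 65536 ^ m) {H : ℤ} {μ₁ μ : ℕ → ℤ} {i : ℕ}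
    (h₁ : AtomReady m G H μ₁) (h : AtomInv m G H μ₁ i μ) (hi : i < 4 * G + 1) {y : ℤ}
    (hyc : y = 2 * G - i) :
    ∃ μ', Eff col (sdepth centerBlock) (scost centerBlock * unitTime m) centerBlock μ μ' ∧
      (∀ j, j ∉ [48, 32, 28, 34, 36, 8] → μ' j = μ j) ∧ Bd (beta m) μ' ∧ μ' 48 = y ∧
      μ' 32 = vVal m G y ∧ μ' 34 = 1 ∧ μ' 36 = -(4 * (G : ℤ) ^ 2) ∧ μ' 8 = m := by
  have hgz := grid_cast_ge hm hG
  have d := direct_blocks.2.2.2.2.2.1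
  have w : writes centerBlock = [48, 32, 32, 28, 32, 34, 28, 36, 8] := rfl
  have hy : |y| ≤ 2 * G := by rw [abs_le]; omega
  have e4 : μ 4 = m := by rw [h.frame _ (by norm_num) (by decide), h₁.c4]
  have e14 : μ 14 = 4 * (G : ℤ) ^ 2 := by rw [h.frame _ (by norm_num) (by decide), h₁.c14]
  have e40 : μ 40 = 2 * G + 1 := by rw [h.frame _ (by norm_num) (by decide), h₁.c40]
  have e42 : μ 42 = G * (G : ℤ) ^ (8 * m + 8) := by
    rw [h.frame _ (by norm_num) (by decide), h₁.c42]
  have hyy : (4 * G + 1 - i : ℤ) - (2 * G + 1) = y := by rw [hyc]; ring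
  set μ' := memEval centerBlock μ with hμ'
  have k48 : μ' 48 = y := by
    simp [hμ', centerBlock, block, memEval, mulP, subP, addP, constP, copyP, laddr, Op.eval, h.c38,
      e40, hyy]
  have k32 : μ' 32 = vVal m G y := by
    simp [hμ', centerBlock, block, memEval, mulP, subP, addP, constP, copyP, laddr, Op.eval, h.c38,
      e40, hyy, e42, e14, vVal]
    ring
  have k34 : μ' 34 = 1 := by
    simp [hμ', centerBlock, block, memEval, mulP, subP, addP, constP, copyP, laddr, Op.eval]
  have k28 : μ' 28 = 0 := by
    simp [hμ', centerBlock, block, memEval, mulP, subP, addP, constP, copyP, laddr, Op.eval]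
  have k36 : μ' 36 = -(4 * (G : ℤ) ^ 2) := by
    simp [hμ', centerBlock, block, memEval, mulP, subP, addP, constP, copyP, laddr, Op.eval, e14]
  have k8 : μ' 8 = m := by
    simp [hμ', centerBlock, block, memEval, mulP, subP, addP, constP, copyP, laddr, Op.eval, e4]
  refine ⟨μ', (Eff.straight d.straight h.bd).mono le_rfl (straight_time_le _ _), ?_, ?_, k48, k32,
    k34, k36, k8⟩
  · intro j hj
    simp only [List.mem_cons, List.not_mem_nil, or_false] at hj
    rw [hμ', d.memEval_of_notMem (by
      rw [w]; simp only [List.mem_cons, List.not_mem_nil, or_false]; omega)]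
  · refine d.bd h.bd ?_
    rw [← hμ', w]
    simp only [List.forall_mem_cons, k48, k32, k34, k28, k36, k8]
    have hV : bits (vVal m G y) ≤ beta m := by
      refine bits_le_beta hm hG (16 * m + 19) ((abs_vVal_le (by
        have := grid_ge hm hG; omega) hy).trans ?_) (by nlinarith only [hm])
      have e : (G : ℤ) ^ (16 * m + 19) = G * ((G : ℤ) ^ 2 * ((G : ℤ) ^ (8 * m + 8)) ^ 2) := by ring
      rw [e]
      gcongr
      linarith
    have hyb : bits y ≤ beta m := bits_le_beta hm hG 2 (hy.trans (by nlinarith))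
      (by nlinarith only [hm])
    have h0 : bits 0 ≤ beta m := by simp [bits]
    have hEb : bits (-(4 * (G : ℤ) ^ 2)) ≤ beta m := by
      refine bits_le_beta hm hG 3 ?_ (by nlinarith only [hm])
      rw [abs_neg, abs_of_nonneg (by positivity)]
      exact four_mul_sq_le hm hG
    exact ⟨hyb, hV, hV, h0, hV, bits_le_beta_of_le hm hG (by norm_num) (by linarith), h0, hEb,
      bits_degree_le hm hG, by simp⟩

theorem weightOf_nonneg (hG : 1 ≤ G) (H y : ℤ) : 0 ≤ weightOf m G H y :=
  Int.emod_nonneg _ (by positivity)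

theorem bits_weightOf_le (hm : 1 ≤ m) (hG : G = 65536 ^ m) (H y : ℤ) :
    bits (weightOf m G H y) ≤ beta m := by
  have hg1 : 1 ≤ G := by have := grid_ge hm hG; omega
  refine bits_le_beta_of_nonneg hm hG (8 * m + 8) (weightOf_nonneg hg1 _ _) ?_
    (by nlinarith only [hm])
  exact (Int.emod_lt_of_pos _ (by positivity)).le

theorem eff_digit (hm : 1 ≤ m) (hG : G = 65536 ^ m) {H y : ℤ} {c : ℕ} (hc : 1 ≤ c)
    (hc' : c ≤ 4 * G + 1) {μ : ℕ → ℤ} (b : Bd (beta m) μ) (c2 : μ 2 = 1)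
    (c16 : μ 16 = (G : ℤ) ^ (8 * m + 8)) (c20 : μ 20 = ((G : ℤ) ^ (8 * m + 8)) ^ (8 * m))
    (c26 : μ 26 = H) (c34 : μ 34 = kseq (vVal m G y) (4 * (G : ℤ) ^ 2) m) (c38 : μ 38 = c)
    (c44 : μ 44 = (G : ℤ) ^ 3 * (4 * (G : ℤ) ^ 2) ^ (4 * m)) (c52 : μ 52 = 52) :
    ∃ μ', Eff col (sdepth digitBlock) (scost digitBlock * unitTime m) digitBlock μ μ' ∧
      (∀ j, j ∉ [50, 28, 46, 38] → μ' j = μ j) ∧ Bd (beta m) μ' ∧ μ' 50 = weightOf m G H y ∧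
      μ' 46 = (2 * c + 52 : ℕ) ∧ μ' 38 = (c : ℤ) - 1 := by
  have hgz := grid_cast_ge hm hG
  have d := direct_blocks.2.2.2.2.2.2.2.1
  have w : writes digitBlock = [50, 50, 50, 50, 50, 28, 28, 50, 28, 46, 46, 38] := rfl
  set μ' := memEval digitBlock μ with hμ'
  have k50 : μ' 50 = weightOf m G H y := by
    rw [weightOf, Int.emod_def]
    simp [hμ', digitBlock, block, memEval, mulP, subP, addP, divP, constP, laddr, Op.eval, c34, c26,
      c20, c44, c16]
    ring_nf
  have k28 : μ' 28 = 0 := by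
    simp [hμ', digitBlock, block, memEval, mulP, subP, addP, divP, constP, laddr, Op.eval]
  have k46 : μ' 46 = (2 * c + 52 : ℕ) := by
    simp [hμ', digitBlock, block, memEval, mulP, subP, addP, divP, constP, laddr, Op.eval, c38, c52]
    ring
  have k38 : μ' 38 = (c : ℤ) - 1 := by
    simp [hμ', digitBlock, block, memEval, mulP, subP, addP, divP, constP, laddr, Op.eval, c38, c2]
  refine ⟨μ', (Eff.straight d.straight b).mono le_rfl (straight_time_le _ _), ?_, ?_, k50, k46, k38⟩
  · intro j hj
    simp only [List.mem_cons, List.not_mem_nil, or_false] at hj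
    rw [hμ', d.memEval_of_notMem (by
      rw [w]; simp only [List.mem_cons, List.not_mem_nil, or_false]; omega)]
  · refine d.bd b ?_
    rw [← hμ', w]
    simp only [List.forall_mem_cons, k50, k28, k46, k38]
    have h50 := bits_weightOf_le hm hG H y
    have h0 : bits 0 ≤ beta m := by simp [bits]
    have hcz : (c : ℤ) ≤ 4 * G + 1 := by exact_mod_cast hc'
    have h46 : bits ((2 * c + 52 : ℕ) : ℤ) ≤ beta m := by
      refine bits_le_beta_of_nonneg hm hG 2 (by positivity) ?_ (by nlinarith only [hm])
      push_cast
      nlinarith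
    have h38 : bits ((c : ℤ) - 1) ≤ beta m :=
      bits_le_beta_of_nonneg hm hG 2 (by omega) (by nlinarith) (by nlinarith only [hm])
    exact ⟨h50, h50, h50, h50, h50, h0, h0, h50, h0, h46, h46, h38, by simp⟩

theorem eff_atomBody (hm : 1 ≤ m) (hG : G = 65536 ^ m) {H : ℤ} {μ₁ μ : ℕ → ℤ} {i : ℕ}
    (h₁ : AtomReady m G H μ₁) (h : AtomInv m G H μ₁ i μ) (hi : i < 4 * G + 1) :
    ∃ μ', Eff col (sdepth centerBlock + sdepth kernelBlock + sdepth digitBlock + sdepth storeBlock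
        + m + 4) (atomCost * unitTime m)
      (block centerBlock [kernelLoop, digitBlock, storeBlock]) μ μ' ∧
      AtomInv m G H μ₁ (i + 1) μ' := by
  have hgz := grid_cast_ge hm hG
  set y : ℤ := 2 * G - i with hy
  obtain ⟨c, hc⟩ : ∃ c : ℕ, c + i = 4 * G + 1 := ⟨4 * G + 1 - i, by omega⟩
  have hyabs : |y| ≤ 2 * G := by rw [abs_le]; omega
  have hyc : (c : ℤ) - (2 * G + 1) = y := by omega
  have hf : ∀ j < 54, j ∉ [8, 28, 32, 34, 36, 38, 46, 48, 50] → μ j = μ₁ j := h.frame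
  obtain ⟨μa, ea, fa, ba, a48, a32, a34, a36, a8⟩ := eff_center (col := col) hm hG h₁ h hi hy
  obtain ⟨μb, eb, fb, b34, bb⟩ := eff_kernelLoop (col := col) hm hG hyabs ba
    (by rw [fa _ (by decide), hf _ (by norm_num) (by decide), h₁.c2]) a8
    (by rw [fa _ (by decide), hf _ (by norm_num) (by decide), h₁.c30]) a32 a34 a36
  have fab : ∀ j, j ∉ [48, 32, 28, 34, 36, 8] → μb j = μ j := by
    intro j hj
    simp only [List.mem_cons, List.not_mem_nil, or_false] at hj
    rw [fb j (by simp only [List.mem_cons, List.not_mem_nil, or_false]; omega),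
      fa j (by simp only [List.mem_cons, List.not_mem_nil, or_false]; omega)]
  obtain ⟨μc, ec, fc, bc, c50, c46, c38⟩ := eff_digit (col := col) hm hG (H := H) (y := y) (c := c)
    (by omega) (by omega) bb
    (by rw [fab _ (by decide), hf _ (by norm_num) (by decide), h₁.c2])
    (by rw [fab _ (by decide), hf _ (by norm_num) (by decide), h₁.c16])
    (by rw [fab _ (by decide), hf _ (by norm_num) (by decide), h₁.c20])
    (by rw [fab _ (by decide), hf _ (by norm_num) (by decide), h₁.c26]) b34
    (by rw [fab _ (by decide), h.c38]; omega)
    (by rw [fab _ (by decide), hf _ (by norm_num) (by decide), h₁.c44])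
    (by rw [fab _ (by decide), hf _ (by norm_num) (by decide), h₁.c52])
  have hst : Straight storeBlock := by simp [storeBlock, block, Straight, addP]
  have ed : Eff col _ _ storeBlock μc _ :=
    (Eff.straight hst bc).mono le_rfl (straight_time_le storeBlock m)
  have c48 : μc 48 = y := by rw [fc _ (by decide), fb _ (by decide), a48]
  have cc2 : μc 2 = 1 := by
    rw [fc _ (by decide), fab _ (by decide), hf _ (by norm_num) (by decide), h₁.c2]
  have hmem : memEval storeBlock μc = Function.update (Function.update (Function.update μc
      (2 * c + 52) y) 46 ((2 * c + 53 : ℕ) : ℤ)) (2 * c + 53) (weightOf m G H y) := by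
    -- As c ≥ 1, output addresses start at 54, beyond all scalar cells.
    have n1 : ∀ j, j < 53 → j ≠ 2 * c + 52 := by intro j hj; omega
    simp only [storeBlock, block, memEval, addP, laddr, Op.eval, c46, Int.toNat_natCast, c48,
      Function.update_of_ne (n1 46 (by norm_num)), Function.update_of_ne (n1 2 (by norm_num)),
      Function.update_self, cc2]
    have e53 : ((2 * c + 52 : ℕ) : ℤ) + 1 = ((2 * c + 53 : ℕ) : ℤ) := by push_cast; ring
    rw [e53, Int.toNat_natCast, Function.update_of_ne (by norm_num : (50 : ℕ) ≠ 46),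
      Function.update_of_ne (n1 50 (by norm_num)), c50]
  rw [hmem] at ed
  refine ⟨_, (ea.seq (eb.seq (ec.seq ed))).mono (by omega) (le_of_eq ?_), ?_⟩
  · unfold atomCost; ring
  · have hcz : (c : ℤ) ≤ 4 * G + 1 := by omega
    have fabc : ∀ j, j ∉ [48, 32, 28, 34, 36, 8, 50, 46, 38] → μc j = μ j := by
      intro j hj
      simp only [List.mem_cons, List.not_mem_nil, or_false] at hj
      rw [fc j (by simp only [List.mem_cons, List.not_mem_nil, or_false]; omega),
        fab j (by simp only [List.mem_cons, List.not_mem_nil, or_false]; omega)]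
    refine ⟨?_, ?_, ?_, ?_⟩
    · intro j hj hj'
      simp only [List.mem_cons, List.not_mem_nil, or_false] at hj'
      rw [Function.update_of_ne (by omega), Function.update_of_ne (by omega),
        Function.update_of_ne (by omega),
        fabc j (by simp only [List.mem_cons, List.not_mem_nil, or_false]; omega)]
      exact hf j hj (by simp only [List.mem_cons, List.not_mem_nil, or_false]; omega)
    · rw [Function.update_of_ne (by omega), Function.update_of_ne (by omega),
        Function.update_of_ne (by omega), c38]
      push_cast
      omega
    · intro c' hc1 hc2
      rcases eq_or_ne c' c with rfl | hne
      · rw [hyc]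
        constructor
        · rw [Function.update_of_ne (by omega), Function.update_of_ne (by omega),
            Function.update_self]
        · rw [Function.update_self]
      · have := h.out c' (by omega) hc2
        constructor
        · rw [Function.update_of_ne (by omega), Function.update_of_ne (by omega),
            Function.update_of_ne (by omega),
            fabc _ (by simp only [List.mem_cons, List.not_mem_nil, or_false]; omega)]
          exact this.1
        · rw [Function.update_of_ne (by omega), Function.update_of_ne (by omega),
            Function.update_of_ne (by omega),
            fabc _ (by simp only [List.mem_cons, List.not_mem_nil, or_false]; omega)]
          exact this.2
    · refine ((bc.update _ ?_).update _ ?_).update _ (bits_weightOf_le hm hG H y)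
      · exact bits_le_beta hm hG 2 (hyabs.trans (by nlinarith)) (by nlinarith only [hm])
      · refine bits_le_beta_of_nonneg hm hG 2 (by positivity) ?_ (by nlinarith only [hm])
        push_cast
        nlinarith

/-- Recursion depth of the output phase. -/
def atomDepth (m G : ℕ) : ℕ := sdepth centerBlock + sdepth kernelBlock + sdepth digitBlock +
  sdepth storeBlock + sdepth finishBlock + m + 4 * G + 8

theorem eff_atoms (hm : 1 ≤ m) (hG : G = 65536 ^ m) {H : ℤ} {μ₁ : ℕ → ℤ}
    (h₁ : AtomReady m G H μ₁) :
    ∃ μ', Eff col (atomDepth m G)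
        ((4 * G + 2) * ((atomCost + 2 + scost finishBlock) * unitTime m))
        (.seq atomLoop finishBlock) μ₁ μ' ∧ μ' 0 = G ∧ μ' 1 = 4 * G + 27 ∧
      (∀ i < 26, μ' (3 + 2 * i) = 0) ∧
      ∀ c : ℕ, 1 ≤ c → c ≤ 4 * G + 1 → μ' (2 * c + 52) = (c : ℤ) - (2 * G + 1) ∧
        μ' (2 * c + 53) = weightOf m G H ((c : ℤ) - (2 * G + 1)) := by
  obtain ⟨μa, ea, ha⟩ := Eff.loop (col := col) (β := beta m) (a := 38) (N := 4 * G + 1)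
    (p := block centerBlock [kernelLoop, digitBlock, storeBlock]) (AtomInv m G H μ₁)
    (fun i μ _ h => h.bd 38)
    (fun i μ hi h => ⟨by rw [h.c38]; omega, eff_atomBody hm hG h₁ h hi⟩)
    (fun μ h => by rw [h.c38]; push_cast; omega)
    (m := μ₁) ⟨fun _ _ _ => rfl, by rw [h₁.c38]; simp, fun c h1 h2 => by omega, h₁.bd⟩
  have d := direct_blocks.2.2.2.2.2.2.2.2
  have w : writes finishBlock = [0, 1, 1, 28, 1] := rfl
  have e6 : μa 6 = G := by rw [ha.frame _ (by norm_num) (by decide), h₁.c6]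
  have e40 : μa 40 = 2 * G + 1 := by rw [ha.frame _ (by norm_num) (by decide), h₁.c40]
  set μ' := memEval finishBlock μa with hμ'
  have hfr : ∀ j, j ∉ [0, 1, 1, 28, 1] → μ' j = μa j := fun j hj => by
    rw [hμ', d.memEval_of_notMem (by rw [w]; exact hj)]
  refine ⟨μ', (Eff.seq ea (Eff.straight d.straight ha.bd)).mono ?_ ?_, ?_, ?_, ?_, ?_⟩
  · unfold atomDepth; omega
  · have t1 := straight_time_le finishBlock m
    have t2 : 2 + beta m ≤ 2 * unitTime m := by
      unfold unitTime
      nlinarith [Nat.zero_le (m * (1 + beta m) ^ 2)]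
    calc _ ≤ (4 * G + 1 + 1) * (atomCost * unitTime m + 2 * unitTime m) +
          scost finishBlock * unitTime m := by gcongr
      _ ≤ _ := by nlinarith [Nat.zero_le (G * (scost finishBlock * unitTime m)),
          Nat.zero_le (scost finishBlock * unitTime m)]
  · simp [hμ', finishBlock, block, memEval, addP, constP, copyP, laddr, Op.eval, e6]
  · simp [hμ', finishBlock, block, memEval, addP, constP, copyP, laddr, Op.eval, e6, e40]
    ring
  · intro i hi
    rw [hfr _ (by simp only [List.mem_cons, List.not_mem_nil, or_false]; omega),
      ha.frame _ (by omega) (by simp only [List.mem_cons, List.not_mem_nil, or_false]; omega)]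
    exact h₁.odd _ (by omega)
  · intro c hc1 hc2
    rw [hfr _ (by simp only [List.mem_cons, List.not_mem_nil, or_false]; omega),
      hfr _ (by simp only [List.mem_cons, List.not_mem_nil, or_false]; omega)]
    exact ha.out c (by omega) hc2

end

end

end SpectralSampling

namespace SpectralSampling

open MeasureTheory
open scoped ENNReal

noncomputable section

/-! ### From return counts to weights -/

section

variable {m G : ℕ}

theorem four_pow_le (hG : G = 65536 ^ m) : (4 * (G : ℤ) ^ 2) ^ (4 * m) ≤ (G : ℤ) ^ (8 * m + 1) := by
  have h : (4 : ℤ) ^ (4 * m) ≤ G := by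
    rw [hG, pow_mul]
    push_cast
    exact pow_le_pow_left₀ (by norm_num) (by norm_num) m
  calc (4 * (G : ℤ) ^ 2) ^ (4 * m) = 4 ^ (4 * m) * (G : ℤ) ^ (8 * m) := by
        rw [mul_pow, ← pow_mul]; congr 2; ring
    _ ≤ G * (G : ℤ) ^ (8 * m) := by gcongr
    _ = _ := by ring

theorem twentytwo_pow_le (hm : 1 ≤ m) (hG : G = 65536 ^ m) :
    (22 * (G : ℤ) ^ 2) ^ (4 * m) ≤ (G : ℤ) ^ (8 * m + 2) := by
  have h1 := noise_le hm hG
  have h2 : (G : ℤ) * (4 * (G : ℤ) ^ 2) ^ (4 * m) ≤ G * (G : ℤ) ^ (8 * m + 1) :=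
    mul_le_mul_of_nonneg_left (four_pow_le hG) (by positivity)
  have h3 : (G : ℤ) * (G : ℤ) ^ (8 * m + 1) = (G : ℤ) ^ (8 * m + 2) := by ring
  have h4 : (0 : ℤ) ≤ (22 * (G : ℤ) ^ 2) ^ (4 * m) := by positivity
  nlinarith [mul_nonneg h4 (by positivity : (0 : ℤ) ≤ m)]

/-- The base B = G^(8m+8) exceeds the digits of the product, at most G^(8m+6), plus the shift, at
most G^(8m+4), so `digit_eq` applies. -/
theorem weightOf_eq (hm : 1 ≤ m) (hG : G = 65536 ^ m) {M : ℕ → ℕ} (hM : ∀ j, M j ≤ G ^ 4) {y : ℤ}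
    (hy : |y| ≤ 2 * G)
    (h1 : 1 ≤ (∑ j ∈ Finset.range (8 * m + 1), (fPoly m G y).coeff j * (M j : ℤ)) +
      (G : ℤ) ^ 3 * (4 * (G : ℤ) ^ 2) ^ (4 * m)) :
    ∃ e : ℤ, 0 ≤ e ∧ e ≤ 1 ∧ weightOf m G (hval (8 * m) ((G : ℤ) ^ (8 * m + 8)) M) y =
      (∑ j ∈ Finset.range (8 * m + 1), (fPoly m G y).coeff j * (M j : ℤ)) +
        (G : ℤ) ^ 3 * (4 * (G : ℤ) ^ 2) ^ (4 * m) - e := by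
  have hgz := grid_cast_ge hm hG
  have hM' : ∀ j, (M j : ℤ) ≤ (G : ℤ) ^ 4 := fun j => by exact_mod_cast hM j
  have hp : (0 : ℤ) < (G : ℤ) ^ (8 * m + 4) := by positivity
  have hco : ∀ i, |(fPoly m G y * hPoly (8 * m) M).coeff i| ≤ (G : ℤ) ^ (8 * m + 4) * G ^ 2 := by
    intro i
    refine (abs_coeff_mul_hPoly_le _ _ hM' i).trans ?_
    calc l1 (fPoly m G y) * (G : ℤ) ^ 4 ≤ (G : ℤ) ^ (8 * m + 2) * (G : ℤ) ^ 4 := by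
          gcongr
          exact (l1_fPoly_le m hy).trans (twentytwo_pow_le hm hG)
      _ = _ := by ring
  have hσ : (G : ℤ) ^ 3 * (4 * (G : ℤ) ^ 2) ^ (4 * m) ≤ (G : ℤ) ^ (8 * m + 4) := by
    calc _ ≤ (G : ℤ) ^ 3 * (G : ℤ) ^ (8 * m + 1) :=
          mul_le_mul_of_nonneg_left (four_pow_le hG) (by positivity)
      _ = _ := by ring
  have hB : (G : ℤ) ^ (8 * m + 8) = (G : ℤ) ^ (8 * m + 4) * (G ^ 2 * G ^ 2) := by ring
  have hg2 : (2 : ℤ) ≤ (G : ℤ) ^ 2 := by nlinarith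
  have hlt : (G : ℤ) ^ (8 * m + 4) * G ^ 2 + (G : ℤ) ^ (8 * m + 4) < (G : ℤ) ^ (8 * m + 8) := by
    rw [hB]
    have : (G : ℤ) ^ 2 + 1 < G ^ 2 * G ^ 2 := by nlinarith
    nlinarith [mul_lt_mul_of_pos_left this hp]
  have hc := coeff_mul_hPoly (fPoly m G y) (8 * m) M
  obtain ⟨e, e0, e1, he⟩ := digit_eq (fPoly m G y * hPoly (8 * m) M) (8 * m)
    (B := (G : ℤ) ^ (8 * m + 8)) (σ := (G : ℤ) ^ 3 * (4 * (G : ℤ) ^ 2) ^ (4 * m)) (by positivity)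
    (fun i => by have := hco i; linarith) (by rw [hc]; exact h1)
    (by have := (abs_le.mp (hco (8 * m))).2; linarith)
  refine ⟨e, e0, e1, ?_⟩
  rw [hc, Polynomial.eval_mul, eval_fPoly, eval_hPoly] at he
  rw [weightOf, vVal, hval, Int.emod_def, ← he]
  ring

/-- The kernel average is non-negative and the noise is at most half the shift, which is at least 2.
So the shifted digit is at least 1, as reading it off requires. -/
theorem weights_accurate {n : ℕ} [NeZero n] (hm : 1 ≤ m) (hG : G = 65536 ^ m) {lam : Fin n → ℝ}
    (hlam : ∀ l, |lam l| ≤ 1) {M : ℕ → ℕ} (hU : ∀ j, M j ≤ G ^ 4)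
    (hM : ∀ j ≤ 8 * m, |(M j : ℝ) - (G : ℝ) ^ 3 * ((∑ l, lam l ^ j) / n)| ≤ (G : ℝ) ^ 2)
    (y : ℤ) (hy : |y| ≤ 2 * G) :
    ∃ e : ℤ, 0 ≤ e ∧ e ≤ 1 ∧ weightOf m G (hval (8 * m) ((G : ℤ) ^ (8 * m + 8)) M) y =
      (∑ j ∈ Finset.range (8 * m + 1), (fPoly m G y).coeff j * (M j : ℤ)) +
        (G : ℤ) ^ 3 * (4 * (G : ℤ) ^ 2) ^ (4 * m) - e := by
  refine weightOf_eq hm hG hU hy ?_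
  have hgz := grid_cast_ge hm hG
  obtain ⟨x, hx, hxl⟩ := exists_grid_points (G := G) (by have := grid_ge hm hG; omega) hlam
  have hc := (abs_le.mp (weight_close hm hG hlam hx hxl hM hy)).1
  have hk : 0 ≤ (∑ l, gker m G (x l - y)) / n :=
    div_nonneg (Finset.sum_nonneg fun l _ => gker_nonneg _ _ _) (by positivity)
  have hσ : (2 : ℤ) ≤ (G : ℤ) ^ 3 * (4 * (G : ℤ) ^ 2) ^ (4 * m) := by
    have h3 : (1 : ℤ) ≤ (4 * (G : ℤ) ^ 2) ^ (4 * m) := one_le_pow₀ (by nlinarith)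
    have h4 : (2 : ℤ) ≤ (G : ℤ) ^ 3 :=
      (by linarith : (2 : ℤ) ≤ G).trans (le_self_pow₀ (by linarith) (by norm_num))
    nlinarith
  have hσ' : (2 : ℝ) ≤ (G : ℝ) ^ 3 * (4 * (G : ℝ) ^ 2) ^ (4 * m) := by exact_mod_cast hσ
  have : (1 : ℝ) ≤ ((∑ j ∈ Finset.range (8 * m + 1), (fPoly m G y).coeff j * (M j : ℤ) : ℤ) : ℝ) +
      (G : ℝ) ^ 3 * (4 * (G : ℝ) ^ 2) ^ (4 * m) := by
    have := mul_nonneg (by linarith : 0 ≤ (G : ℝ) ^ 3 * (4 * (G : ℝ) ^ 2) ^ (4 * m)) hk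
    linarith
  exact_mod_cast this

/-! ### The sampling phase starts and ends in the right states -/

theorem Ready.sampleReady (hm : 1 ≤ m) (hG : G = 65536 ^ m) {μ : ℕ → ℤ} (h : Ready m G μ) :
    SampleReady (8 * m) (beta m) (G ^ 4) ((G : ℤ) ^ (8 * m + 8)) μ := by
  have hgz := grid_cast_ge hm hG
  have hB1 : (1 : ℤ) < (G : ℤ) ^ (8 * m + 8) := one_lt_pow₀ (by linarith) (by omega)
  have hmG : (8 * m + 1 : ℤ) ≤ G := by exact_mod_cast (mul_add_le_grid hm hG).1
  refine ⟨hB1, h.c2, h.c16, h.c22, h.bd, ?_, ?_, ?_⟩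
  · unfold beta
    exact Nat.succ_le_of_lt (by positivity)
  · intro M hM
    refine bits_le_beta_of_nonneg hm hG (5 + (8 * m + 8) * (8 * m)) ?_ ?_ (by nlinarith only [hm])
    · exact Finset.sum_nonneg fun j _ => by positivity
    · calc hval (8 * m) ((G : ℤ) ^ (8 * m + 8)) M
          ≤ ∑ _j ∈ Finset.range (8 * m + 1), (G : ℤ) ^ 4 * ((G : ℤ) ^ (8 * m + 8)) ^ (8 * m) := by
            refine Finset.sum_le_sum fun j _ => ?_
            have h1 : (M j : ℤ) ≤ (G : ℤ) ^ 4 := by exact_mod_cast hM j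
            gcongr
            · exact hB1.le
            · omega
        _ = (8 * m + 1) * ((G : ℤ) ^ 4 * ((G : ℤ) ^ (8 * m + 8)) ^ (8 * m)) := by simp
        _ ≤ G * ((G : ℤ) ^ 4 * ((G : ℤ) ^ (8 * m + 8)) ^ (8 * m)) := by gcongr
        _ = _ := by rw [← pow_mul, pow_add]; ring
  · intro l hl
    refine bits_le_beta_of_nonneg hm hG ((8 * m + 8) * (8 * m)) ?_ ?_ (by nlinarith only [hm])
    · positivity
    · refine (Int.ediv_le_self _ (by positivity)).trans ?_
      rw [pow_mul]
      exact pow_le_pow_right₀ hB1.le hl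

/-- The return counts before the first walk. -/
def startCount (G j : ℕ) : ℕ := if j = 0 then G ^ 3 else 0

theorem hval_startCount (L : ℕ) (B : ℤ) : hval L B (startCount G) = (G : ℤ) ^ 3 * B ^ L := by
  rw [hval, Finset.sum_eq_single 0]
  · simp [startCount]
  · intro j _ hj; simp [startCount, hj]
  · simp

theorem Ready.sampling {n : ℕ} {μ : ℕ → ℤ} (h : Ready m G μ) {s : State n}
    (hs : s.mem = μ) {T : ℕ} (hT : s.time ≤ T) (hq : s.queries = 0) :
    Sampling (8 * m) (beta m) ((G : ℤ) ^ (8 * m + 8)) μ (G ^ 3 : ℕ) 0 (startCount G) (G ^ 3) T 0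
      s := by
  subst hs
  refine ⟨fun _ _ _ _ _ => rfl, by rw [h.c12]; push_cast; rfl, h.c24, ?_, h.bd 28, ?_, hT, hq.le⟩
  · rw [h.c26, hval_startCount]
  · intro j
    unfold startCount
    split_ifs <;> simp

theorem Ready.atomReady {n : ℕ} (hm : 1 ≤ m) (hG : G = 65536 ^ m) {μ : ℕ → ℤ} (h : Ready m G μ)
    {M : ℕ → ℕ} {U T q : ℕ} (hU : U ≤ G ^ 4) {s : State n}
    (hs : Sampling (8 * m) (beta m) ((G : ℤ) ^ (8 * m + 8)) μ 0 0 M U T q s) :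
    AtomReady m G (hval (8 * m) ((G : ℤ) ^ (8 * m + 8)) M) s.mem := by
  have f := hs.frame
  have h0 : bits 0 ≤ beta m := by simp [bits]
  exact
    { c2 := by rw [f _ (by decide) (by decide) (by decide) (by decide), h.c2]
      c4 := by rw [f _ (by decide) (by decide) (by decide) (by decide), h.c4]
      c6 := by rw [f _ (by decide) (by decide) (by decide) (by decide), h.c6]
      c14 := by rw [f _ (by decide) (by decide) (by decide) (by decide), h.c14]
      c16 := by rw [f _ (by decide) (by decide) (by decide) (by decide), h.c16]
      c20 := by rw [f _ (by decide) (by decide) (by decide) (by decide), h.c20]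
      c26 := hs.cell_code
      c30 := by rw [f _ (by decide) (by decide) (by decide) (by decide), h.c30]
      c38 := by rw [f _ (by decide) (by decide) (by decide) (by decide), h.c38]
      c40 := by rw [f _ (by decide) (by decide) (by decide) (by decide), h.c40]
      c42 := by rw [f _ (by decide) (by decide) (by decide) (by decide), h.c42]
      c44 := by rw [f _ (by decide) (by decide) (by decide) (by decide), h.c44]
      c52 := by rw [f _ (by decide) (by decide) (by decide) (by decide), h.c52]
      odd := fun i hi => by
        rw [f _ (by omega) (by omega) (by omega) (by omega), h.odd i hi]
      bd := hs.bd (h.sampleReady hm hG) hU h0 h0 }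

/-! ### The output -/

/-- The output cells hold atoms at `y / G` with weights `W y`, and atoms of weight zero. -/
structure Encodes {n : ℕ} (G : ℕ) (W : ℤ → ℤ) (s : State n) : Prop where
  denom : s.mem 0 = G
  count : s.mem 1 = 4 * G + 27
  padding : ∀ i < 26, s.mem (3 + 2 * i) = 0
  atom : ∀ c : ℕ, 1 ≤ c → c ≤ 4 * G + 1 → s.mem (2 * c + 52) = (c : ℤ) - (2 * G + 1) ∧
    s.mem (2 * c + 53) = W ((c : ℤ) - (2 * G + 1))

theorem sum_range_eq_sum_Icc {α : Type*} [AddCommMonoid α] (G : ℕ) (f : ℤ → α) :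
    ∑ i ∈ Finset.range (4 * G + 1), f ((i : ℤ) - 2 * G) =
      ∑ y ∈ Finset.Icc (-((2 * G : ℕ) : ℤ)) ((2 * G : ℕ) : ℤ), f y := by
  refine Finset.sum_bij (fun i _ => (i : ℤ) - 2 * G) ?_ ?_ ?_ ?_
  · intro i hi
    rw [Finset.mem_range] at hi
    rw [Finset.mem_Icc]
    push_cast
    omega
  · intro i _ j _ h
    omega
  · intro y hy
    rw [Finset.mem_Icc] at hy
    push_cast at hy
    exact ⟨(y + 2 * G).toNat, by rw [Finset.mem_range]; omega, by omega⟩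
  · intros; rfl

theorem Encodes.atoms_eq {n : ℕ} {W : ℤ → ℤ} {s : State n} (h : Encodes G W s) :
    s.atoms = 26 + (4 * G + 1) := by
  rw [State.atoms, h.count]; omega

theorem Encodes.weight_eq {n : ℕ} {W : ℤ → ℤ} {s : State n} (h : Encodes G W s) {i : ℕ}
    (hi : i < 4 * G + 1) : s.weight (26 + i) = W ((i : ℤ) - 2 * G) := by
  have := (h.atom (i + 1) (by omega) (by omega)).2
  rw [State.weight, (by ring : 3 + 2 * (26 + i) = 2 * (i + 1) + 53), this]
  congr 1
  push_cast
  ring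

theorem Encodes.location_eq {n : ℕ} {W : ℤ → ℤ} {s : State n} (h : Encodes G W s) {i : ℕ}
    (hi : i < 4 * G + 1) : s.location (26 + i) = (((i : ℤ) - 2 * G : ℤ) : ℝ) / G := by
  have := (h.atom (i + 1) (by omega) (by omega)).1
  rw [State.location, (by ring : 2 + 2 * (26 + i) = 2 * (i + 1) + 52), this, h.denom]
  push_cast
  congr 1
  ring

theorem Encodes.weight_padding {n : ℕ} {W : ℤ → ℤ} {s : State n} (h : Encodes G W s) {i : ℕ}
    (hi : i < 26) : s.weight i = 0 := h.padding i hi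

theorem Encodes.totalWeight_eq {n : ℕ} {W : ℤ → ℤ} {s : State n} (h : Encodes G W s) :
    s.totalWeight = ∑ y ∈ Finset.Icc (-((2 * G : ℕ) : ℤ)) ((2 * G : ℕ) : ℤ), W y := by
  rw [State.totalWeight, h.atoms_eq, Finset.sum_range_add, ← sum_range_eq_sum_Icc,
    Finset.sum_eq_zero fun i hi => h.weight_padding (Finset.mem_range.mp hi), zero_add]
  exact Finset.sum_congr rfl fun i hi => h.weight_eq (Finset.mem_range.mp hi)

theorem Encodes.output_eq {n : ℕ} {W : ℤ → ℤ} {s : State n} (h : Encodes G W s) :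
    s.output = ∑ y ∈ Finset.Icc (-((2 * G : ℕ) : ℤ)) ((2 * G : ℕ) : ℤ), ENNReal.ofReal ((W y : ℝ) /
      ((∑ z ∈ Finset.Icc (-((2 * G : ℕ) : ℤ)) ((2 * G : ℕ) : ℤ), W z : ℤ) : ℝ)) •
        Measure.dirac ((y : ℝ) / G) := by
  rw [State.output, h.atoms_eq, Finset.sum_range_add, ← sum_range_eq_sum_Icc G
    (fun y => ENNReal.ofReal ((W y : ℝ) / _) • Measure.dirac ((y : ℝ) / G)), h.totalWeight_eq,
    Finset.sum_eq_zero fun i hi => by rw [h.weight_padding (Finset.mem_range.mp hi)]; simp,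
    zero_add]
  refine Finset.sum_congr rfl fun i hi => ?_
  rw [h.weight_eq (Finset.mem_range.mp hi), h.location_eq (Finset.mem_range.mp hi)]

theorem Encodes.wellFormed {n : ℕ} {W : ℤ → ℤ} {s : State n} (h : Encodes G W s) (hG : 0 < G)
    (h0 : ∀ y : ℤ, |y| ≤ 2 * G → 0 ≤ W y)
    (h1 : 0 < ∑ y ∈ Finset.Icc (-((2 * G : ℕ) : ℤ)) ((2 * G : ℕ) : ℤ), W y) : s.WellFormed := by
  refine ⟨by rw [h.denom]; exact_mod_cast hG, fun i hi => ?_, by rw [h.totalWeight_eq]; exact h1⟩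
  rw [h.atoms_eq] at hi
  rcases lt_or_ge i 26 with hi' | hi'
  · rw [h.weight_padding hi']
  · obtain ⟨j, rfl⟩ := Nat.exists_eq_add_of_le hi'
    rw [h.weight_eq (by omega)]
    refine h0 _ ?_
    rw [abs_le]
    constructor <;> omega

end

end

end SpectralSampling

namespace SpectralSampling

open MeasureTheory
open scoped ENNReal

noncomputable section

/-! ### The whole program -/

section

variable {m G : ℕ}

/-- A bound for the running time of the algorithm. -/
def totalTime (m G : ℕ) : ℕ := setupCost * unitTime m +
  (G ^ 3 + 1) * walkTime (8 * m) (beta m) +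
  (4 * G + 2) * ((atomCost + 2 + scost finishBlock) * unitTime m)

theorem count_bound (hm : 1 ≤ m) (hG : G = 65536 ^ m) : G ^ 3 + G ^ 3 * (8 * m) ≤ G ^ 4 := by
  have h := (mul_add_le_grid hm hG).1
  calc G ^ 3 + G ^ 3 * (8 * m) = G ^ 3 * (8 * m + 1) := by ring
    _ ≤ G ^ 3 * G := by gcongr
    _ = _ := by ring

theorem sim_spectralProgram {n : ℕ} [NeZero n] (col : Fin n → PMF (Fin n)) {k : ℕ} (hm : 1 ≤ m)
    (hG : G = 65536 ^ m) (hk : m = 256 * k) :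
    ∃ F, Sim col F spectralProgram (State.init n k) (reps col (8 * m) (G ^ 3) (startCount G))
      (fun M s => (∀ j, M j ≤ G ^ 4) ∧
        Encodes G (weightOf m G (hval (8 * m) ((G : ℤ) ^ (8 * m + 8)) M)) s ∧
        s.time ≤ totalTime m G ∧ s.queries ≤ G ^ 3 * (8 * m + 2)) := by
  obtain ⟨F, μ, he, hr⟩ := eff_setup (col := col) hm hG hk
  have hU := count_bound hm hG
  have hbits : bits ((G ^ 3 : ℕ) : ℤ) ≤ beta m :=
    bits_le_beta_of_nonneg hm hG 3 (by positivity) (by push_cast; rfl) (by nlinarith only [hm])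
  refine ⟨_, Sim.seq_pure (Sim.of_eff (s := State.init n k) he () (R := fun _ s =>
    s.mem = μ ∧ s.time ≤ setupCost * unitTime m ∧ s.queries = 0) ?_)
    (F₂ := max (sdepth recordBlock + 20 + 8 * m + G ^ 3) (atomDepth m G) + 1) ?_⟩
  · intro s h1 _ h3 h4
    exact ⟨h1, by simpa [State.init] using h4, h3⟩
  · rintro - s ⟨h1, h2, h3⟩
    have hs := sim_sampleLoop (col := col) (hr.sampleReady hm hG) (G ^ 3) hbits (startCount G)
      (G ^ 3) _ 0 hU s (hr.sampling h1 h2 h3)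
    have := hs.seq (q := .seq atomLoop finishBlock) (E := PMF.pure) (F₂ := atomDepth m G)
      (R' := fun M s => (∀ j, M j ≤ G ^ 4) ∧
        Encodes G (weightOf m G (hval (8 * m) ((G : ℤ) ^ (8 * m + 8)) M)) s ∧
        s.time ≤ totalTime m G ∧ s.queries ≤ G ^ 3 * (8 * m + 2)) ?_
    · rwa [PMF.bind_pure] at this
    · intro M s' h
      obtain ⟨μ', e, g0, g1, g2, g3⟩ := eff_atoms (col := col) hm hG (hr.atomReady hm hG hU h)
      refine Sim.of_eff e M ?_
      intro s'' i1 _ i3 i4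
      subst i1
      refine ⟨fun j => (h.bound j).trans hU, ⟨g0, g1, g2, g3⟩, ?_, ?_⟩
      · have := h.time_le
        unfold totalTime
        omega
      · have := h.queries_le
        omega

/-! ### Running time -/

/-- Bit lengths are cubic in m, hence negligible against 65536^m = 8192^m · 8^m. -/
theorem beta_lt_grid (hm : 1 ≤ m) (hG : G = 65536 ^ m) : 1 + beta m ≤ G := by
  have h1 : m ^ 3 ≤ 8 ^ m := by
    calc m ^ 3 ≤ (2 ^ m) ^ 3 := Nat.pow_le_pow_left Nat.lt_two_pow_self.le 3
      _ = 8 ^ m := by rw [← pow_mul, mul_comm, pow_mul]; norm_num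
  have h2 : 6145 ≤ 8192 ^ m := by
    calc 6145 ≤ 8192 ^ 1 := by norm_num
      _ ≤ _ := Nat.pow_le_pow_right (by norm_num) hm
  have h3 : 1 ≤ m ^ 3 := Nat.one_le_pow _ _ hm
  calc 1 + beta m ≤ 1 + 16 * m * ((16 * m) * (24 * m)) := by unfold beta; gcongr <;> omega
    _ ≤ 6145 * m ^ 3 := by nlinarith only [h3]
    _ ≤ 8192 ^ m * 8 ^ m := by gcongr
    _ = G := by rw [hG, ← mul_pow]; norm_num

/-- The constant factor in the running time. -/
def totalCost : ℕ := setupCost + 10 * (scost recordBlock + 9) +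
  6 * (atomCost + 2 + scost finishBlock) + 2

/-- The dominant term is the sampling phase: G^3 walks, each of time O(G^3). -/
theorem totalTime_le (hm : 1 ≤ m) (hG : G = 65536 ^ m) : totalTime m G ≤ totalCost * G ^ 6 := by
  have hb := beta_lt_grid hm hG
  obtain ⟨h8, h2⟩ := mul_add_le_grid hm hG
  have hG1 : 1 ≤ G := by omega
  have hu : unitTime m ≤ G ^ 3 := by
    calc unitTime m ≤ G * G ^ 2 := by unfold unitTime; gcongr
      _ = _ := by ring
  have hw : walkTime (8 * m) (beta m) ≤ 5 * (scost recordBlock + 9) * G ^ 3 := by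
    calc walkTime (8 * m) (beta m) ≤ (5 * G) * ((scost recordBlock + 9) * G ^ 2) := by
          unfold walkTime stepTime; gcongr; omega
      _ = _ := by ring
  have h36 : G ^ 3 ≤ G ^ 6 := Nat.pow_le_pow_right hG1 (by norm_num)
  have h46 : G ^ 4 ≤ G ^ 6 := Nat.pow_le_pow_right hG1 (by norm_num)
  have hG3 : 1 ≤ G ^ 3 := Nat.one_le_pow _ _ hG1
  calc totalTime m G ≤ setupCost * G ^ 3 + (2 * G ^ 3) * (5 * (scost recordBlock + 9) * G ^ 3) +
        (6 * G) * ((atomCost + 2 + scost finishBlock) * G ^ 3) := by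
        unfold totalTime; gcongr <;> omega
    _ = setupCost * G ^ 3 + 10 * (scost recordBlock + 9) * G ^ 6 +
        6 * (atomCost + 2 + scost finishBlock) * G ^ 4 := by ring
    _ ≤ setupCost * G ^ 6 + 10 * (scost recordBlock + 9) * G ^ 6 +
        6 * (atomCost + 2 + scost finishBlock) * G ^ 6 := by gcongr
    _ ≤ totalCost * G ^ 6 := by
      rw [← add_mul, ← add_mul]
      exact Nat.mul_le_mul_right _ (Nat.le_add_right _ 2)

theorem queries_bound (hm : 1 ≤ m) (hG : G = 65536 ^ m) :
    G ^ 3 * (8 * m + 2) ≤ totalCost * G ^ 6 := by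
  obtain ⟨h8, h2⟩ := mul_add_le_grid hm hG
  have hG1 : 1 ≤ G := by omega
  calc G ^ 3 * (8 * m + 2) ≤ G ^ 3 * (2 * G) := by gcongr; omega
    _ = 2 * G ^ 4 := by ring
    _ ≤ totalCost * G ^ 6 := by
      exact Nat.mul_le_mul (Nat.le_add_left 2 _) (Nat.pow_le_pow_right hG1 (by norm_num))

/-- The exponent in the running time. -/
def growthRate : ℝ := 1536 * Real.log 65536

/-- The constant in the statement of the main theorem. -/
def timeConstant : ℝ := totalCost * Real.exp growthRate + growthRate

theorem growthRate_pos : 0 < growthRate := by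
  have := Real.log_pos (by norm_num : (1 : ℝ) < 65536)
  unfold growthRate
  positivity

theorem timeConstant_pos : 0 < timeConstant :=
  add_pos_of_nonneg_of_pos (by positivity) growthRate_pos

/-- G^6 is exactly exp(`growthRate` · k). Rounding 1/ε up costs a factor of at most
exp(`growthRate`), which `timeConstant` absorbs. -/
theorem cost_le {k : ℕ} (hk : m = 256 * k) (hG : G = 65536 ^ m) {ε : ℝ} (hε : 0 < ε)
    (hkε : (k : ℝ) ≤ 1 / ε + 1) :
    ((totalCost * G ^ 6 : ℕ) : ℝ) ≤ timeConstant * Real.exp (timeConstant / ε) := by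
  have hr := growthRate_pos
  have h1 : (G : ℝ) ^ 6 = Real.exp (growthRate * k) := by
    have : growthRate * k = ((m * 6 : ℕ) : ℝ) * Real.log 65536 := by
      unfold growthRate; rw [hk]; push_cast; ring
    rw [this, Real.exp_nat_mul, Real.exp_log (by norm_num), hG, pow_mul]
    push_cast
    rfl
  have h2 : growthRate * k ≤ growthRate + growthRate / ε := by
    calc growthRate * k ≤ growthRate * (1 / ε + 1) := by gcongr
      _ = _ := by ring
  have h3 : growthRate ≤ timeConstant := by
    have : (0 : ℝ) ≤ totalCost * Real.exp growthRate := by positivity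
    unfold timeConstant; linarith
  have h4 : totalCost * Real.exp growthRate ≤ timeConstant := by unfold timeConstant; linarith
  push_cast
  rw [h1]
  calc totalCost * Real.exp (growthRate * k)
      ≤ totalCost * Real.exp (growthRate + growthRate / ε) := by gcongr
    _ = totalCost * Real.exp growthRate * Real.exp (growthRate / ε) := by rw [Real.exp_add]; ring
    _ ≤ timeConstant * Real.exp (timeConstant / ε) := by
      have := timeConstant_pos
      gcongr

end

/-! ### Success probability -/

theorem two_thirds_le_of_compl {α : Type*} (p : PMF α) (s : Set α)
    (h : p.toOuterMeasure sᶜ ≤ 1 / 3) : 2 / 3 ≤ p.toOuterMeasure s := by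
  have h1 : 1 ≤ p.toOuterMeasure s + p.toOuterMeasure sᶜ := by
    calc 1 = p.toOuterMeasure Set.univ :=
          ((p.toOuterMeasure_apply_eq_one_iff _).mpr (Set.subset_univ _)).symm
      _ = p.toOuterMeasure (s ∪ sᶜ) := by rw [Set.union_compl_self]
      _ ≤ _ := measure_union_le _ _
  have h2 : (2 / 3 : ℝ≥0∞) + 1 / 3 = 1 := by
    rw [ENNReal.div_add_div_same]
    norm_num
    exact ENNReal.div_self (by norm_num) (by norm_num)
  have h3 : (1 / 3 : ℝ≥0∞) ≠ ⊤ := by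
    exact ENNReal.div_ne_top (by norm_num) (by norm_num)
  rw [← ENNReal.add_le_add_iff_right h3, h2]
  exact h1.trans (by gcongr)

/-- A coupling transfers lower bounds for probabilities from the abstract return counts to runs of
the program. -/
theorem Sim.toOuterMeasure_le {n : ℕ} [NeZero n] {col : Fin n → PMF (Fin n)} {α : Type} {F : ℕ}
    {p : Prog} {s : State n} {D : PMF α} {R : α → State n → Prop} (h : Sim col F p s D R)
    {t : Set α} {u : Set (Option (State n))} (ht : ∀ a s', R a s' → a ∈ t → some s' ∈ u) :
    D.toOuterMeasure t ≤ (exec col F p s).toOuterMeasure u := by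
  obtain ⟨J, h1, h2, h3⟩ := h F le_rfl
  rw [h2, ← h1, PMF.toOuterMeasure_map_apply, PMF.toOuterMeasure_map_apply]
  refine PMF.toOuterMeasure_mono _ ?_
  rintro x ⟨hx, hs⟩
  exact ht _ _ (h3 x hs) hx

theorem Sim.of_mem_support {n : ℕ} [NeZero n] {col : Fin n → PMF (Fin n)} {α : Type} {F : ℕ}
    {p : Prog} {s : State n} {D : PMF α} {R : α → State n → Prop} (h : Sim col F p s D R)
    {r : Option (State n)} (hr : r ∈ (exec col F p s).support) : ∃ a s', r = some s' ∧ R a s' := by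
  obtain ⟨J, -, h2, h3⟩ := h F le_rfl
  rw [h2, PMF.mem_support_map_iff] at hr
  obtain ⟨x, hx, rfl⟩ := hr
  exact ⟨_, _, rfl, h3 x hx⟩

end

end SpectralSampling

theorem theorem3 :
    ∃ (P : SpectralSampling.Prog) (C : ℝ), 0 < C ∧
      ∀ (n : ℕ) [NeZero n] (A Q : Matrix (Fin n) (Fin n) ℝ) (lam : Fin n → ℝ)
        (hA : A ∈ Matrix.colStochastic ℝ (Fin n)),
        IsUnit Q →
        A = Q * Matrix.diagonal lam * Q⁻¹ →
        (∀ i, lam i ∈ Set.Icc (-1 : ℝ) 1) →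
        ∀ ε : ℝ, 0 < ε →
          ∃ fuel : ℕ,
            (∀ r ∈ (SpectralSampling.exec (SpectralSampling.column A hA) fuel P
                (SpectralSampling.State.init n ⌈1 / ε⌉₊)).support,
              ∃ s : SpectralSampling.State n, r = some s ∧
                (s.time : ℝ) ≤ C * Real.exp (C / ε) ∧
                (s.queries : ℝ) ≤ C * Real.exp (C / ε)) ∧
            (2 / 3 : ENNReal) ≤
              (SpectralSampling.exec (SpectralSampling.column A hA) fuel P
                (SpectralSampling.State.init n ⌈1 / ε⌉₊)).toOuterMeasure
                {r | ∃ s : SpectralSampling.State n, r = some s ∧ s.WellFormed ∧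
                  SpectralSampling.W1 s.output (SpectralSampling.spectralDistribution lam)
                    ≤ ENNReal.ofReal ε} := by
  open SpectralSampling in
  refine ⟨spectralProgram, timeConstant, timeConstant_pos, ?_⟩
  intro n _ A Q lam hA hQ hAQ hlam ε hε
  have hlam' : ∀ l, |lam l| ≤ 1 := fun l => abs_le.mpr (hlam l)
  have hε' : 0 < 1 / ε := by positivity
  obtain ⟨k, hkdef⟩ : ∃ k, k = ⌈1 / ε⌉₊ := ⟨_, rfl⟩
  have hk1 : 1 ≤ k := hkdef ▸ Nat.ceil_pos.mpr hε'
  have hkle : (k : ℝ) ≤ 1 / ε + 1 := hkdef ▸ (Nat.ceil_lt_add_one hε'.le).le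
  have hkge : 1 / ε ≤ k := hkdef ▸ Nat.le_ceil _
  rw [← hkdef]
  obtain ⟨m, hm⟩ : ∃ m, m = 256 * k := ⟨_, rfl⟩
  obtain ⟨G, hG⟩ : ∃ G, G = 65536 ^ m := ⟨_, rfl⟩
  have hm1 : 1 ≤ m := by omega
  obtain ⟨F, hF⟩ := sim_spectralProgram (column A hA) hm1 hG hm
  refine ⟨F, fun r hr => ?_, ?_⟩
  · obtain ⟨M, s, rfl, -, -, ht, hq⟩ := hF.of_mem_support hr
    have hc := cost_le hm hG hε hkle
    refine ⟨s, rfl, le_trans ?_ hc, le_trans ?_ hc⟩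
    · exact_mod_cast ht.trans (totalTime_le hm1 hG)
    · exact_mod_cast hq.trans (queries_bound hm1 hG)
  · have hbad := reps_bad_le hA (L := 8 * m) (G := G) (M₀ := startCount G)
      (by have := (mul_add_le_grid hm1 hG).1; omega) (by simp [startCount])
      (fun j hj => by simp [startCount, hj.ne'])
    refine (two_thirds_le_of_compl _ {M | ∀ j ≤ 8 * m, |(M j : ℝ) - (G : ℝ) ^ 3 * returnProb A j| ≤
      (G : ℝ) ^ 2} hbad).trans (hF.toOuterMeasure_le ?_)
    rintro M s ⟨hU, henc, -, -⟩ hM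
    have hM' : ∀ j ≤ 8 * m, |(M j : ℝ) - (G : ℝ) ^ 3 * ((∑ l, lam l ^ j) / n)| ≤ (G : ℝ) ^ 2 :=
      fun j hj => by rw [← returnProb_eq hQ hAQ]; exact hM j hj
    obtain ⟨h0, hpos, hW⟩ := W1_weights_le hk1 hm hG hlam' hM'
      (weights_accurate hm1 hG hlam' hU hM')
    refine ⟨s, rfl, henc.wellFormed (by rw [hG]; positivity) h0 hpos, ?_⟩
    rw [henc.output_eq]
    refine hW.trans (ENNReal.ofReal_le_ofReal ?_)
    rw [div_le_iff₀ (by exact_mod_cast hk1)]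
    rw [div_le_iff₀ hε] at hkge
    linarith
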